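/- Let $a>0$ and let $D_a=-i\alpha\cdot\nabla+a\beta$ be the Dirac operator on $L^2=L^2(\mathbb R^3,\mathbb C^4)$. Let $E=\mathcal D(|D_a|^{1/2})$, with inner product $\langle u,v\rangle=\mathrm{Re}\,(|D_a|^{1/2}u,|D_a|^{1/2}v)_{L^2}$ and norm $\|\cdot\|$, and let $E=E^+\oplus E^-$, $u=u^++u^-$, be the decomposition into the positive and negative spectral subspaces of $D_a$. Let $W\in L^\infty(\mathbb R^3,\mathbb R)$ with $|W|_\infty<a$, and let $g:\mathbb R^3\times[0,\infty)\to\mathbb R$ be measurable in $x$ and such that, for every $x$, the function $s\mapsto g(x,s)s$ is of class $C^1$ on $[0,\infty)$. Suppose that (i) $g(x,s)s\ge 0$ for all $x\in\mathbb R^3$ and $s\ge0$; (ii) $g(x,s)s=o(s)$ as $s\to0$, uniformly in $x\in\mathbb R^3$; (iii) there is $C>0$ with $0\le\partial_s\big(g(x,s)s\big)\le C(1+s)$ for all $x\in\mathbb R^3$ and $s>0$; (iv) $\partial_s g(x,s)>0$ for all $x\in\mathbb R^3$ and $s>0$. Put $G(x,s)=\int_0^s g(x,t)t\,dt$ and $$J(u)=\tfrac12\big(\|u^+\|^2-\|u^-\|^2\big)+\tfrac12\int_{\mathbb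 R^3}W(x)|u|^2\,dx-\int_{\mathbb R^3}G(x,|u|)\,dx,\qquad u\in E .$$ Then $J$ is differentiable; for each $v\in E^+$ there is exactly one $w=h_J(v)\in E^-$ with $DJ(v+w)[\phi]=0$ for all $\phi\in E^-$; and the reduced functional $I:E^+\to\mathbb R$, $I(v)=J(v+h_J(v))$, is differentiable. Moreover, for every $v\in E^+\setminus\{0\}$ the function $$H(t)=I(tv)-\frac t2\,I'(tv)[v],\qquad t\in\mathbb R,$$ is of class $C^1$, and $H'(t)>0$ for all $t>0$. -/

import Mathlib

open MeasureTheory Set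
open scoped ENNReal FourierTransform

noncomputable section

namespace NonlinearDirac

/-- Physical space `ℝ³`, with its Euclidean norm. -/
abbrev Space : Type := EuclideanSpace ℝ (Fin 3)

/-- Spinors `ℂ⁴`, with their Hermitian norm. -/
abbrev Spinor : Type := EuclideanSpace ℂ (Fin 4)

/-- `L² = L²(ℝ³, ℂ⁴)`. -/
abbrev L2 : Type := Lp Spinor 2 (volume : Measure Space)

/-- The Dirac matrices `α₁, α₂, α₃`: the off-diagonal blocks of `α k` are the Pauli matrix `σ k`. -/
def alphaMat : Fin 3 → Matrix (Fin 4) (Fin 4) ℂ :=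
  ![!![0, 0, 0, 1; 0, 0, 1, 0; 0, 1, 0, 0; 1, 0, 0, 0],
    !![0, 0, 0, -Complex.I; 0, 0, Complex.I, 0; 0, -Complex.I, 0, 0; Complex.I, 0, 0, 0],
    !![0, 0, 1, 0; 0, 0, 0, -1; 1, 0, 0, 0; 0, -1, 0, 0]]

/-- The Dirac matrix `β = diag(1, 1, -1, -1)`. -/
def betaMat : Matrix (Fin 4) (Fin 4) ℂ :=
  !![1, 0, 0, 0; 0, 1, 0, 0; 0, 0, -1, 0; 0, 0, 0, -1]

/-- The symbol of `D_a = -i α·∇ + a β`. Mathlib's Fourier transform is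
`û(ξ) = ∫ exp(-2πi ⟨x, ξ⟩) u(x) dx`, so `-i ∂_k` becomes multiplication by `2π ξ_k`, and
`(D_a u)^(ξ) = (∑ₖ 2π ξ_k α_k + a β) û(ξ)`. -/
def symbolMat (a : ℝ) (ξ : Space) : Matrix (Fin 4) (Fin 4) ℂ :=
  ∑ k : Fin 3, ((2 * Real.pi * ξ k : ℝ) : ℂ) • alphaMat k + (a : ℂ) • betaMat

/-- The symbol of `D_a`, as a linear map on spinors. -/
def symbol (a : ℝ) (ξ : Space) : Spinor →L[ℂ] Spinor :=
  Matrix.toEuclideanCLM (n := Fin 4) (𝕜 := ℂ) (symbolMat a ξ)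

/-- The symbol `√(a² + |2πξ|²)` of `|D_a|`. -/
def omega (a : ℝ) (ξ : Space) : ℝ :=
  Real.sqrt (a ^ 2 + (2 * Real.pi * ‖ξ‖) ^ 2)

/-! ### Algebra of the symbol: it is Hermitian, and its square is `ω²` -/

lemma omega_nonneg (a : ℝ) (ξ : Space) : 0 ≤ omega a ξ := Real.sqrt_nonneg _

lemma omega_sq (a : ℝ) (ξ : Space) :
    omega a ξ ^ 2 = a ^ 2 + (2 * Real.pi) ^ 2 * (ξ 0 ^ 2 + ξ 1 ^ 2 + ξ 2 ^ 2) := by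
  rw [omega, Real.sq_sqrt (by positivity), mul_pow, EuclideanSpace.real_norm_sq_eq,
    Fin.sum_univ_three]

lemma omega_pos (a : ℝ) {ξ : Space} (h : ξ ≠ 0) : 0 < omega a ξ := by
  have h1 : 0 < ‖ξ‖ := norm_pos_iff.mpr h
  have := Real.pi_pos
  exact Real.sqrt_pos.mpr (by positivity)

lemma continuous_omega (a : ℝ) : Continuous (omega a) := by
  unfold omega; fun_prop

lemma symbolMat_isHermitian (a : ℝ) (ξ : Space) : (symbolMat a ξ).IsHermitian := by
  ext i j
  fin_cases i <;> fin_cases j <;>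
    simp [symbolMat, alphaMat, betaMat, Fin.sum_univ_three, Matrix.conjTranspose_apply]

lemma symbolMat_mul_self (a : ℝ) (ξ : Space) :
    symbolMat a ξ * symbolMat a ξ = ((omega a ξ ^ 2 : ℝ) : ℂ) • 1 := by
  have hI := Complex.I_sq
  rw [omega_sq]
  ext i j
  fin_cases i <;> fin_cases j <;>
    simp [symbolMat, alphaMat, betaMat, Fin.sum_univ_three, Matrix.mul_apply,
      Fin.sum_univ_four] <;> ring_nf <;> simp [hI]

lemma norm_symbol_apply (a : ℝ) (ξ : Space) (x : Spinor) :
    ‖symbol a ξ x‖ = omega a ξ * ‖x‖ := by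
  have hadj : ContinuousLinearMap.adjoint (symbol a ξ) = symbol a ξ := by
    rw [← ContinuousLinearMap.star_eq_adjoint]
    simp only [symbol]
    rw [← map_star, Matrix.star_eq_conjTranspose, (symbolMat_isHermitian a ξ).eq]
  have hsq : symbol a ξ (symbol a ξ x) = ((omega a ξ ^ 2 : ℝ) : ℂ) • x := by
    have : symbol a ξ * symbol a ξ = ((omega a ξ ^ 2 : ℝ) : ℂ) • 1 := by
      simp only [symbol]
      rw [← map_mul, symbolMat_mul_self, map_smul, map_one]
    simpa using congrArg (fun L : Spinor →L[ℂ] Spinor => L x) this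
  have h : ‖symbol a ξ x‖ ^ 2 = (omega a ξ * ‖x‖) ^ 2 := by
    rw [← inner_self_eq_norm_sq (𝕜 := ℂ), ← ContinuousLinearMap.adjoint_inner_right, hadj, hsq,
      inner_smul_right, ← Complex.coe_algebraMap]
    simp [mul_pow, ← Complex.ofReal_pow, inner_self_eq_norm_sq_to_K]
  exact (sq_eq_sq₀ (norm_nonneg _) (mul_nonneg (omega_nonneg _ _) (norm_nonneg _))).mp h

lemma continuous_symbol (a : ℝ) : Continuous (symbol a) := by
  have : symbol a = fun ξ : Space => ∑ k : Fin 3, ((2 * Real.pi * ξ k : ℝ) : ℂ) •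
      Matrix.toEuclideanCLM (n := Fin 4) (𝕜 := ℂ) (alphaMat k) +
      (a : ℂ) • Matrix.toEuclideanCLM (n := Fin 4) (𝕜 := ℂ) betaMat := by
    funext ξ
    simp only [symbol, symbolMat, map_add, map_sum, map_smul]
  rw [this]
  fun_prop

/-- The symbol of the sign `D_a |D_a|⁻¹` of `D_a` (at `ξ = 0` and `a = 0` it is `0`). -/
def signSymbol (a : ℝ) (ξ : Space) : Spinor →L[ℂ] Spinor :=
  ((omega a ξ)⁻¹ : ℝ) • symbol a ξ

lemma norm_signSymbol_apply_le (a : ℝ) (ξ : Space) (x : Spinor) :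
    ‖signSymbol a ξ x‖ ≤ ‖x‖ := by
  have h0 := omega_nonneg a ξ
  simp only [signSymbol, smul_apply, norm_smul, norm_symbol_apply,
    Real.norm_eq_abs, abs_inv, abs_of_nonneg h0, ← mul_assoc]
  rcases h0.eq_or_lt with h | h
  · simp [← h]
  · rw [inv_mul_cancel₀ h.ne', one_mul]

lemma stronglyMeasurable_signSymbol (a : ℝ) : StronglyMeasurable (signSymbol a) :=
  ((continuous_omega a).measurable.inv.stronglyMeasurable).smul
    (continuous_symbol a).stronglyMeasurable

lemma fourier_real_smul (c : ℝ) (u : L2) : 𝓕 (c • u) = c • 𝓕 u :=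
  ((Lp.fourierTransformₗᵢ Space Spinor).toLinearEquiv.toLinearMap.restrictScalars ℝ).map_smul c u

lemma fourierInv_real_smul (c : ℝ) (u : L2) : 𝓕⁻ (c • u) = c • 𝓕⁻ u :=
  ((Lp.fourierTransformₗᵢ Space Spinor).symm.toLinearEquiv.toLinearMap.restrictScalars ℝ).map_smul
    c u

/-! ### The form domain `E` of `D_a` -/

/-- The form domain of `D_a`, i.e. the domain of `|D_a|^{1/2}`, as a subspace of `L²`
(regarded as a real vector space). -/
def formDomain (a : ℝ) : Submodule ℝ L2 where
  carrier := {u | MemLp (fun ξ => Real.sqrt (omega a ξ) • (𝓕 u : L2) ξ) 2 volume}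
  zero_mem' := by
    have h : (𝓕 (0 : L2) : L2) = 0 := FourierTransform.fourier_zero
    change MemLp _ 2 volume
    rw [h]
    refine (memLp_congr_ae ?_).mpr (MemLp.zero' (p := 2))
    filter_upwards [Lp.coeFn_zero Spinor 2 (volume : Measure Space)] with ξ hξ
    simp [hξ]
  add_mem' := by
    intro u v hu hv
    refine (memLp_congr_ae ?_).mpr (MemLp.add hu hv)
    rw [FourierTransform.fourier_add]
    filter_upwards [Lp.coeFn_add (𝓕 u : L2) (𝓕 v : L2)] with ξ hξ
    rw [hξ]
    simp only [Pi.add_apply]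
    exact smul_add _ _ _
  smul_mem' := by
    intro c u hu
    refine (memLp_congr_ae ?_).mpr (MemLp.const_smul hu c)
    rw [fourier_real_smul]
    filter_upwards [Lp.coeFn_smul c (𝓕 u : L2)] with ξ hξ
    rw [hξ]
    simp only [Pi.smul_apply]
    exact smul_comm _ _ _

/-- The space `E = 𝒟(|D_a|^{1/2})`. It is a type of its own since it does not carry the norm
of `L²` but the norm `‖u‖ = | |D_a|^{1/2} u |₂`, defined below. -/
def E (a : ℝ) : Type := formDomain a

instance (a : ℝ) : AddCommGroup (E a) := inferInstanceAs (AddCommGroup (formDomain a))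

instance (a : ℝ) : Module ℝ (E a) := inferInstanceAs (Module ℝ (formDomain a))

/-- The inclusion `E ⊆ L²`. -/
def toL2 (a : ℝ) : E a →ₗ[ℝ] L2 := (formDomain a).subtype

lemma toL2_injective (a : ℝ) : Function.Injective (toL2 a) := (formDomain a).injective_subtype

lemma memLp_sqrt_omega {a : ℝ} (u : E a) :
    MemLp (fun ξ => Real.sqrt (omega a ξ) • (𝓕 (toL2 a u) : L2) ξ) 2 volume := u.2

/-- The operator `|D_a|^{1/2} : E → L²`, the Fourier multiplier with symbol `√ω`. -/
def absSqrt (a : ℝ) : E a →ₗ[ℝ] L2 where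
  toFun u := 𝓕⁻ ((memLp_sqrt_omega u).toLp _)
  map_add' u v := by
    rw [← FourierTransform.fourierInv_add]
    congr 1
    rw [← MemLp.toLp_add]
    refine MemLp.toLp_congr _ _ ?_
    rw [map_add, FourierTransform.fourier_add]
    filter_upwards [Lp.coeFn_add (𝓕 (toL2 a u) : L2) (𝓕 (toL2 a v) : L2)] with ξ hξ
    rw [hξ]
    simp only [Pi.add_apply]
    exact smul_add _ _ _
  map_smul' c u := by
    rw [RingHom.id_apply, ← fourierInv_real_smul]
    congr 1
    rw [← MemLp.toLp_const_smul]
    refine MemLp.toLp_congr _ _ ?_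
    rw [map_smul, fourier_real_smul]
    filter_upwards [Lp.coeFn_smul c (𝓕 (toL2 a u) : L2)] with ξ hξ
    rw [hξ]
    simp only [Pi.smul_apply]
    exact smul_comm _ _ _

lemma fourier_absSqrt (a : ℝ) (u : E a) :
    (𝓕 (absSqrt a u) : L2) =ᵐ[volume]
      fun ξ => Real.sqrt (omega a ξ) • (𝓕 (toL2 a u) : L2) ξ := by
  have : (𝓕 (absSqrt a u) : L2) = (memLp_sqrt_omega u).toLp _ := by
    simp [absSqrt, FourierTransform.fourier_fourierInv_eq]
  rw [this]
  exact MemLp.coeFn_toLp _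

lemma absSqrt_injective (a : ℝ) : Function.Injective (absSqrt a) := by
  rw [injective_iff_map_eq_zero]
  intro u hu
  apply toL2_injective a
  rw [map_zero]
  have h1 := fourier_absSqrt a u
  have h0 : (𝓕 (0 : L2) : L2) = 0 := FourierTransform.fourier_zero
  rw [hu, h0] at h1
  have h2 : (𝓕 (toL2 a u) : L2) = 0 := by
    rw [Lp.eq_zero_iff_ae_eq_zero]
    have hne : ∀ᵐ ξ : Space ∂volume, ξ ≠ 0 := by
      simp [ae_iff, measure_singleton]
    filter_upwards [h1, hne, Lp.coeFn_zero Spinor 2 (volume : Measure Space)] with ξ h hξ hz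
    rw [hz] at h
    have hs : Real.sqrt (omega a ξ) ≠ 0 := (Real.sqrt_pos.mpr (omega_pos a hξ)).ne'
    simpa [hs] using h.symm
  have := congrArg (fun w : L2 => (𝓕⁻ w : L2)) h2
  simp only [FourierTransform.fourierInv_fourier_eq] at this
  rw [this]
  simpa using fourierInv_real_smul 0 0

/-- The inner product `⟨u, v⟩ = Re (|D_a|^{1/2} u, |D_a|^{1/2} v)₂` of `E`. -/
abbrev innerCore (a : ℝ) : InnerProductSpace.Core ℝ (E a) where
  inner u v := (inner ℂ (absSqrt a u) (absSqrt a v)).re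
  conj_inner_symm u v := by
    simpa using inner_re_symm (𝕜 := ℂ) (absSqrt a v) (absSqrt a u)
  re_inner_nonneg u := by
    simpa using inner_self_nonneg (𝕜 := ℂ) (x := absSqrt a u)
  add_left u v w := by simp [inner_add_left]
  smul_left u v c := by
    have h : (c • absSqrt a u : L2) = (c : ℂ) • absSqrt a u := (Complex.coe_smul c _).symm
    rw [map_smul, h, inner_smul_left]
    simp
  definite u h := by
    apply absSqrt_injective a
    rw [map_zero]
    exact (inner_self_eq_zero (𝕜 := ℂ)).mp (by
      apply Complex.ext
      · simpa using h
      · simpa using inner_self_im (𝕜 := ℂ) (absSqrt a u))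

instance (a : ℝ) : NormedAddCommGroup (E a) :=
  @InnerProductSpace.Core.toNormedAddCommGroup ℝ (E a) _ _ _ (innerCore a)

instance (a : ℝ) : InnerProductSpace ℝ (E a) :=
  InnerProductSpace.ofCore (innerCore a).toCore

/-- The norm of `E` is `‖u‖ = | |D_a|^{1/2} u |₂`. -/
lemma norm_eq (a : ℝ) (u : E a) : ‖u‖ = ‖absSqrt a u‖ := by
  have h1 : ‖u‖ ^ 2 = (inner ℂ (absSqrt a u) (absSqrt a u)).re :=
    (real_inner_self_eq_norm_sq u).symm
  have h2 : (inner ℂ (absSqrt a u) (absSqrt a u)).re = ‖absSqrt a u‖ ^ 2 :=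
    inner_self_eq_norm_sq (𝕜 := ℂ) (absSqrt a u)
  exact (sq_eq_sq₀ (norm_nonneg _) (norm_nonneg _)).mp (h1.trans h2)

/-! ### The decomposition `E = E⁺ ⊕ E⁻` -/

lemma memLp_signSymbol (a : ℝ) (f : L2) : MemLp (fun ξ => signSymbol a ξ (f ξ)) 2 volume := by
  refine MemLp.of_le (Lp.memLp f) ?_ (Filter.Eventually.of_forall fun ξ =>
    norm_signSymbol_apply_le a ξ _)
  exact (ContinuousLinearMap.apply ℂ Spinor).flip.aestronglyMeasurable_comp₂
    (stronglyMeasurable_signSymbol a).aestronglyMeasurable (Lp.aestronglyMeasurable f)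

/-- The sign `D_a |D_a|⁻¹` of `D_a`, as an operator on `L²`. -/
def signL2 (a : ℝ) (u : L2) : L2 := 𝓕⁻ ((memLp_signSymbol a (𝓕 u)).toLp _)

lemma fourier_signL2 (a : ℝ) (u : L2) :
    (𝓕 (signL2 a u) : L2) =ᵐ[volume] fun ξ => signSymbol a ξ ((𝓕 u : L2) ξ) := by
  have : (𝓕 (signL2 a u) : L2) = (memLp_signSymbol a (𝓕 u)).toLp _ := by
    simp [signL2, FourierTransform.fourier_fourierInv_eq]
  rw [this]
  exact MemLp.coeFn_toLp _

lemma signL2_mem {a : ℝ} (u : L2) (hu : u ∈ formDomain a) : signL2 a u ∈ formDomain a := by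
  change MemLp _ 2 volume at hu
  change MemLp _ 2 volume
  refine MemLp.of_le hu ?_ ?_
  · exact ((continuous_omega a).sqrt.aestronglyMeasurable).smul (Lp.aestronglyMeasurable _)
  · filter_upwards [fourier_signL2 a u] with ξ hξ
    rw [hξ, norm_smul, norm_smul]
    exact mul_le_mul_of_nonneg_left (norm_signSymbol_apply_le a ξ _) (norm_nonneg _)

/-- The sign `D_a |D_a|⁻¹` of `D_a`, as an operator on `E`. -/
def signOp (a : ℝ) : E a →ₗ[ℝ] E a where
  toFun u := ⟨signL2 a (toL2 a u), signL2_mem _ u.2⟩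
  map_add' u v := by
    apply toL2_injective a
    change signL2 a (toL2 a (u + v)) = signL2 a (toL2 a u) + signL2 a (toL2 a v)
    simp only [signL2]
    rw [← FourierTransform.fourierInv_add]
    congr 1
    rw [← MemLp.toLp_add]
    refine MemLp.toLp_congr _ _ ?_
    rw [map_add, FourierTransform.fourier_add]
    filter_upwards [Lp.coeFn_add (𝓕 (toL2 a u) : L2) (𝓕 (toL2 a v) : L2)] with ξ hξ
    rw [hξ]
    exact map_add (signSymbol a ξ) _ _
  map_smul' c u := by
    apply toL2_injective a
    change signL2 a (toL2 a (c • u)) = c • signL2 a (toL2 a u)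
    simp only [signL2]
    rw [← fourierInv_real_smul]
    congr 1
    rw [← MemLp.toLp_const_smul]
    refine MemLp.toLp_congr _ _ ?_
    rw [map_smul, fourier_real_smul]
    filter_upwards [Lp.coeFn_smul c (𝓕 (toL2 a u) : L2)] with ξ hξ
    rw [hξ]
    exact ((signSymbol a ξ).restrictScalars ℝ).map_smul c _

/-- The spectral projection `u ↦ u⁺ = ½ (1 + sgn D_a) u` onto the positive subspace of `D_a`. -/
def projPlus (a : ℝ) : E a →ₗ[ℝ] E a := (1 / 2 : ℝ) • (LinearMap.id + signOp a)

/-- The spectral projection `u ↦ u⁻ = ½ (1 - sgn D_a) u` onto the negative subspace of `D_a`. -/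
def projMinus (a : ℝ) : E a →ₗ[ℝ] E a := (1 / 2 : ℝ) • (LinearMap.id - signOp a)

/-- `E⁺`, the positive spectral subspace of `D_a` in `E`. -/
def EPlus (a : ℝ) : Submodule ℝ (E a) := LinearMap.range (projPlus a)

/-- `E⁻`, the negative spectral subspace of `D_a` in `E`. -/
def EMinus (a : ℝ) : Submodule ℝ (E a) := LinearMap.range (projMinus a)

/-! ### The functional and its reduction -/

/-- The functional
`J(u) = ½ (‖u⁺‖² - ‖u⁻‖²) + ½ ∫ W(x) |u|² dx - ∫ G(x, |u|) dx`, `G(x, s) = ∫₀ˢ g(x, t) t dt`. -/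
def functional (a : ℝ) (W : Space → ℝ) (g : Space → ℝ → ℝ) (u : E a) : ℝ :=
  1 / 2 * (‖projPlus a u‖ ^ 2 - ‖projMinus a u‖ ^ 2)
    + 1 / 2 * (∫ x : Space, W x * ‖toL2 a u x‖ ^ 2)
    - (∫ x : Space, ∫ t in (0 : ℝ)..‖toL2 a u x‖, g x t * t)

/-- The critical point equation that defines the reduction map:
`DJ(v + w)[φ] = 0` for all `φ ∈ E⁻`. -/
def IsCriticalAlongMinus {a : ℝ} (J : E a → ℝ) (v : EPlus a) (w : EMinus a) : Prop :=
  ∀ φ : EMinus a, fderiv ℝ J ((v : E a) + (w : E a)) (φ : E a) = 0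

/-- The reduction map `h_J : E⁺ → E⁻`: `h_J(v)` is the element `w` of `E⁻` with
`DJ(v + w)[φ] = 0` for all `φ ∈ E⁻`. (Where there are several such `w`, or none, the value
is arbitrary.) -/
def reductionMap {a : ℝ} (J : E a → ℝ) (v : EPlus a) : EMinus a :=
  Classical.epsilon fun w : EMinus a => IsCriticalAlongMinus J v w

/-- The reduced functional `J^red(v) = J(v + h_J(v))` on `E⁺`. -/
def reducedFunctional {a : ℝ} (J : E a → ℝ) (v : EPlus a) : ℝ :=
  J ((v : E a) + (reductionMap J v : E a))

/-- The assumptions on the nonlinearity `g`. -/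
structure IsAdmissible (g : Space → ℝ → ℝ) : Prop where
  /-- `g(·, s)` is Lebesgue measurable. -/
  measurable : ∀ s : ℝ, 0 < s → AEMeasurable (fun x => g x s) volume
  /-- `s ↦ g(x, s) s` is of class `C¹` on `[0, ∞)`. -/
  contDiffOn : ∀ x, ContDiffOn ℝ 1 (fun s => g x s * s) (Ici 0)
  nonneg : ∀ x, ∀ s : ℝ, 0 ≤ s → 0 ≤ g x s * s
  /-- `g(x, s) s = o(s)` as `s → 0`, uniformly in `x`. -/
  isLittleO : ∀ ε : ℝ, 0 < ε → ∃ δ : ℝ, 0 < δ ∧ ∀ x, ∀ s : ℝ, 0 < s → s < δ → g x s * s ≤ ε * s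
  /-- `0 ≤ ∂ₛ(g(x, s) s) ≤ C (1 + s)`. -/
  deriv_bound : ∃ C : ℝ, ∀ x, ∀ s : ℝ, 0 < s →
    0 ≤ deriv (fun τ => g x τ * τ) s ∧ deriv (fun τ => g x τ * τ) s ≤ C * (1 + s)
  /-- `∂ₛ g(x, s) > 0`. -/
  deriv_pos : ∀ x, ∀ s : ℝ, 0 < s → 0 < deriv (fun τ => g x τ) s

end NonlinearDirac

end

/-!
The derivative of `H` has the sign of a pointwise quantity; the work lies in the regularity that is
needed to compute it.

For `u ∈ E` and `χ ∈ E⁻` write `y` and `χ` for `u(x)` and `χ(x)`, and put `N(y) = g(x, |y|) y`.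
Where `y ≠ 0`,
`⟨N'(y)(y + χ), y + χ⟩ - ⟨N(y), y + 2χ⟩ = g(x, |y|) |χ|² + ∂ₛg(x, |y|) |y|⁻¹ ⟨y, y + χ⟩² ≥ 0`
(`inner_radialField_le`), and for `χ = 0` this is positive. The quadratic part of `J` contributes
`‖χ‖² - ∫ W |χ|² ≥ (1 - |W|_∞ / a) ‖χ‖²`, because `a |χ|₂² ≤ ‖χ‖²`. Hence
`J'(u)[u + 2χ] - J''(u)[u + χ, u + χ] > 0` for `u ≠ 0` (`functionalHessian_lt`). If
`u = u(t) = t v + h(t v)`, then `J'(u)` vanishes on `E⁻` by definition of `h`, and so does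
`J''(u)[∂ₜu, ·]`, by differentiating in `t`; with `u + χ = t ∂ₜu` the difference is exactly
`2 t H'(t)` (`IsReducible.deriv_reduced_sub_pos`).

The continuity of `∂ₛg(x, ·)` is not assumed to be uniform in `x`, and `J` need not be of class
`C²`. What holds is that `J'` is Lipschitz on bounded sets and Gateaux differentiable, with a
derivative `J''(u)` for which `u ↦ J''(u) ξ` is continuous at each fixed `ξ`
(`IsCubicPotential.tendsto_slope_gradient`, `IsCubicPotential.continuous_hessian_apply`). This comes
from a weighted Cauchy–Schwarz inequality and dominated convergence (`tendsto_fieldPairing_zero`),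
and needs only that `E` embeds into `L² ∩ L³`.

The implicit function theorem does not apply to such a `J`; the strong concavity of `J` along `E⁻`
replaces it: `w ↦ J(v + w)` has exactly one critical point in `E⁻`, namely its maximum
(`IsReducible.exists_critical`, `IsReducible.critical_unique`); `h` is Lipschitz at each point, so
that `I'(v) = J'(v + h(v))` on `E⁺` (`IsReducible.hasFDerivAt_reduced`); and comparing `u(t + r)`
with `u(t) + r ξ`, where `ξ` solves the linearized equation by Lax–Milgram, shows that `u` is
differentiable with `∂ₜu = ξ`, continuous in `t` (`IsReducible.hasDerivAt_curve`,
`IsReducible.continuous_velocity`). So `H` is of class `C¹` without continuity of `J''` in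
the operator norm.

The embedding `H^{1/2}(ℝ³) ⊆ L³(ℝ³)` (`lintegral_enorm_cube_le`) is proved by splitting frequencies:
to estimate the measure of `{|u| > t}`, one cuts at a frequency proportional to `t`, chosen such
that the low part of `u` is at most `t / 2`; Chebyshev's inequality and Plancherel's theorem bound
the measure by the high part, and integrating against `3 t² dt` gives the norm of `L³`.
-/

noncomputable section

namespace NonlinearDirac

/-! ### The Sobolev embedding `H^{1/2}(ℝ³) ⊆ L³(ℝ³)` -/

/-- On `L¹ ∩ L²` the inverse Fourier transform of `L²` is the Fourier integral. -/
theorem fourierInv_ae_eq_of_integrable {V F : Type*} [NormedAddCommGroup V]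
    [InnerProductSpace ℝ V] [FiniteDimensional ℝ V] [MeasurableSpace V] [BorelSpace V]
    [NormedAddCommGroup F] [InnerProductSpace ℂ F] [CompleteSpace F]
    (f : Lp F 2 (volume : Measure V)) (hf : Integrable f) :
    (𝓕⁻ f : Lp F 2 (volume : Measure V)) =ᵐ[volume] 𝓕⁻ (f : V → F) := by
  have hL : Continuous fun p : V × V => (-innerₗ V) p.1 p.2 := (continuous_inner (𝕜 := ℝ)).neg
  have hcont : Continuous (𝓕⁻ (f : V → F)) :=
    VectorFourier.fourierIntegral_continuous Real.continuous_fourierChar hL hf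
  apply ae_eq_of_integral_contDiff_smul_eq
  · exact (Lp.memLp _).locallyIntegrable (by norm_num)
  · exact hcont.locallyIntegrable
  · intro g g_smooth g_cpt
    have hg₁ : HasCompactSupport (Complex.ofRealCLM ∘ g) := g_cpt.comp_left rfl
    have hg₂ : ContDiff ℝ ((⊤ : ℕ∞) : WithTop ℕ∞) (Complex.ofRealCLM ∘ g) := by fun_prop
    have h1 := congrArg (fun T => T (hg₁.toSchwartzMap hg₂))
      (Lp.fourierInv_toTemperedDistribution_eq f)
    simp only [TemperedDistribution.fourierInv_apply, Lp.toTemperedDistribution_apply,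
      SchwartzMap.fourierInv_coe] at h1
    have h2 := VectorFourier.integral_fourierIntegral_smul_eq_flip (μ := volume) (ν := volume)
      (e := Real.fourierChar) (L := -innerₗ V) (f := hg₁.toSchwartzMap hg₂) (g := f)
      Real.continuous_fourierChar hL (SchwartzMap.integrable _) hf
    have h3 : (-innerₗ V).flip = -innerₗ V := by
      ext x y; simp [real_inner_comm]
    rw [h3] at h2
    have h5 := calc ∫ x, g x • (𝓕⁻ f : Lp F 2 (volume : Measure V)) x
        = ∫ x, (hg₁.toSchwartzMap hg₂) x • (𝓕⁻ f : Lp F 2 (volume : Measure V)) x := by simp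
      _ = ∫ x, (hg₁.toSchwartzMap hg₂) x • (𝓕⁻ (f : V → F)) x := h1.symm.trans h2
      _ = ∫ x, g x • (𝓕⁻ (f : V → F)) x := by simp
    exact h5

theorem norm_fourierInv_le_integral_norm {V F : Type*} [NormedAddCommGroup V]
    [InnerProductSpace ℝ V] [FiniteDimensional ℝ V] [MeasurableSpace V] [BorelSpace V]
    [NormedAddCommGroup F] [InnerProductSpace ℂ F] [CompleteSpace F]
    (f : Lp F 2 (volume : Measure V)) (hf : Integrable f) :
    ∀ᵐ x, ‖(𝓕⁻ f : Lp F 2 (volume : Measure V)) x‖ ≤ ∫ ξ, ‖f ξ‖ := by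
  filter_upwards [fourierInv_ae_eq_of_integrable f hf] with x hx
  rw [hx]
  exact VectorFourier.norm_fourierIntegral_le_integral_norm _ _ _ _ _

theorem lintegral_enorm_sq_eq {α F : Type*} [MeasurableSpace α] {μ : Measure α}
    [NormedAddCommGroup F] (f : Lp F 2 μ) : ∫⁻ x, ‖f x‖ₑ ^ 2 ∂μ = ‖f‖ₑ ^ 2 := by
  have h := eLpNorm_nnreal_pow_eq_lintegral (p := 2) (f := f) (μ := μ) (by norm_num)
  rw [Lp.enorm_def]
  simpa using h.symm

/-- `∫_{|ξ| ≤ A} |ξ|⁻¹ dξ = (3/2) |B₁| A²` in three dimensions. -/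
theorem integrable_inv_norm_closedBall {A : ℝ} (hA : 0 < A) :
    Integrable (fun ξ : Space => (Iic A).indicator (fun y : ℝ => y⁻¹) ‖ξ‖) ∧
    ∫ ξ : Space, (Iic A).indicator (fun y : ℝ => y⁻¹) ‖ξ‖
      = 3 / 2 * (volume : Measure Space).real (Metric.ball 0 1) * A ^ 2 := by
  have hfin : Module.finrank ℝ Space = 3 := by simp
  have heq : EqOn (fun y : ℝ => y ^ (Module.finrank ℝ Space - 1) •
      (Iic A).indicator (fun y : ℝ => y⁻¹) y) ((Iic A).indicator fun y => y) (Ioi 0) := by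
    intro y hy
    have hy' : y ≠ 0 := (mem_Ioi.mp hy).ne'
    by_cases h : y ∈ Iic A
    · simp only [h, indicator_of_mem, hfin, smul_eq_mul]; field_simp
    · simp [h]
  have hI : IntegrableOn ((Iic A).indicator fun y : ℝ => y) (Ioi 0) := by
    rw [integrableOn_indicator_iff measurableSet_Iic, inter_comm, Ioi_inter_Iic]
    exact (continuous_id.integrableOn_Icc).mono_set Ioc_subset_Icc_self
  refine ⟨?_, ?_⟩
  · rw [integrable_fun_norm_addHaar (volume : Measure Space)]
    exact hI.congr_fun heq.symm measurableSet_Ioi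
  · rw [integral_fun_norm_addHaar (volume : Measure Space), setIntegral_congr_fun
      measurableSet_Ioi heq, setIntegral_indicator measurableSet_Iic, Ioi_inter_Iic,
      ← intervalIntegral.integral_of_le hA.le, integral_id, hfin]
    simp only [nsmul_eq_mul, smul_eq_mul]
    push_cast
    ring

/-- The constant `c` with which `∫_{|ξ| ≤ A} |f| dξ ≤ c A M` whenever `∫ |ξ| |f|² dξ ≤ M²`. -/
def lowFreqConst : ℝ := 3 / 4 * (volume : Measure Space).real (Metric.ball 0 1) + 1 / 2

theorem lowFreqConst_pos : 0 < lowFreqConst := by unfold lowFreqConst; positivity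

/-- The frequencies `|ξ| ≤ A` of a function in `H^{1/2}(ℝ³)` are in `L¹`, with norm of order `A`.
This is the inequality `2 |f| ≤ (M / A) |ξ|⁻¹ + (A / M) |ξ| |f|²`, integrated. -/
theorem integral_norm_lowFreq_le {F : Type*} [NormedAddCommGroup F]
    (f : Lp F 2 (volume : Measure Space)) {M A : ℝ} (hM : 0 < M) (hA : 0 < A)
    (hint : Integrable (fun ξ : Space => ‖ξ‖ * ‖f ξ‖ ^ 2))
    (hle : ∫ ξ : Space, ‖ξ‖ * ‖f ξ‖ ^ 2 ≤ M ^ 2) :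
    Integrable ((Metric.closedBall (0 : Space) A).indicator f) ∧
    ∫ ξ, ‖(Metric.closedBall (0 : Space) A).indicator f ξ‖ ≤ lowFreqConst * A * M := by
  have hI := integrable_inv_norm_closedBall hA
  have hfi : Integrable ((Metric.closedBall (0 : Space) A).indicator f) := by
    rw [integrable_indicator_iff measurableSet_closedBall]
    have : IsFiniteMeasure ((volume : Measure Space).restrict (Metric.closedBall 0 A)) :=
      ⟨by
        rw [Measure.restrict_apply_univ]
        exact measure_closedBall_lt_top⟩
    exact ((Lp.memLp f).restrict _).integrable (by norm_num)
  refine ⟨hfi, ?_⟩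
  have hb := (hI.1.const_mul (M / A / 2)).add (hint.const_mul (A / M / 2))
  calc ∫ ξ, ‖(Metric.closedBall (0 : Space) A).indicator f ξ‖
      ≤ ∫ ξ : Space, (M / A / 2 * (Iic A).indicator (fun y : ℝ => y⁻¹) ‖ξ‖
          + A / M / 2 * (‖ξ‖ * ‖f ξ‖ ^ 2)) := by
        refine integral_mono_ae hfi.norm hb ?_
        have hne : ∀ᵐ ξ : Space ∂volume, ξ ≠ 0 := by simp [ae_iff, measure_singleton]
        filter_upwards [hne] with ξ hξ
        by_cases h : ξ ∈ Metric.closedBall (0 : Space) A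
        · have h' : ‖ξ‖ ∈ Iic A := by simpa using h
          have hξ0 : 0 < ‖ξ‖ := norm_pos_iff.mpr hξ
          rw [indicator_of_mem h, indicator_of_mem h']
          have key : M / A / 2 * ‖ξ‖⁻¹ + A / M / 2 * (‖ξ‖ * ‖f ξ‖ ^ 2) - ‖f ξ‖
              = (M - A * ‖ξ‖ * ‖f ξ‖) ^ 2 / (2 * M * A * ‖ξ‖) := by
            field_simp; ring
          have : 0 ≤ (M - A * ‖ξ‖ * ‖f ξ‖) ^ 2 / (2 * M * A * ‖ξ‖) := by positivity
          linarith
        · have h' : ‖ξ‖ ∉ Iic A := by simpa using h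
          rw [indicator_of_notMem h, indicator_of_notMem h']
          simp only [norm_zero, mul_zero, zero_add]
          positivity
    _ ≤ lowFreqConst * A * M := by
        rw [integral_add (hI.1.const_mul _) (hint.const_mul _), integral_const_mul,
          integral_const_mul, hI.2]
        have h1 : A / M / 2 * ∫ ξ : Space, ‖ξ‖ * ‖f ξ‖ ^ 2 ≤ A / M / 2 * M ^ 2 :=
          mul_le_mul_of_nonneg_left hle (by positivity)
        have h2 : M / A / 2 * (3 / 2 * (volume : Measure Space).real (Metric.ball 0 1) * A ^ 2)
            + A / M / 2 * M ^ 2 = lowFreqConst * A * M := by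
          unfold lowFreqConst; field_simp; ring
        linarith

/-- The weak-type estimate behind the embedding: cutting the frequencies at the level where the
low ones are bounded by `t / 2`, only the high ones contribute to `{|u| > t}`. -/
theorem meas_lt_norm_mul_sq_le {F : Type*} [NormedAddCommGroup F] [InnerProductSpace ℂ F]
    [CompleteSpace F] (u : Lp F 2 (volume : Measure Space)) {M t : ℝ} (hM : 0 < M) (ht : 0 < t)
    (hint : Integrable (fun ξ : Space => ‖ξ‖ * ‖(𝓕 u : Lp F 2 (volume : Measure Space)) ξ‖ ^ 2))
    (hle : ∫ ξ : Space, ‖ξ‖ * ‖(𝓕 u : Lp F 2 (volume : Measure Space)) ξ‖ ^ 2 ≤ M ^ 2) :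
    volume {x | t < ‖u x‖} * ENNReal.ofReal (t ^ 2) ≤
      4 * ∫⁻ ξ, (Iio (2 * lowFreqConst * M * ‖ξ‖)).indicator
        (fun _ => ‖(𝓕 u : Lp F 2 (volume : Measure Space)) ξ‖ₑ ^ 2) t := by
  set f : Lp F 2 (volume : Measure Space) := 𝓕 u with hf
  have hc := lowFreqConst_pos
  set A : ℝ := t / (2 * lowFreqConst * M) with hAdef
  have hA : 0 < A := by positivity
  obtain ⟨hi, hb⟩ := integral_norm_lowFreq_le f hM hA hint hle
  have hmem : MemLp ((Metric.closedBall (0 : Space) A).indicator f) 2 volume :=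
    (Lp.memLp f).indicator measurableSet_closedBall
  set fl : Lp F 2 (volume : Measure Space) := hmem.toLp _ with hfl
  have hfl_ae := hmem.coeFn_toLp
  have hul : ∀ᵐ x, ‖(𝓕⁻ fl : Lp F 2 (volume : Measure Space)) x‖ ≤ t / 2 := by
    have h1 := norm_fourierInv_le_integral_norm fl (hi.congr hfl_ae.symm)
    have h2 : ∫ ξ, ‖fl ξ‖ = ∫ ξ, ‖(Metric.closedBall (0 : Space) A).indicator f ξ‖ :=
      integral_congr_ae (hfl_ae.mono fun x hx => by simp only [hfl, hx])
    filter_upwards [h1] with x hx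
    refine hx.trans ((h2.le.trans hb).trans (le_of_eq ?_))
    rw [hAdef]; field_simp
  set uh : Lp F 2 (volume : Measure Space) := u - 𝓕⁻ fl with huh
  have hsub : ∀ᵐ x, t < ‖u x‖ → ENNReal.ofReal ((t / 2) ^ 2) ≤ ‖uh x‖ₑ ^ 2 := by
    filter_upwards [hul, Lp.coeFn_sub u (𝓕⁻ fl)] with x h1 h2 h3
    have h4 : t / 2 ≤ ‖uh x‖ := by
      rw [huh, h2, Pi.sub_apply]
      have := norm_sub_norm_le (u x) ((𝓕⁻ fl : Lp F 2 (volume : Measure Space)) x)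
      linarith
    rw [ENNReal.ofReal_pow (by positivity), ← ofReal_norm]
    gcongr
  have hcheb : ENNReal.ofReal ((t / 2) ^ 2) * volume {x | t < ‖u x‖} ≤ ∫⁻ x, ‖uh x‖ₑ ^ 2 := by
    refine le_trans ?_ (mul_meas_ge_le_lintegral₀
      ((Lp.aestronglyMeasurable uh).enorm.pow_const 2) (ENNReal.ofReal ((t / 2) ^ 2)))
    gcongr 1
    exact measure_mono_ae hsub
  have hplanch : ∫⁻ x, ‖uh x‖ₑ ^ 2 = ∫⁻ ξ, ‖(f - fl) ξ‖ₑ ^ 2 := by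
    rw [lintegral_enorm_sq_eq, lintegral_enorm_sq_eq]
    have h1 : f - fl = (Lp.fourierTransformₗᵢ Space F) uh := by
      rw [huh, map_sub]
      congr 1
      exact ((Lp.fourierTransformₗᵢ Space F).apply_symm_apply fl).symm
    have h2 : ‖f - fl‖ = ‖uh‖ := by
      rw [h1]; exact (Lp.fourierTransformₗᵢ Space F).norm_map uh
    rw [← ofReal_norm, ← ofReal_norm, h2]
  have hind : ∫⁻ ξ, ‖(f - fl) ξ‖ₑ ^ 2 =
      ∫⁻ ξ, (Iio (2 * lowFreqConst * M * ‖ξ‖)).indicator (fun _ => ‖f ξ‖ₑ ^ 2) t := by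
    refine lintegral_congr_ae ?_
    filter_upwards [Lp.coeFn_sub f fl, hfl_ae] with ξ h1 h2
    rw [h1, Pi.sub_apply, h2]
    have h3 : ξ ∈ Metric.closedBall (0 : Space) A ↔ ¬ t < 2 * lowFreqConst * M * ‖ξ‖ := by
      rw [mem_closedBall_zero_iff, hAdef, le_div_iff₀ (by positivity), not_lt, mul_comm]
    by_cases h : ξ ∈ Metric.closedBall (0 : Space) A
    · rw [indicator_of_mem h, indicator_of_notMem (by simpa using h3.mp h)]
      simp
    · rw [indicator_of_notMem h, indicator_of_mem (by simpa using (not_iff_not.mpr h3).mp h),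
        sub_zero]
  calc volume {x | t < ‖u x‖} * ENNReal.ofReal (t ^ 2)
      = 4 * (ENNReal.ofReal ((t / 2) ^ 2) * volume {x | t < ‖u x‖}) := by
        have : ENNReal.ofReal (t ^ 2) = 4 * ENNReal.ofReal ((t / 2) ^ 2) := by
          rw [show (4 : ℝ≥0∞) = ENNReal.ofReal 4 by simp, ← ENNReal.ofReal_mul (by norm_num)]
          congr 1; ring
        rw [this]; ring
    _ ≤ _ := by
        rw [← hind, ← hplanch]
        gcongr

/-- The Sobolev embedding `H^{1/2}(ℝ³) ⊆ L³(ℝ³)`, by integrating the weak-type estimate against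
`3 dt` and exchanging the integrals over levels and frequencies. -/
theorem lintegral_enorm_cube_le {F : Type*} [NormedAddCommGroup F] [InnerProductSpace ℂ F]
    [CompleteSpace F] (u : Lp F 2 (volume : Measure Space)) {M : ℝ} (hM : 0 < M)
    (hint : Integrable (fun ξ : Space => ‖ξ‖ * ‖(𝓕 u : Lp F 2 (volume : Measure Space)) ξ‖ ^ 2))
    (hle : ∫ ξ : Space, ‖ξ‖ * ‖(𝓕 u : Lp F 2 (volume : Measure Space)) ξ‖ ^ 2 ≤ M ^ 2) :
    ∫⁻ x, ‖u x‖ₑ ^ 3 ≤ ENNReal.ofReal (24 * lowFreqConst * M ^ 3) := by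
  have hc := lowFreqConst_pos
  set f : Lp F 2 (volume : Measure Space) := 𝓕 u with hf
  set K : ℝ := 2 * lowFreqConst * M with hK
  have hK0 : 0 < K := by positivity
  have hmeas : AEMeasurable (Function.uncurry fun (t : ℝ) (ξ : Space) =>
      (Iio (K * ‖ξ‖)).indicator (fun _ => ‖f ξ‖ₑ ^ 2) t)
      ((volume.restrict (Ioi (0 : ℝ))).prod (volume : Measure Space)) := by
    have h1 : AEMeasurable (fun p : ℝ × Space => ‖f p.2‖ₑ ^ 2)
        ((volume.restrict (Ioi (0 : ℝ))).prod (volume : Measure Space)) :=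
      (((Lp.aestronglyMeasurable f).enorm.pow_const 2).comp_quasiMeasurePreserving
        Measure.quasiMeasurePreserving_snd)
    have h2 : MeasurableSet {p : ℝ × Space | p.1 < K * ‖p.2‖} :=
      measurableSet_lt measurable_fst (measurable_snd.norm.const_mul K)
    refine (h1.indicator h2).congr (Filter.Eventually.of_forall fun p => ?_)
    simp only [Function.uncurry, indicator, mem_ofPred_eq, mem_Iio]
  have hcake := lintegral_rpow_eq_lintegral_meas_lt_mul volume
    (f := fun x => ‖u x‖) (Filter.Eventually.of_forall fun x => norm_nonneg _)
    (Lp.aestronglyMeasurable u).norm.aemeasurable (p := 3) (by norm_num)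
  calc ∫⁻ x, ‖u x‖ₑ ^ 3
      = ∫⁻ x, ENNReal.ofReal (‖u x‖ ^ (3 : ℝ)) := by
        refine lintegral_congr fun x => ?_
        rw [show (3 : ℝ) = ((3 : ℕ) : ℝ) by norm_num, Real.rpow_natCast,
          ENNReal.ofReal_pow (norm_nonneg _), ofReal_norm]
    _ = ENNReal.ofReal 3 * ∫⁻ t in Ioi 0, volume {x | t < ‖u x‖} *
          ENNReal.ofReal (t ^ (3 - 1 : ℝ)) :=
        hcake
    _ ≤ ENNReal.ofReal 3 * ∫⁻ t in Ioi 0, 4 * ∫⁻ ξ, (Iio (K * ‖ξ‖)).indicator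
          (fun _ => ‖f ξ‖ₑ ^ 2) t := by
        gcongr 1
        refine setLIntegral_mono' measurableSet_Ioi fun t ht => ?_
        have := meas_lt_norm_mul_sq_le u hM (mem_Ioi.mp ht) hint hle
        rw [show (3 - 1 : ℝ) = ((2 : ℕ) : ℝ) by norm_num, Real.rpow_natCast]
        exact this
    _ = ENNReal.ofReal 3 * (4 * ∫⁻ ξ, ∫⁻ t in Ioi 0, (Iio (K * ‖ξ‖)).indicator
          (fun _ => ‖f ξ‖ₑ ^ 2) t) := by
        rw [lintegral_const_mul' _ _ (by norm_num), lintegral_lintegral_swap hmeas]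
    _ = ENNReal.ofReal 3 * (4 * ∫⁻ ξ, ENNReal.ofReal (K * (‖ξ‖ * ‖f ξ‖ ^ 2))) := by
        congr 2
        refine lintegral_congr fun ξ => ?_
        rw [lintegral_indicator measurableSet_Iio, lintegral_const,
          Measure.restrict_apply_univ, Measure.restrict_apply measurableSet_Iio, inter_comm,
          Ioi_inter_Iio, Real.volume_Ioo, sub_zero, ← ofReal_norm,
          ← ENNReal.ofReal_pow (norm_nonneg _), ← ENNReal.ofReal_mul (by positivity)]
        congr 1; ring
    _ ≤ ENNReal.ofReal (24 * lowFreqConst * M ^ 3) := by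
        rw [← ofReal_integral_eq_lintegral_ofReal (hint.const_mul K)
          (Filter.Eventually.of_forall fun ξ => by positivity), integral_const_mul,
          show (4 : ℝ≥0∞) = ENNReal.ofReal 4 by simp, ← ENNReal.ofReal_mul (by norm_num),
          ← ENNReal.ofReal_mul (by norm_num)]
        refine ENNReal.ofReal_le_ofReal ?_
        have := mul_le_mul_of_nonneg_left hle hK0.le
        calc 3 * (4 * (K * ∫ ξ : Space, ‖ξ‖ * ‖f ξ‖ ^ 2)) ≤ 3 * (4 * (K * M ^ 2)) := by linarith
          _ = 24 * lowFreqConst * M ^ 3 := by rw [hK]; ring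

/-! ### The Hilbert space `E` -/

theorem norm_sq_eq_integral {α F : Type*} [MeasurableSpace α] {μ : Measure α}
    [NormedAddCommGroup F] (f : Lp F 2 μ) : ‖f‖ ^ 2 = ∫ x, ‖f x‖ ^ 2 ∂μ := by
  rw [integral_eq_lintegral_of_nonneg_ae (Filter.Eventually.of_forall fun x => by positivity)
    (by exact (Lp.aestronglyMeasurable f).norm.pow 2)]
  have h : ∫⁻ x, ENNReal.ofReal (‖f x‖ ^ 2) ∂μ = ‖f‖ₑ ^ 2 := by
    rw [← lintegral_enorm_sq_eq]
    exact lintegral_congr fun x => by rw [ENNReal.ofReal_pow (norm_nonneg _), ofReal_norm]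
  rw [h, ENNReal.toReal_pow, toReal_enorm]

theorem le_omega (a : ℝ) (ξ : Space) : a ≤ omega a ξ :=
  Real.le_sqrt_of_sq_le (by nlinarith [sq_nonneg (2 * Real.pi * ‖ξ‖)])

theorem norm_le_omega (a : ℝ) (ξ : Space) : ‖ξ‖ ≤ omega a ξ := by
  refine Real.le_sqrt_of_sq_le ?_
  have h1 : ‖ξ‖ ≤ 2 * Real.pi * ‖ξ‖ :=
    le_mul_of_one_le_left (norm_nonneg _) (by linarith [Real.pi_gt_three])
  nlinarith [sq_nonneg a, norm_nonneg ξ]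

theorem integrable_omega_mul_sq {a : ℝ} (u : E a) :
    Integrable (fun ξ => omega a ξ * ‖(𝓕 (toL2 a u) : L2) ξ‖ ^ 2) := by
  refine (memLp_sqrt_omega u).norm.integrable_sq.congr (Filter.Eventually.of_forall fun ξ => ?_)
  simp only [norm_smul, mul_pow, Real.norm_eq_abs, sq_abs, Real.sq_sqrt (omega_nonneg a ξ)]

theorem norm_sq_eq_integral_omega {a : ℝ} (u : E a) :
    ‖u‖ ^ 2 = ∫ ξ, omega a ξ * ‖(𝓕 (toL2 a u) : L2) ξ‖ ^ 2 := by
  have h1 : ‖absSqrt a u‖ = ‖(𝓕 (absSqrt a u) : L2)‖ := (Lp.norm_fourier_eq _).symm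
  rw [norm_eq, h1, norm_sq_eq_integral]
  refine integral_congr_ae ?_
  filter_upwards [fourier_absSqrt a u] with ξ h
  rw [h, norm_smul, mul_pow, Real.norm_eq_abs, sq_abs, Real.sq_sqrt (omega_nonneg a ξ)]

theorem mul_norm_toL2_sq_le {a : ℝ} (u : E a) : a * ‖toL2 a u‖ ^ 2 ≤ ‖u‖ ^ 2 := by
  have h1 : ‖toL2 a u‖ = ‖(𝓕 (toL2 a u) : L2)‖ := (Lp.norm_fourier_eq _).symm
  rw [norm_sq_eq_integral_omega, h1, norm_sq_eq_integral, ← integral_const_mul]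
  refine integral_mono ((Lp.memLp _).norm.integrable_sq.const_mul a) (integrable_omega_mul_sq u)
    fun ξ => ?_
  exact mul_le_mul_of_nonneg_right (le_omega a ξ) (by positivity)

theorem lintegral_enorm_cube_toL2_le {a : ℝ} (u : E a) :
    ∫⁻ x, ‖toL2 a u x‖ₑ ^ 3 ≤ ENNReal.ofReal (24 * lowFreqConst * ‖u‖ ^ 3) := by
  rcases eq_or_ne u 0 with rfl | hu
  · have h : ∫⁻ x, ‖toL2 a (0 : E a) x‖ₑ ^ 3 = 0 := by
      rw [map_zero, lintegral_eq_zero_iff' ((Lp.aestronglyMeasurable _).enorm.pow_const 3)]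
      filter_upwards [Lp.coeFn_zero Spinor 2 (volume : Measure Space)] with x hx
      simp
    rw [h]; exact zero_le
  · have hle : ∀ ξ, ‖ξ‖ * ‖(𝓕 (toL2 a u) : L2) ξ‖ ^ 2 ≤
        omega a ξ * ‖(𝓕 (toL2 a u) : L2) ξ‖ ^ 2 := fun ξ =>
      mul_le_mul_of_nonneg_right (norm_le_omega a ξ) (by positivity)
    have hint : Integrable (fun ξ : Space => ‖ξ‖ * ‖(𝓕 (toL2 a u) : L2) ξ‖ ^ 2) := by
      refine (integrable_omega_mul_sq u).mono' ?_ (Filter.Eventually.of_forall fun ξ => ?_)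
      · exact continuous_norm.aestronglyMeasurable.mul
          ((Lp.aestronglyMeasurable _).norm.pow 2)
      · rw [Real.norm_of_nonneg (by positivity)]
        exact hle ξ
    refine lintegral_enorm_cube_le _ (norm_pos_iff.mpr hu) hint ?_
    rw [norm_sq_eq_integral_omega]
    exact integral_mono hint (integrable_omega_mul_sq u) hle

theorem memLp_three_toL2 {a : ℝ} (u : E a) : MemLp (toL2 a u) 3 volume := by
  refine ⟨Lp.aestronglyMeasurable _, ?_⟩
  rw [eLpNorm_lt_top_iff_lintegral_rpow_enorm_lt_top (by norm_num) (by norm_num)]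
  have := (lintegral_enorm_cube_toL2_le u).trans_lt ENNReal.ofReal_lt_top
  have h3 : (3 : ℝ≥0∞).toReal = ((3 : ℕ) : ℝ) := by norm_num
  simpa only [h3, ENNReal.rpow_natCast] using this

theorem integral_norm_cube_toL2_le {a : ℝ} (u : E a) :
    ∫ x, ‖toL2 a u x‖ ^ 3 ≤ 24 * lowFreqConst * ‖u‖ ^ 3 := by
  have hc := lowFreqConst_pos
  rw [integral_eq_lintegral_of_nonneg_ae (Filter.Eventually.of_forall fun x => by positivity)
    (by exact (Lp.aestronglyMeasurable (toL2 a u)).norm.pow 3)]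
  refine ENNReal.toReal_le_of_le_ofReal (by positivity) (le_trans (le_of_eq ?_)
    (lintegral_enorm_cube_toL2_le u))
  exact lintegral_congr fun x => by rw [ENNReal.ofReal_pow (norm_nonneg _), ofReal_norm]

/-- `|D_a|^{1/2}` maps `E` onto `L²`, since `ω ≥ a > 0`; hence `E` is isometric to `L²`. -/
theorem absSqrt_surjective {a : ℝ} (ha : 0 < a) : Function.Surjective (absSqrt a) := by
  intro f
  have hpos : ∀ ξ, 0 < omega a ξ := fun ξ => ha.trans_le (le_omega a ξ)
  have hsm : AEStronglyMeasurable (fun ξ : Space => (Real.sqrt (omega a ξ))⁻¹) volume :=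
    ((continuous_omega a).sqrt.measurable.inv).aestronglyMeasurable
  have hmem : MemLp (fun ξ => (Real.sqrt (omega a ξ))⁻¹ • (𝓕 f : L2) ξ) 2 volume := by
    refine MemLp.of_le_mul (c := (Real.sqrt a)⁻¹) (Lp.memLp (𝓕 f : L2))
      (hsm.smul (Lp.aestronglyMeasurable _)) (Filter.Eventually.of_forall fun ξ => ?_)
    rw [norm_smul, norm_inv, Real.norm_of_nonneg (Real.sqrt_nonneg _)]
    gcongr
    exact le_omega a ξ
  have hF : (𝓕 (𝓕⁻ (hmem.toLp _) : L2) : L2) =ᵐ[volume]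
      fun ξ => (Real.sqrt (omega a ξ))⁻¹ • (𝓕 f : L2) ξ := by
    rw [FourierTransform.fourier_fourierInv_eq]
    exact hmem.coeFn_toLp
  have hF' : (fun ξ => Real.sqrt (omega a ξ) • (𝓕 (𝓕⁻ (hmem.toLp _) : L2) : L2) ξ)
      =ᵐ[volume] (𝓕 f : L2) := by
    filter_upwards [hF] with ξ h
    rw [h, smul_smul, mul_inv_cancel₀ (Real.sqrt_pos.mpr (hpos ξ)).ne', one_smul]
  refine ⟨⟨𝓕⁻ (hmem.toLp _), (memLp_congr_ae hF').mpr (Lp.memLp _)⟩, ?_⟩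
  have h : (𝓕 (absSqrt a ⟨𝓕⁻ (hmem.toLp _), (memLp_congr_ae hF').mpr (Lp.memLp _)⟩) : L2)
      = 𝓕 f := by
    refine Lp.ext ((fourier_absSqrt a _).trans hF')
  exact (Lp.fourierTransformₗᵢ Space Spinor).injective h

theorem completeSpace_E {a : ℝ} (ha : 0 < a) : CompleteSpace (E a) := by
  have hiso : Isometry (absSqrt a) :=
    AddMonoidHomClass.isometry_of_norm _ fun u => (norm_eq a u).symm
  exact (hiso.isUniformInducing.completeSpace_congr (absSqrt_surjective ha)).mpr inferInstance

/-! ### The sign of the Dirac operator is a symmetry of `E` -/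

theorem omega_pos_of_pos {a : ℝ} (ha : 0 < a) (ξ : Space) : 0 < omega a ξ :=
  ha.trans_le (le_omega a ξ)

theorem norm_signSymbol_apply {a : ℝ} (ha : 0 < a) (ξ : Space) (x : Spinor) :
    ‖signSymbol a ξ x‖ = ‖x‖ := by
  have h0 := omega_pos_of_pos ha ξ
  simp only [signSymbol, smul_apply, norm_smul, norm_symbol_apply,
    Real.norm_eq_abs, abs_inv, abs_of_pos h0, ← mul_assoc]
  rw [inv_mul_cancel₀ h0.ne', one_mul]

theorem signSymbol_signSymbol {a : ℝ} (ha : 0 < a) (ξ : Space) (x : Spinor) :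
    signSymbol a ξ (signSymbol a ξ x) = x := by
  have h0 := omega_pos_of_pos ha ξ
  have hsq : symbol a ξ * symbol a ξ = ((omega a ξ ^ 2 : ℝ) : ℂ) • 1 := by
    simp only [symbol]
    rw [← map_mul, symbolMat_mul_self, map_smul, map_one]
  have h1 : symbol a ξ (symbol a ξ x) = (omega a ξ ^ 2) • x := by
    have := congrArg (fun L : Spinor →L[ℂ] Spinor => L x) hsq
    rw [← Complex.coe_smul]
    simpa using this
  have h2 : ∀ (c : ℝ) (y : Spinor), symbol a ξ (c • y) = c • symbol a ξ y := fun c y =>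
    ((symbol a ξ).restrictScalars ℝ).map_smul c y
  simp only [signSymbol, smul_apply]
  rw [h2, h1, smul_smul, smul_smul]
  have : (omega a ξ)⁻¹ * (omega a ξ)⁻¹ * omega a ξ ^ 2 = 1 := by field_simp
  rw [this, one_smul]

theorem fourier_signOp {a : ℝ} (u : E a) : (𝓕 (toL2 a (signOp a u)) : L2) =ᵐ[volume]
    fun ξ => signSymbol a ξ ((𝓕 (toL2 a u) : L2) ξ) :=
  fourier_signL2 a (toL2 a u)

theorem norm_signOp {a : ℝ} (ha : 0 < a) (u : E a) : ‖signOp a u‖ = ‖u‖ := by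
  refine (sq_eq_sq₀ (norm_nonneg _) (norm_nonneg _)).mp ?_
  rw [norm_sq_eq_integral_omega, norm_sq_eq_integral_omega]
  refine integral_congr_ae ?_
  filter_upwards [fourier_signOp u] with ξ h
  rw [h, norm_signSymbol_apply ha]

theorem signOp_signOp {a : ℝ} (ha : 0 < a) (u : E a) : signOp a (signOp a u) = u := by
  apply toL2_injective a
  apply (Lp.fourierTransformₗᵢ Space Spinor).injective
  refine Lp.ext ((fourier_signOp (signOp a u)).trans ?_)
  filter_upwards [fourier_signOp u] with ξ h
  rw [h, signSymbol_signSymbol ha]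
  rfl

/-- The sign of the Dirac operator, as a linear isometry of `E`. -/
def signIsometry {a : ℝ} (ha : 0 < a) : E a →ₗᵢ[ℝ] E a := ⟨signOp a, norm_signOp ha⟩

theorem inner_signIsometry_left {a : ℝ} (ha : 0 < a) (u v : E a) :
    inner ℝ (signIsometry ha u) v = inner ℝ u (signIsometry ha v) := by
  rw [← (signIsometry ha).inner_map_map u]
  congr 1
  exact (signOp_signOp ha v).symm

theorem mem_EPlus_iff {a : ℝ} (ha : 0 < a) {u : E a} : u ∈ EPlus a ↔ signIsometry ha u = u := by
  have hS : ∀ v, signIsometry ha v = signOp a v := fun _ => rfl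
  rw [hS]
  constructor
  · rintro ⟨v, rfl⟩
    simp only [projPlus, LinearMap.smul_apply, LinearMap.add_apply, LinearMap.id_apply, map_smul,
      map_add, signOp_signOp ha]
    rw [add_comm]
  · intro h
    refine ⟨u, ?_⟩
    simp only [projPlus, LinearMap.smul_apply, LinearMap.add_apply, LinearMap.id_apply, h]
    rw [← two_smul ℝ u, smul_smul]; norm_num

theorem mem_EMinus_iff {a : ℝ} (ha : 0 < a) {u : E a} :
    u ∈ EMinus a ↔ signIsometry ha u = -u := by
  have hS : ∀ v, signIsometry ha v = signOp a v := fun _ => rfl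
  rw [hS]
  constructor
  · rintro ⟨v, rfl⟩
    simp only [projMinus, LinearMap.smul_apply, LinearMap.sub_apply, LinearMap.id_apply, map_smul,
      map_sub, signOp_signOp ha]
    rw [← smul_neg, neg_sub]
  · intro h
    refine ⟨u, ?_⟩
    simp only [projMinus, LinearMap.smul_apply, LinearMap.sub_apply, LinearMap.id_apply, h]
    rw [sub_neg_eq_add, ← two_smul ℝ u, smul_smul]; norm_num

theorem isClosed_EMinus {a : ℝ} (ha : 0 < a) : IsClosed (EMinus a : Set (E a)) := by
  have : (EMinus a : Set (E a)) = {u | signIsometry ha u = -u} := by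
    ext u; exact mem_EMinus_iff ha
  rw [this]
  exact isClosed_eq (signIsometry ha).continuous continuous_neg

theorem norm_projPlus_sq_sub_norm_projMinus_sq {a : ℝ} (ha : 0 < a) (u : E a) :
    ‖projPlus a u‖ ^ 2 - ‖projMinus a u‖ ^ 2 = inner ℝ (signIsometry ha u) u := by
  have h1 : projPlus a u = (1 / 2 : ℝ) • (u + signIsometry ha u) := rfl
  have h2 : projMinus a u = (1 / 2 : ℝ) • (u - signIsometry ha u) := rfl
  rw [h1, h2, norm_smul, norm_smul, mul_pow, mul_pow, norm_add_sq_real, norm_sub_sq_real,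
    real_inner_comm]
  norm_num
  ring

/-! ### Radial fields `y ↦ g(|y|) y` -/

section Radial

open Filter Topology

/-- The hypotheses on `g(x, ·)` at a fixed point `x`, with the constant `C` of the growth
condition made explicit. -/
structure IsAdmissibleProfile (g : ℝ → ℝ) (C : ℝ) : Prop where
  contDiffOn : ContDiffOn ℝ 1 (fun s => g s * s) (Ici 0)
  nonneg : ∀ s : ℝ, 0 ≤ s → 0 ≤ g s * s
  isLittleO : ∀ ε : ℝ, 0 < ε → ∃ δ : ℝ, 0 < δ ∧ ∀ s : ℝ, 0 < s → s < δ → g s * s ≤ ε * s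
  deriv_bound : ∀ s : ℝ, 0 < s →
    0 ≤ deriv (fun τ => g τ * τ) s ∧ deriv (fun τ => g τ * τ) s ≤ C * (1 + s)
  deriv_pos : ∀ s : ℝ, 0 < s → 0 < deriv g s

namespace IsAdmissibleProfile

variable {g : ℝ → ℝ} {C : ℝ} (hg : IsAdmissibleProfile g C)
include hg

theorem const_nonneg : 0 ≤ C := by
  have := hg.deriv_bound 1 one_pos
  nlinarith [this.1.trans this.2]

theorem continuousOn_mul : ContinuousOn (fun s => g s * s) (Ici 0) := hg.contDiffOn.continuousOn

theorem hasDerivAt {s : ℝ} (hs : 0 < s) : HasDerivAt g (deriv g s) s :=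
  (differentiableAt_of_deriv_ne_zero (hg.deriv_pos s hs).ne').hasDerivAt

theorem deriv_mul_eq {s : ℝ} (hs : 0 < s) :
    deriv (fun τ => g τ * τ) s = deriv g s * s + g s := by
  have h := ((hg.hasDerivAt hs).mul (hasDerivAt_id s)).deriv
  rw [id, mul_one] at h
  exact h

theorem apply_nonneg {s : ℝ} (hs : 0 < s) : 0 ≤ g s :=
  nonneg_of_mul_nonneg_left (hg.nonneg s hs.le) hs

/-- By the mean value theorem, as `g(s) s` vanishes at `s = 0`. -/
theorem apply_le {s : ℝ} (hs : 0 < s) : g s ≤ C * (1 + s) := by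
  obtain ⟨c, hc, h⟩ := exists_deriv_eq_slope (fun τ => g τ * τ) hs
    (hg.continuousOn_mul.mono Icc_subset_Ici_self)
    (fun τ hτ => ((hg.hasDerivAt hτ.1).mul
      (hasDerivAt_id τ)).differentiableAt.differentiableWithinAt)
  have h1 : g s = deriv (fun τ => g τ * τ) c := by
    rw [h]; field_simp; ring_nf
    rw [mul_assoc, mul_inv_cancel₀ hs.ne', mul_one]
  have := hg.const_nonneg
  rw [h1]
  refine ((hg.deriv_bound c hc.1).2).trans ?_
  have := hc.2
  gcongr

theorem tendsto_apply : Tendsto g (𝓝[>] 0) (𝓝 0) := by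
  rw [Metric.tendsto_nhdsWithin_nhds]
  intro ε hε
  obtain ⟨δ, hδ, h⟩ := hg.isLittleO (ε / 2) (by positivity)
  refine ⟨δ, hδ, fun {s} hs hsd => ?_⟩
  have hs : 0 < s := hs
  rw [Real.dist_eq, sub_zero, abs_of_pos hs] at hsd
  have h1 := le_of_mul_le_mul_right (h s hs hsd) hs
  rw [Real.dist_eq, sub_zero, abs_of_nonneg (hg.apply_nonneg hs)]
  linarith

theorem continuousOn_deriv_mul : ContinuousOn (deriv fun τ => g τ * τ) (Ioi 0) :=
  (hg.contDiffOn.mono Ioi_subset_Ici_self).continuousOn_deriv_of_isOpen isOpen_Ioi le_rfl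

theorem tendsto_deriv_mul : Tendsto (deriv fun τ => g τ * τ) (𝓝[>] 0) (𝓝 0) := by
  have hcont := hg.contDiffOn.continuousOn_derivWithin (uniqueDiffOn_Ici 0) le_rfl
  have h0 : derivWithin (fun τ => g τ * τ) (Ici 0) 0 = 0 := by
    refine HasDerivWithinAt.derivWithin ?_ (uniqueDiffOn_Ici (0 : ℝ) 0 self_mem_Ici)
    rw [hasDerivWithinAt_iff_tendsto_slope, Ici_sdiff_left]
    refine hg.tendsto_apply.congr' ?_
    filter_upwards [self_mem_nhdsWithin] with s hs
    have : s ≠ 0 := (mem_Ioi.mp hs).ne'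
    simp [slope_def_field, this]
  have h1 : Tendsto (derivWithin (fun τ => g τ * τ) (Ici 0)) (𝓝[>] 0) (𝓝 0) := by
    have := (hcont 0 self_mem_Ici).mono Ioi_subset_Ici_self
    rwa [ContinuousWithinAt, h0] at this
  refine h1.congr' ?_
  filter_upwards [self_mem_nhdsWithin] with s hs
  exact derivWithin_of_mem_nhds (Ici_mem_nhds hs)

theorem continuousOn_deriv : ContinuousOn (deriv g) (Ioi 0) := by
  have hgc : ContinuousOn g (Ioi 0) := fun s hs =>
    (hg.hasDerivAt hs).continuousAt.continuousWithinAt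
  refine ((hg.continuousOn_deriv_mul.sub hgc).div continuousOn_id
    fun s hs => (mem_Ioi.mp hs).ne').congr fun s hs => ?_
  have : s ≠ 0 := (mem_Ioi.mp hs).ne'
  rw [Pi.div_apply, Pi.sub_apply, hg.deriv_mul_eq hs, id]
  field_simp; ring

theorem monotoneOn_mul : MonotoneOn (fun s => g s * s) (Ici 0) := by
  refine monotoneOn_of_deriv_nonneg (convex_Ici 0) hg.continuousOn_mul ?_ ?_ <;>
    rw [interior_Ici]
  · exact fun τ hτ =>
      ((hg.hasDerivAt hτ).mul (hasDerivAt_id τ)).differentiableAt.differentiableWithinAt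
  · exact fun s hs => (hg.deriv_bound s hs).1

end IsAdmissibleProfile

variable {V : Type*} [NormedAddCommGroup V] [InnerProductSpace ℝ V]

/-- The potential `y ↦ ∫₀^{|y|} g(t) t dt` of a radial field. -/
def radialPotential (g : ℝ → ℝ) (y : V) : ℝ := ∫ t in (0 : ℝ)..‖y‖, g t * t

/-- The radial field `y ↦ g(|y|) y`. -/
def radialField (g : ℝ → ℝ) (y : V) : V := g ‖y‖ • y

open Classical in
/-- The derivative `φ ↦ g(|y|) φ + g'(|y|) |y|⁻¹ ⟨y, φ⟩ y` of the radial field `y ↦ g(|y|) y`.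
At `y = 0` it is `0`, whatever the value `g 0` is. -/
def radialDeriv (g : ℝ → ℝ) (y : V) : V →L[ℝ] V :=
  if y = 0 then 0 else g ‖y‖ • ContinuousLinearMap.id ℝ V +
    (deriv g ‖y‖ / ‖y‖) • (innerSL ℝ y).smulRight y

theorem hasFDerivAt_norm {y : V} (hy : y ≠ 0) :
    HasFDerivAt (fun y : V => ‖y‖) (‖y‖⁻¹ • innerSL ℝ y) y := by
  have h1 := (hasStrictFDerivAt_norm_sq y).hasFDerivAt.sqrt
    (pow_ne_zero 2 (norm_ne_zero_iff.mpr hy))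
  simp only [Real.sqrt_sq (norm_nonneg _)] at h1
  convert h1 using 1
  ext φ
  simp
  field_simp

namespace IsAdmissibleProfile

variable {g : ℝ → ℝ} {C : ℝ} (hg : IsAdmissibleProfile g C)
include hg

theorem hasFDerivAt_radialField (y : V) : HasFDerivAt (radialField g) (radialDeriv g y) y := by
  rcases eq_or_ne y 0 with rfl | hy
  · rw [radialDeriv, if_pos rfl, hasFDerivAt_iff_isLittleO_nhds_zero, Asymptotics.isLittleO_iff]
    intro ε hε
    obtain ⟨δ, hδ, h⟩ := hg.isLittleO ε hε
    filter_upwards [Metric.ball_mem_nhds (0 : V) hδ] with k hk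
    rcases eq_or_ne k 0 with rfl | hk0
    · simp
    · have hk' : 0 < ‖k‖ := norm_pos_iff.mpr hk0
      have := h ‖k‖ hk' (by simpa using hk)
      simpa [radialField, norm_smul, abs_of_nonneg (hg.apply_nonneg hk')] using this
  · have hy' : 0 < ‖y‖ := norm_pos_iff.mpr hy
    rw [radialDeriv, if_neg hy]
    convert! ((hg.hasDerivAt hy').comp_hasFDerivAt y (hasFDerivAt_norm hy)).smul
      (hasFDerivAt_id y) using 1
    ext φ
    simp [div_eq_mul_inv, smul_smul, mul_assoc]

omit [InnerProductSpace ℝ V] in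
theorem abs_radialPotential_le (y : V) :
    |radialPotential g y| ≤ C * (1 + ‖y‖) * ‖y‖ ^ 2 := by
  have h := intervalIntegral.norm_integral_le_of_norm_le_const (a := 0) (b := ‖y‖)
    (f := fun t => g t * t) (C := C * (1 + ‖y‖) * ‖y‖) (fun t ht => ?_)
  · rw [sub_zero, abs_norm, Real.norm_eq_abs] at h
    rw [radialPotential]
    linarith [h, sq ‖y‖]
  · rw [uIoc_of_le (norm_nonneg y)] at ht
    have := hg.const_nonneg
    rw [Real.norm_of_nonneg (hg.nonneg t ht.1.le)]
    have h1 := hg.apply_le ht.1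
    have h2 := ht.2
    have h3 := ht.1.le
    calc g t * t ≤ (C * (1 + t)) * t := by gcongr
      _ ≤ C * (1 + ‖y‖) * ‖y‖ := by gcongr

theorem hasFDerivAt_radialPotential (y : V) :
    HasFDerivAt (radialPotential g) (innerSL ℝ (radialField g y)) y := by
  rcases eq_or_ne y 0 with rfl | hy
  · have h0 : radialField g (0 : V) = 0 := smul_zero _
    rw [h0, map_zero]
    refine Asymptotics.IsBigO.hasFDerivAt (n := 2) (Asymptotics.IsBigO.of_bound (C * 2) ?_)
      one_lt_two
    filter_upwards [Metric.ball_mem_nhds (0 : V) one_pos] with k hk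
    have hk : ‖k‖ < 1 := by simpa using hk
    have := hg.const_nonneg
    rw [sub_zero, Real.norm_eq_abs, norm_pow, norm_norm]
    refine (hg.abs_radialPotential_le k).trans ?_
    gcongr
    linarith
  · have hy' : 0 < ‖y‖ := norm_pos_iff.mpr hy
    have hint : IntervalIntegrable (fun t => g t * t) volume 0 ‖y‖ :=
      (hg.continuousOn_mul.mono (by
        rw [uIcc_of_le hy'.le]; exact Icc_subset_Ici_self)).intervalIntegrable
    have hca : ContinuousAt (fun t => g t * t) ‖y‖ :=
      (hg.hasDerivAt hy').continuousAt.mul continuousAt_id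
    have hsm : StronglyMeasurableAtFilter (fun t => g t * t) (𝓝 ‖y‖) :=
      ContinuousOn.stronglyMeasurableAtFilter isOpen_Ioi
        (hg.continuousOn_mul.mono Ioi_subset_Ici_self) _ hy'
    convert! (intervalIntegral.integral_hasDerivAt_right hint hsm hca).comp_hasFDerivAt y
      (hasFDerivAt_norm hy) using 1
    ext φ
    simp only [radialField, map_smul, smul_apply, innerSL_apply_apply, smul_eq_mul]
    field_simp

theorem norm_radialDeriv_le (y : V) :
    ‖radialDeriv g y‖ ≤ g ‖y‖ * 2 + deriv (fun τ => g τ * τ) ‖y‖ ∨ y = 0 := by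
  rcases eq_or_ne y 0 with rfl | hy
  · exact Or.inr rfl
  · left
    have hy' : 0 < ‖y‖ := norm_pos_iff.mpr hy
    have h1 : 0 ≤ deriv g ‖y‖ / ‖y‖ := (div_pos (hg.deriv_pos _ hy') hy').le
    rw [radialDeriv, if_neg hy]
    refine (norm_add_le _ _).trans ?_
    rw [norm_smul, norm_smul, ContinuousLinearMap.norm_smulRight_apply, innerSL_apply_norm,
      Real.norm_of_nonneg h1, Real.norm_of_nonneg (hg.apply_nonneg hy'), hg.deriv_mul_eq hy']
    have h2 : deriv g ‖y‖ / ‖y‖ * (‖y‖ * ‖y‖) = deriv g ‖y‖ * ‖y‖ := by field_simp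
    have h3 := mul_le_mul_of_nonneg_left (ContinuousLinearMap.norm_id_le (𝕜 := ℝ) (E := V))
      (hg.apply_nonneg hy')
    have h4 := hg.apply_nonneg hy'
    linarith

theorem norm_radialDeriv_le_const (y : V) : ‖radialDeriv g y‖ ≤ 3 * C * (1 + ‖y‖) := by
  have hC := hg.const_nonneg
  rcases eq_or_ne y 0 with rfl | hy
  · simp only [radialDeriv, if_true, norm_zero]; positivity
  · have hy' : 0 < ‖y‖ := norm_pos_iff.mpr hy
    have h1 := (hg.norm_radialDeriv_le y).resolve_right hy
    have h2 := hg.apply_le hy'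
    have h3 := (hg.deriv_bound _ hy').2
    linarith

theorem continuous_radialDeriv : Continuous (radialDeriv g : V → V →L[ℝ] V) := by
  rw [continuous_iff_continuousAt]
  intro y
  rcases eq_or_ne y 0 with rfl | hy
  · have h0 : radialDeriv g (0 : V) = 0 := if_pos rfl
    have hb : Tendsto (fun s => g s * 2 + deriv (fun τ => g τ * τ) s) (𝓝[>] 0) (𝓝 0) := by
      simpa using (hg.tendsto_apply.mul_const 2).add hg.tendsto_deriv_mul
    rw [Metric.tendsto_nhdsWithin_nhds] at hb
    rw [Metric.continuousAt_iff]
    intro ε hε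
    obtain ⟨δ, hδ, h⟩ := hb ε hε
    refine ⟨δ, hδ, fun {z} hz => ?_⟩
    rw [h0, dist_zero_right]
    rcases eq_or_ne z 0 with rfl | hz0
    · simpa [h0] using hε
    · have h1 := h (norm_pos_iff.mpr hz0) (by simpa using hz)
      rw [dist_zero_right] at h1
      exact ((hg.norm_radialDeriv_le z).resolve_right hz0).trans_lt ((le_abs_self _).trans_lt h1)
  · have hy' : 0 < ‖y‖ := norm_pos_iff.mpr hy
    have h1 : ContinuousAt (fun z : V => g ‖z‖) y :=
      (hg.hasDerivAt hy').continuousAt.comp (f := fun z : V => ‖z‖) continuous_norm.continuousAt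
    have h2 : ContinuousAt (fun z : V => deriv g ‖z‖) y :=
      (hg.continuousOn_deriv.continuousAt (Ioi_mem_nhds hy')).comp (f := fun z : V => ‖z‖)
        continuous_norm.continuousAt
    have h3 : ContinuousAt (fun z : V => g ‖z‖ • ContinuousLinearMap.id ℝ V +
        (deriv g ‖z‖ / ‖z‖) • (innerSL ℝ z).smulRight z) y := by
      refine (h1.smul continuousAt_const).add
        ((h2.div continuous_norm.continuousAt hy'.ne').smul ?_)
      have : Continuous fun z : V => (innerSL ℝ z).smulRight z := by fun_prop
      exact this.continuousAt
    refine h3.congr ?_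
    filter_upwards [isOpen_ne.mem_nhds hy] with z hz
    rw [radialDeriv, if_neg hz]

/-- Radial fields are monotone: by Cauchy–Schwarz it suffices that `s ↦ g(s) s` is monotone. -/
theorem inner_radialField_sub_nonneg (y z : V) :
    0 ≤ inner ℝ (radialField g y - radialField g z) (y - z) := by
  have hle : ∀ y z : V, inner ℝ (radialField g y) z ≤ g ‖y‖ * ‖y‖ * ‖z‖ := fun y z => by
    refine (real_inner_le_norm _ _).trans (le_of_eq ?_)
    rw [radialField, norm_smul, ← norm_norm y, ← norm_mul, norm_norm,
      Real.norm_of_nonneg (hg.nonneg _ (norm_nonneg y))]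
  have hself : ∀ y : V, inner ℝ (radialField g y) y = g ‖y‖ * ‖y‖ * ‖y‖ := fun y => by
    rw [radialField, real_inner_smul_left, real_inner_self_eq_norm_sq]; ring
  have hmono : 0 ≤ (g ‖y‖ * ‖y‖ - g ‖z‖ * ‖z‖) * (‖y‖ - ‖z‖) := by
    rcases le_total ‖y‖ ‖z‖ with h | h
    · have := hg.monotoneOn_mul (norm_nonneg y) (norm_nonneg z) h
      exact mul_nonneg_of_nonpos_of_nonpos (sub_nonpos.mpr this) (sub_nonpos.mpr h)
    · have := hg.monotoneOn_mul (norm_nonneg z) (norm_nonneg y) h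
      exact mul_nonneg (sub_nonneg.mpr this) (sub_nonneg.mpr h)
  rw [inner_sub_left, inner_sub_right, inner_sub_right, hself, hself]
  have := hle y z
  have := hle z y
  linarith

/-- The pointwise inequality behind `H' > 0`: the difference of the two sides is
`g(|y|) |χ|² + g'(|y|) |y|⁻¹ ⟨y, y + χ⟩²`. -/
theorem inner_radialField_le (y χ : V) :
    inner ℝ (radialField g y) (y + (2 : ℝ) • χ) ≤ inner ℝ (radialDeriv g y (y + χ)) (y + χ) := by
  rcases eq_or_ne y 0 with rfl | hy
  · simp [radialField, radialDeriv]
  · have hy' : 0 < ‖y‖ := norm_pos_iff.mpr hy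
    have h1 : 0 ≤ deriv g ‖y‖ / ‖y‖ := (div_pos (hg.deriv_pos _ hy') hy').le
    have h2 : inner ℝ (radialDeriv g y (y + χ)) (y + χ)
          - inner ℝ (radialField g y) (y + (2 : ℝ) • χ)
        = g ‖y‖ * ‖χ‖ ^ 2 + deriv g ‖y‖ / ‖y‖ * inner ℝ y (y + χ) ^ 2 := by
      rw [radialDeriv, if_neg hy, radialField]
      simp only [add_apply, smul_apply, ContinuousLinearMap.id_apply,
        ContinuousLinearMap.smulRight_apply, innerSL_apply_apply, inner_add_left, inner_add_right,
        inner_smul_left, inner_smul_right, real_inner_self_eq_norm_sq, RCLike.conj_to_real,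
        real_inner_comm y χ]
      ring
    have := hg.apply_nonneg hy'
    have h3 : 0 ≤ g ‖y‖ * ‖χ‖ ^ 2 + deriv g ‖y‖ / ‖y‖ * inner ℝ y (y + χ) ^ 2 := by positivity
    linarith

theorem inner_radialField_lt {y : V} (hy : y ≠ 0) :
    inner ℝ (radialField g y) y < inner ℝ (radialDeriv g y y) y := by
  have hy' : 0 < ‖y‖ := norm_pos_iff.mpr hy
  have h1 : 0 < deriv g ‖y‖ := hg.deriv_pos _ hy'
  have h2 : inner ℝ (radialDeriv g y y) y - inner ℝ (radialField g y) y
      = deriv g ‖y‖ * ‖y‖ ^ 3 := by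
    rw [radialDeriv, if_neg hy, radialField]
    simp only [add_apply, smul_apply, ContinuousLinearMap.id_apply,
      ContinuousLinearMap.smulRight_apply, innerSL_apply_apply, inner_add_left,
      inner_smul_left, real_inner_self_eq_norm_sq, RCLike.conj_to_real]
    field_simp
    ring
  have : 0 < deriv g ‖y‖ * ‖y‖ ^ 3 := by positivity
  linarith

end IsAdmissibleProfile

theorem IsAdmissible.exists_profile {g : Space → ℝ → ℝ} (hg : IsAdmissible g) :
    ∃ C, ∀ x, IsAdmissibleProfile (g x) C := by
  obtain ⟨C, hC⟩ := hg.deriv_bound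
  refine ⟨C, fun x => ⟨hg.contDiffOn x, hg.nonneg x, fun ε hε => ?_, hC x, hg.deriv_pos x⟩⟩
  obtain ⟨δ, hδ, h⟩ := hg.isLittleO ε hε
  exact ⟨δ, hδ, h x⟩

end Radial

/-! ### Integral functionals of cubic growth -/

section Nemytskii

open Filter Topology

variable {α V X : Type*} [MeasurableSpace α] {μ : Measure α} [NormedAddCommGroup V]
  [InnerProductSpace ℝ V] [NormedAddCommGroup X] [NormedSpace ℝ X]

/-- A linear map `ι : X → L²` is a cubic embedding with constant `K` if it maps into `L² ∩ L³` and
is bounded there; `K` bounds `|ι u|₂² / ‖u‖²` and `|ι u|₃³ / ‖u‖³`. -/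
structure IsCubicEmbedding (ι : X →ₗ[ℝ] Lp V 2 μ) (K : ℝ) : Prop where
  const_nonneg : 0 ≤ K
  memLp_three : ∀ u, MemLp (ι u) 3 μ
  integral_sq_le : ∀ u, ∫ x, ‖ι u x‖ ^ 2 ∂μ ≤ K * ‖u‖ ^ 2
  integral_cube_le : ∀ u, ∫ x, ‖ι u x‖ ^ 3 ∂μ ≤ K * ‖u‖ ^ 3

/-- The inequality between the arithmetic and the geometric mean, for cubes. -/
theorem mul_mul_le_cubes {a b c : ℝ} (ha : 0 ≤ a) (hb : 0 ≤ b) (hc : 0 ≤ c) :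
    a * (b * c) ≤ (a ^ 3 + b ^ 3 + c ^ 3) / 3 := by
  nlinarith [mul_nonneg (add_nonneg (add_nonneg ha hb) hc) (add_nonneg (add_nonneg
    (sq_nonneg (a - b)) (sq_nonneg (b - c))) (sq_nonneg (c - a)))]

namespace IsCubicEmbedding

variable {ι : X →ₗ[ℝ] Lp V 2 μ} {K : ℝ} (hι : IsCubicEmbedding ι K)
include hι

omit hι in
theorem aesm (u : X) : AEStronglyMeasurable (ι u) μ := Lp.aestronglyMeasurable _

omit hι in
theorem integrable_mul (u v : X) : Integrable (fun x => ‖ι u x‖ * ‖ι v x‖) μ :=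
  (Lp.memLp (ι u)).norm.integrable_mul (Lp.memLp (ι v)).norm

theorem integrable_cube (u : X) : Integrable (fun x => ‖ι u x‖ ^ 3) μ := by
  simpa using (hι.memLp_three u).integrable_norm_pow (by norm_num)

theorem integrable_mul_mul (u v w : X) :
    Integrable (fun x => ‖ι u x‖ * (‖ι v x‖ * ‖ι w x‖)) μ := by
  refine ((((hι.integrable_cube u).add (hι.integrable_cube v)).add
    (hι.integrable_cube w)).div_const 3).mono'
    ((aesm u).norm.mul ((aesm v).norm.mul (aesm w).norm)) (Eventually.of_forall fun x => ?_)
  rw [Real.norm_of_nonneg (by positivity)]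
  exact mul_mul_le_cubes (norm_nonneg _) (norm_nonneg _) (norm_nonneg _)

omit hι in
theorem integral_eq_zero_left (F : α → ℝ) :
    ∫ x, ‖ι (0 : X) x‖ * F x ∂μ = 0 := by
  rw [map_zero]
  refine integral_eq_zero_of_ae ?_
  filter_upwards [Lp.coeFn_zero V 2 μ] with x hx
  simp only [hx, Pi.zero_apply, norm_zero, zero_mul]

theorem integral_mul_le (u v : X) : ∫ x, ‖ι u x‖ * ‖ι v x‖ ∂μ ≤ K * (‖u‖ * ‖v‖) := by
  rcases eq_or_ne u 0 with rfl | hu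
  · rw [integral_eq_zero_left]; simp
  rcases eq_or_ne v 0 with rfl | hv
  · simp_rw [mul_comm ‖ι u _‖]; rw [integral_eq_zero_left]; simp
  have hu' := norm_pos_iff.mpr hu
  have hv' := norm_pos_iff.mpr hv
  have h2 : ∀ u : X, Integrable (fun x => ‖ι u x‖ ^ 2) μ := fun u =>
    (Lp.memLp (ι u)).norm.integrable_sq
  calc ∫ x, ‖ι u x‖ * ‖ι v x‖ ∂μ
      ≤ ∫ x, (‖v‖ / ‖u‖ / 2 * ‖ι u x‖ ^ 2 + ‖u‖ / ‖v‖ / 2 * ‖ι v x‖ ^ 2) ∂μ := by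
        refine integral_mono (integrable_mul u v)
          (((h2 u).const_mul _).add ((h2 v).const_mul _)) fun x => ?_
        have key : ‖v‖ / ‖u‖ / 2 * ‖ι u x‖ ^ 2 + ‖u‖ / ‖v‖ / 2 * ‖ι v x‖ ^ 2 - ‖ι u x‖ * ‖ι v x‖
            = (‖v‖ * ‖ι u x‖ - ‖u‖ * ‖ι v x‖) ^ 2 / (2 * ‖u‖ * ‖v‖) := by field_simp; ring
        have : 0 ≤ (‖v‖ * ‖ι u x‖ - ‖u‖ * ‖ι v x‖) ^ 2 / (2 * ‖u‖ * ‖v‖) := by positivity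
        simp only
        linarith
    _ ≤ ‖v‖ / ‖u‖ / 2 * (K * ‖u‖ ^ 2) + ‖u‖ / ‖v‖ / 2 * (K * ‖v‖ ^ 2) := by
        rw [integral_add ((h2 u).const_mul _) ((h2 v).const_mul _), integral_const_mul,
          integral_const_mul]
        have := hι.integral_sq_le u
        have := hι.integral_sq_le v
        gcongr
    _ = K * (‖u‖ * ‖v‖) := by field_simp; ring

theorem integral_mul_mul_le (u v w : X) :
    ∫ x, ‖ι u x‖ * (‖ι v x‖ * ‖ι w x‖) ∂μ ≤ K * (‖u‖ * (‖v‖ * ‖w‖)) := by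
  rcases eq_or_ne u 0 with rfl | hu
  · rw [integral_eq_zero_left]; simp
  rcases eq_or_ne v 0 with rfl | hv
  · simp_rw [mul_left_comm ‖ι u _‖]; rw [integral_eq_zero_left]; simp
  rcases eq_or_ne w 0 with rfl | hw
  · simp_rw [mul_comm ‖ι v _‖, mul_left_comm ‖ι u _‖]; rw [integral_eq_zero_left]; simp
  have hu' := norm_pos_iff.mpr hu
  have hv' := norm_pos_iff.mpr hv
  have hw' := norm_pos_iff.mpr hw
  set P := ‖u‖ * (‖v‖ * ‖w‖) with hP
  have hP0 : 0 < P := by positivity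
  have hi := fun u : X => hι.integrable_cube u
  calc ∫ x, ‖ι u x‖ * (‖ι v x‖ * ‖ι w x‖) ∂μ
      ≤ ∫ x, (P / ‖u‖ ^ 3 / 3 * ‖ι u x‖ ^ 3 + P / ‖v‖ ^ 3 / 3 * ‖ι v x‖ ^ 3
          + P / ‖w‖ ^ 3 / 3 * ‖ι w x‖ ^ 3) ∂μ := by
        refine integral_mono (hι.integrable_mul_mul u v w)
          ((((hi u).const_mul _).add ((hi v).const_mul _)).add ((hi w).const_mul _)) fun x => ?_
        have key := mul_mul_le_cubes (a := ‖ι u x‖ / ‖u‖) (b := ‖ι v x‖ / ‖v‖)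
          (c := ‖ι w x‖ / ‖w‖) (by positivity) (by positivity) (by positivity)
        have h1 := mul_le_mul_of_nonneg_left key hP0.le
        calc ‖ι u x‖ * (‖ι v x‖ * ‖ι w x‖)
            = P * (‖ι u x‖ / ‖u‖ * (‖ι v x‖ / ‖v‖ * (‖ι w x‖ / ‖w‖))) := by
              rw [hP]; field_simp
          _ ≤ _ := h1
          _ = _ := by simp only [div_pow]; ring
    _ ≤ P / ‖u‖ ^ 3 / 3 * (K * ‖u‖ ^ 3) + P / ‖v‖ ^ 3 / 3 * (K * ‖v‖ ^ 3)
          + P / ‖w‖ ^ 3 / 3 * (K * ‖w‖ ^ 3) := by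
        have huv : Integrable (fun x => P / ‖u‖ ^ 3 / 3 * ‖ι u x‖ ^ 3
          + P / ‖v‖ ^ 3 / 3 * ‖ι v x‖ ^ 3) μ := ((hi u).const_mul _).add ((hi v).const_mul _)
        rw [integral_add huv ((hi w).const_mul _),
          integral_add ((hi u).const_mul _) ((hi v).const_mul _),
          integral_const_mul,
          integral_const_mul, integral_const_mul]
        have := hι.integral_cube_le u
        have := hι.integral_cube_le v
        have := hι.integral_cube_le w
        gcongr
    _ = K * P := by field_simp; ring

theorem integrable_weight (y z u v : X) :
    Integrable (fun x => (1 + ‖ι y x‖ + ‖ι z x‖) * (‖ι u x‖ * ‖ι v x‖)) μ := by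
  refine (((integrable_mul (ι := ι) u v).add (hι.integrable_mul_mul y u v)).add
    (hι.integrable_mul_mul z u v)).congr (Eventually.of_forall fun x => ?_)
  simp only [Pi.add_apply]; ring

theorem integral_weight_le (y z u v : X) :
    ∫ x, (1 + ‖ι y x‖ + ‖ι z x‖) * (‖ι u x‖ * ‖ι v x‖) ∂μ
      ≤ K * (1 + ‖y‖ + ‖z‖) * (‖u‖ * ‖v‖) := by
  have h : ∀ x, (1 + ‖ι y x‖ + ‖ι z x‖) * (‖ι u x‖ * ‖ι v x‖) = ‖ι u x‖ * ‖ι v x‖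
      + ‖ι y x‖ * (‖ι u x‖ * ‖ι v x‖) + ‖ι z x‖ * (‖ι u x‖ * ‖ι v x‖) := fun x => by ring
  simp_rw [h]
  have huv : Integrable (fun x => ‖ι u x‖ * ‖ι v x‖ + ‖ι y x‖ * (‖ι u x‖ * ‖ι v x‖)) μ :=
    (integrable_mul (ι := ι) u v).add (hι.integrable_mul_mul y u v)
  rw [integral_add huv (hι.integrable_mul_mul z u v), integral_add (integrable_mul (ι := ι) u v)
    (hι.integrable_mul_mul y u v)]
  have h1 := hι.integral_mul_le u v
  have h2 := hι.integral_mul_mul_le y u v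
  have h3 := hι.integral_mul_mul_le z u v
  linarith

theorem continuous : Continuous ι := by
  refine AddMonoidHomClass.continuous_of_bound ι (Real.sqrt K) fun u => ?_
  refine le_of_sq_le_sq ?_ (by positivity)
  rw [norm_sq_eq_integral, mul_pow, Real.sq_sqrt hι.const_nonneg]
  exact hι.integral_sq_le u

end IsCubicEmbedding

/-! ### Functionals represented by fields -/

/-- The fields `R` with `|R| ≤ c (1 + |y| + |z|) |ξ|` for some `y, z, ξ ∈ X`: those that represent
an element of the dual of `X` by pairing in `L²`. -/
structure IsControlled (ι : X →ₗ[ℝ] Lp V 2 μ) (R : α → V) (c : ℝ) (y z ξ : X) : Prop where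
  aesm : AEStronglyMeasurable R μ
  const_nonneg : 0 ≤ c
  norm_le : ∀ᵐ x ∂μ, ‖R x‖ ≤ c * ((1 + ‖ι y x‖ + ‖ι z x‖) * ‖ι ξ x‖)

theorem IsControlled.integrable_norm_mul {ι : X →ₗ[ℝ] Lp V 2 μ} {K : ℝ}
    (hι : IsCubicEmbedding ι K) {R : α → V} {c : ℝ} {y z ξ : X} (h : IsControlled ι R c y z ξ)
    (φ : X) : Integrable (fun x => ‖R x‖ * ‖ι φ x‖) μ := by
  refine ((hι.integrable_weight y z ξ φ).const_mul c).mono'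
    (h.aesm.norm.mul (IsCubicEmbedding.aesm φ).norm) ?_
  filter_upwards [h.norm_le] with x hx
  rw [Real.norm_of_nonneg (by positivity)]
  calc ‖R x‖ * ‖ι φ x‖ ≤ c * ((1 + ‖ι y x‖ + ‖ι z x‖) * ‖ι ξ x‖) * ‖ι φ x‖ := by gcongr
    _ = _ := by ring

theorem IsControlled.integrable {ι : X →ₗ[ℝ] Lp V 2 μ} {K : ℝ}
    (hι : IsCubicEmbedding ι K) {R : α → V} {c : ℝ} {y z ξ : X} (h : IsControlled ι R c y z ξ)
    (φ : X) : Integrable (fun x => inner ℝ (R x) (ι φ x)) μ := by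
  refine (h.integrable_norm_mul hι φ).mono'
    (h.aesm.inner (𝕜 := ℝ) (IsCubicEmbedding.aesm (ι := ι) φ))
    (Eventually.of_forall fun x => ?_)
  exact norm_inner_le_norm (𝕜 := ℝ) _ _

theorem IsControlled.abs_integral_le {ι : X →ₗ[ℝ] Lp V 2 μ} {K : ℝ}
    (hι : IsCubicEmbedding ι K) {R : α → V} {c : ℝ} {y z ξ : X} (h : IsControlled ι R c y z ξ)
    (φ : X) : |∫ x, inner ℝ (R x) (ι φ x) ∂μ| ≤ c * K * (1 + ‖y‖ + ‖z‖) * ‖ξ‖ * ‖φ‖ := by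
  rw [← Real.norm_eq_abs]
  refine (norm_integral_le_of_norm_le ((hι.integrable_weight y z ξ φ).const_mul c) ?_).trans ?_
  · filter_upwards [h.norm_le] with x hx
    refine (norm_inner_le_norm _ _).trans ?_
    calc ‖R x‖ * ‖ι φ x‖ ≤ c * ((1 + ‖ι y x‖ + ‖ι z x‖) * ‖ι ξ x‖) * ‖ι φ x‖ := by gcongr
      _ = _ := by ring
  · rw [integral_const_mul]
    calc _ ≤ c * (K * (1 + ‖y‖ + ‖z‖) * (‖ξ‖ * ‖φ‖)) :=
          mul_le_mul_of_nonneg_left (hι.integral_weight_le y z ξ φ) h.const_nonneg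
      _ = _ := by ring

/-- The functional `φ ↦ ∫ ⟨R(x), φ(x)⟩ dx` of a controlled field. -/
def fieldPairing {ι : X →ₗ[ℝ] Lp V 2 μ} {K : ℝ} (hι : IsCubicEmbedding ι K) {R : α → V} {c : ℝ}
    {y z ξ : X} (h : IsControlled ι R c y z ξ) : X →L[ℝ] ℝ :=
  LinearMap.mkContinuous
    { toFun := fun φ => ∫ x, inner ℝ (R x) (ι φ x) ∂μ
      map_add' := fun φ φ' => by
        rw [← integral_add (h.integrable hι φ) (h.integrable hι φ')]
        refine integral_congr_ae ?_
        rw [map_add]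
        filter_upwards [Lp.coeFn_add (ι φ) (ι φ')] with x hx
        rw [hx, Pi.add_apply, inner_add_right]
      map_smul' := fun s φ => by
        rw [RingHom.id_apply, smul_eq_mul, ← integral_const_mul]
        refine integral_congr_ae ?_
        rw [map_smul]
        filter_upwards [Lp.coeFn_smul s (ι φ)] with x hx
        rw [hx, Pi.smul_apply, real_inner_smul_right] }
    (c * K * (1 + ‖y‖ + ‖z‖) * ‖ξ‖) fun φ => h.abs_integral_le hι φ

theorem fieldPairing_apply {ι : X →ₗ[ℝ] Lp V 2 μ} {K : ℝ} (hι : IsCubicEmbedding ι K) {R : α → V}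
    {c : ℝ} {y z ξ : X} (h : IsControlled ι R c y z ξ) (φ : X) :
    fieldPairing hι h φ = ∫ x, inner ℝ (R x) (ι φ x) ∂μ := rfl

theorem norm_fieldPairing_le {ι : X →ₗ[ℝ] Lp V 2 μ} {K : ℝ} (hι : IsCubicEmbedding ι K)
    {R : α → V} {c : ℝ} {y z ξ : X} (h : IsControlled ι R c y z ξ) :
    ‖fieldPairing hι h‖ ≤ c * K * (1 + ‖y‖ + ‖z‖) * ‖ξ‖ := by
  have := h.const_nonneg
  have := hι.const_nonneg
  exact LinearMap.mkContinuous_norm_le _ (by positivity) _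

/-- Cauchy–Schwarz with the weight `m = 1 + |y| + |z|`, in its quadratic form. -/
theorem norm_fieldPairing_le_weighted {ι : X →ₗ[ℝ] Lp V 2 μ} {K : ℝ} (hι : IsCubicEmbedding ι K)
    {R : α → V} {c : ℝ} {y z ξ : X} (h : IsControlled ι R c y z ξ) {ε : ℝ} (hε : 0 < ε)
    (hi : Integrable (fun x => ‖R x‖ ^ 2 / (1 + ‖ι y x‖ + ‖ι z x‖)) μ) :
    ‖fieldPairing hι h‖ ≤ (∫ x, ‖R x‖ ^ 2 / (1 + ‖ι y x‖ + ‖ι z x‖) ∂μ) / (2 * ε)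
      + ε / 2 * (K * (1 + ‖y‖ + ‖z‖)) := by
  have hK := hι.const_nonneg
  have hρ : 0 ≤ ∫ x, ‖R x‖ ^ 2 / (1 + ‖ι y x‖ + ‖ι z x‖) ∂μ :=
    integral_nonneg fun x => by positivity
  refine ContinuousLinearMap.opNorm_le_bound _ (by positivity) fun φ => ?_
  rcases eq_or_ne φ 0 with rfl | hφ
  · simp
  have hφ' := norm_pos_iff.mpr hφ
  have hw := hι.integrable_weight y z φ φ
  rw [fieldPairing_apply]
  calc ‖∫ x, inner ℝ (R x) (ι φ x) ∂μ‖
      ≤ ∫ x, (‖φ‖ / (2 * ε) * (‖R x‖ ^ 2 / (1 + ‖ι y x‖ + ‖ι z x‖))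
          + ε / (2 * ‖φ‖) * ((1 + ‖ι y x‖ + ‖ι z x‖) * (‖ι φ x‖ * ‖ι φ x‖))) ∂μ := by
        refine norm_integral_le_of_norm_le ((hi.const_mul _).add (hw.const_mul _))
          (Eventually.of_forall fun x => (norm_inner_le_norm _ _).trans ?_)
        set m := 1 + ‖ι y x‖ + ‖ι z x‖ with hm
        have hm0 : 0 < m := by positivity
        have key : ‖φ‖ / (2 * ε) * (‖R x‖ ^ 2 / m) + ε / (2 * ‖φ‖) * (m * (‖ι φ x‖ * ‖ι φ x‖))
            - ‖R x‖ * ‖ι φ x‖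
            = (‖φ‖ * ‖R x‖ - ε * m * ‖ι φ x‖) ^ 2 / (2 * ε * ‖φ‖ * m) := by
          field_simp; ring
        have : 0 ≤ (‖φ‖ * ‖R x‖ - ε * m * ‖ι φ x‖) ^ 2 / (2 * ε * ‖φ‖ * m) := by positivity
        linarith
    _ ≤ ‖φ‖ / (2 * ε) * (∫ x, ‖R x‖ ^ 2 / (1 + ‖ι y x‖ + ‖ι z x‖) ∂μ)
          + ε / (2 * ‖φ‖) * (K * (1 + ‖y‖ + ‖z‖) * (‖φ‖ * ‖φ‖)) := by
        rw [integral_add (hi.const_mul _) (hw.const_mul _), integral_const_mul,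
          integral_const_mul]
        have := hι.integral_weight_le y z φ φ
        gcongr
    _ = _ := by field_simp

/-- Dominated convergence in the dual of `X`: the fields `R n` are dominated by a fixed weight
up to a perturbation `z n` that vanishes in the limit. -/
theorem tendsto_fieldPairing_zero {ι : X →ₗ[ℝ] Lp V 2 μ} {K : ℝ} (hι : IsCubicEmbedding ι K)
    {R : ℕ → α → V} {c : ℝ} {y ξ : X} {z : ℕ → X} (h : ∀ n, IsControlled ι (R n) c y (z n) ξ)
    (hz : Tendsto z atTop (𝓝 0)) (hR : ∀ᵐ x ∂μ, Tendsto (fun n => R n x) atTop (𝓝 0)) :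
    Tendsto (fun n => fieldPairing hι (h n)) atTop (𝓝 0) := by
  have hK := hι.const_nonneg
  have hc : 0 ≤ c := (h 0).const_nonneg
  set B : ℕ → α → ℝ := fun n x => ‖R n x‖ ^ 2 / (1 + ‖ι y x‖ + ‖ι (z n) x‖) with hB
  have hB0 : ∀ n x, 0 ≤ B n x := fun n x => by positivity
  have hBm : ∀ n, AEStronglyMeasurable (B n) μ := fun n =>
    (((h n).aesm.norm.aemeasurable.pow_const 2).div
      ((IsCubicEmbedding.aesm y).norm.aemeasurable.const_add 1 |>.add
        (IsCubicEmbedding.aesm (z n)).norm.aemeasurable)).aestronglyMeasurable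
  have hBle : ∀ n, ∀ᵐ x ∂μ, B n x ≤
      c ^ 2 * ((1 + ‖ι y x‖ + ‖ι (z n) x‖) * (‖ι ξ x‖ * ‖ι ξ x‖)) := fun n => by
    filter_upwards [(h n).norm_le] with x hx
    have hm0 : 0 < 1 + ‖ι y x‖ + ‖ι (z n) x‖ := by positivity
    simp only [hB]
    rw [div_le_iff₀ hm0]
    calc ‖R n x‖ ^ 2 ≤ (c * ((1 + ‖ι y x‖ + ‖ι (z n) x‖) * ‖ι ξ x‖)) ^ 2 := by gcongr
      _ = _ := by ring
  have hBi : ∀ n, Integrable (B n) μ := fun n =>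
    ((hι.integrable_weight y (z n) ξ ξ).const_mul (c ^ 2)).mono' (hBm n) (by
      filter_upwards [hBle n] with x hx
      rwa [Real.norm_of_nonneg (hB0 n x)])
  set D : α → ℝ := fun x => c ^ 2 * ((1 + ‖ι y x‖ + ‖ι (0 : X) x‖) * (‖ι ξ x‖ * ‖ι ξ x‖)) with hD
  have hDi : Integrable D μ := (hι.integrable_weight y 0 ξ ξ).const_mul (c ^ 2)
  have hD0 : ∀ x, 0 ≤ D x := fun x => by positivity
  have hmin : Tendsto (fun n => ∫ x, min (B n x) (D x) ∂μ) atTop (𝓝 0) := by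
    rw [← integral_zero α ℝ (μ := μ)]
    refine tendsto_integral_of_dominated_convergence D
      (fun n => (hBm n).inf hDi.aestronglyMeasurable) hDi
      (fun n => Eventually.of_forall fun x => ?_) ?_
    · rw [Real.norm_of_nonneg (le_min (hB0 n x) (hD0 x))]
      exact min_le_right _ _
    · filter_upwards [hR] with x hx
      have h1 : Tendsto (fun n => ‖R n x‖ ^ 2) atTop (𝓝 0) := by simpa using hx.norm.pow 2
      refine squeeze_zero (fun n => le_min (hB0 n x) (hD0 x))
        (fun n => (min_le_left _ _).trans ?_) h1
      exact div_le_self (by positivity)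
        (by linarith [norm_nonneg (ι y x), norm_nonneg (ι (z n) x)])
  have hρ : Tendsto (fun n => ∫ x, B n x ∂μ) atTop (𝓝 0) := by
    have hup : Tendsto (fun n => ∫ x, min (B n x) (D x) ∂μ + c ^ 2 * (K * (‖z n‖ * (‖ξ‖ * ‖ξ‖))))
        atTop (𝓝 0) := by
      have := hmin.add (((hz.norm.mul_const (‖ξ‖ * ‖ξ‖)).const_mul K).const_mul (c ^ 2))
      simpa using this
    refine squeeze_zero (fun n => integral_nonneg (hB0 n)) (fun n => ?_) hup
    have hmi : Integrable (fun x => min (B n x) (D x)) μ := (hBi n).inf hDi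
    have hci := (hι.integrable_mul_mul (z n) ξ ξ).const_mul (c ^ 2)
    calc ∫ x, B n x ∂μ
        ≤ ∫ x, (min (B n x) (D x) + c ^ 2 * (‖ι (z n) x‖ * (‖ι ξ x‖ * ‖ι ξ x‖))) ∂μ := by
          refine integral_mono_ae (hBi n) (hmi.add hci) ?_
          filter_upwards [hBle n] with x hx
          have hp : 0 ≤ c ^ 2 * (‖ι (z n) x‖ * (‖ι ξ x‖ * ‖ι ξ x‖)) := by positivity
          rcases le_total (B n x) (D x) with h' | h'
          · rw [min_eq_left h']; linarith
          · rw [min_eq_right h']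
            refine hx.trans ?_
            have : 0 ≤ c ^ 2 * (‖ι (0 : X) x‖ * (‖ι ξ x‖ * ‖ι ξ x‖)) := by positivity
            simp only [hD]
            linarith
      _ ≤ _ := by
          rw [integral_add hmi hci, integral_const_mul]
          have := hι.integral_mul_mul_le (z n) ξ ξ
          gcongr
  rw [Metric.tendsto_atTop]
  intro ε hε
  set L := K * (2 + ‖y‖) + 1 with hL
  have hL0 : 0 < L := by positivity
  have h1 := (Metric.tendsto_atTop.mp hρ) (ε ^ 2 / L) (by positivity)
  have h2 := (Metric.tendsto_atTop.mp hz) 1 one_pos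
  obtain ⟨n1, h1⟩ := h1
  obtain ⟨n2, h2⟩ := h2
  refine ⟨max n1 n2, fun n hn => ?_⟩
  have h1 := h1 n (le_of_max_le_left hn)
  have h2 := h2 n (le_of_max_le_right hn)
  rw [dist_zero_right] at h1 h2 ⊢
  rw [Real.norm_of_nonneg (integral_nonneg (hB0 n))] at h1
  have h3 := norm_fieldPairing_le_weighted hι (h n) (ε := ε / L) (by positivity) (hBi n)
  have h4 : (∫ x, B n x ∂μ) / (2 * (ε / L)) < (ε ^ 2 / L) / (2 * (ε / L)) := by gcongr
  have h5 : (ε ^ 2 / L) / (2 * (ε / L)) = ε / 2 := by field_simp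
  have h6 : K * (1 + ‖y‖ + ‖z n‖) ≤ L := by
    have : K * (1 + ‖y‖ + ‖z n‖) ≤ K * (2 + ‖y‖) :=
      mul_le_mul_of_nonneg_left (by linarith) hK
    linarith
  have h7 : ε / L / 2 * (K * (1 + ‖y‖ + ‖z n‖)) ≤ ε / L / 2 * L := by gcongr
  have h8 : ε / L / 2 * L = ε / 2 := by field_simp
  linarith


/-! ### Potentials of cubic growth -/

/-- A potential `ψ(x, y)` of cubic growth in `y`, with gradient field `N` and Hessian `A`. The
Hessian is continuous in `y` at every fixed `x`, with no uniformity in `x`. -/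
structure IsCubicPotential (μ : Measure α) (ψ : α → V → ℝ) (N : α → V → V)
    (A : α → V → V →L[ℝ] V) (C : ℝ) : Prop where
  const_nonneg : 0 ≤ C
  aesm_potential : ∀ u : α → V, AEStronglyMeasurable u μ →
    AEStronglyMeasurable (fun x => ψ x (u x)) μ
  aesm_field : ∀ u : α → V, AEStronglyMeasurable u μ →
    AEStronglyMeasurable (fun x => N x (u x)) μ
  potential_zero : ∀ᵐ x ∂μ, ψ x 0 = 0
  field_zero : ∀ᵐ x ∂μ, N x 0 = 0
  hasFDerivAt_potential : ∀ᵐ x ∂μ, ∀ y, HasFDerivAt (ψ x) (innerSL ℝ (N x y)) y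
  hasFDerivAt_field : ∀ᵐ x ∂μ, ∀ y, HasFDerivAt (N x) (A x y) y
  norm_le : ∀ᵐ x ∂μ, ∀ y, ‖A x y‖ ≤ C * (1 + ‖y‖)
  continuous : ∀ᵐ x ∂μ, Continuous (A x)

namespace IsCubicPotential

variable {ψ : α → V → ℝ} {N : α → V → V} {A : α → V → V →L[ℝ] V} {C : ℝ}
  (hψ : IsCubicPotential μ ψ N A C)
include hψ

theorem norm_field_sub_le : ∀ᵐ x ∂μ, ∀ y z,
    ‖N x y - N x z‖ ≤ C * ((1 + ‖y‖ + ‖z‖) * ‖y - z‖) := by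
  filter_upwards [hψ.hasFDerivAt_field, hψ.norm_le] with x h1 h2 y z
  have hC := hψ.const_nonneg
  have := (convex_closedBall (0 : V) (max ‖y‖ ‖z‖)).norm_image_sub_le_of_norm_hasFDerivWithin_le
    (f := N x) (f' := A x) (C := C * (1 + ‖y‖ + ‖z‖)) (x := z) (y := y)
    (fun w _ => (h1 w).hasFDerivWithinAt) (fun w hw => ?_)
    (by simp) (by simp)
  · linarith
  · refine (h2 w).trans ?_
    have : ‖w‖ ≤ ‖y‖ + ‖z‖ := (by simpa using hw : ‖w‖ ≤ max ‖y‖ ‖z‖).trans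
      (max_le_add_of_nonneg (norm_nonneg _) (norm_nonneg _))
    exact mul_le_mul_of_nonneg_left (by linarith) hC

theorem norm_field_le : ∀ᵐ x ∂μ, ∀ y, ‖N x y‖ ≤ C * ((1 + ‖y‖) * ‖y‖) := by
  filter_upwards [hψ.norm_field_sub_le, hψ.field_zero] with x h1 h2 y
  simpa [h2] using h1 y 0

theorem abs_potential_sub_le : ∀ᵐ x ∂μ, ∀ y k,
    |ψ x (y + k) - ψ x y - inner ℝ (N x y) k|
      ≤ 2 * C * ((1 + ‖y‖ + ‖k‖) * (‖k‖ * ‖k‖)) := by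
  filter_upwards [hψ.hasFDerivAt_potential, hψ.norm_field_sub_le] with x h1 h2 y k
  have hC := hψ.const_nonneg
  have := (convex_closedBall y ‖k‖).norm_image_sub_le_of_norm_hasFDerivWithin_le
    (f := fun w => ψ x w - innerSL ℝ (N x y) w)
    (f' := fun w => innerSL ℝ (N x w) - innerSL ℝ (N x y))
    (C := C * ((1 + (‖y‖ + ‖k‖) + ‖y‖) * ‖k‖)) (x := y) (y := y + k)
    (fun w _ => ((h1 w).sub (innerSL ℝ (N x y)).hasFDerivAt).hasFDerivWithinAt) (fun w hw => ?_)
    (by simp) (by simp)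
  · rw [add_sub_cancel_left, Real.norm_eq_abs, map_add] at this
    calc |ψ x (y + k) - ψ x y - inner ℝ (N x y) k|
        = |ψ x (y + k) - (innerSL ℝ (N x y) y + innerSL ℝ (N x y) k)
            - (ψ x y - innerSL ℝ (N x y) y)| := by
          congr 1; simp only [innerSL_apply_apply]; ring
      _ ≤ C * ((1 + (‖y‖ + ‖k‖) + ‖y‖) * ‖k‖) * ‖k‖ := this
      _ ≤ C * ((2 * (1 + ‖y‖ + ‖k‖)) * ‖k‖) * ‖k‖ := by
          gcongr
          linarith [norm_nonneg k]
      _ = _ := by ring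
  · rw [← map_sub, innerSL_apply_norm]
    have hw' : ‖w - y‖ ≤ ‖k‖ := by simpa [dist_eq_norm] using hw
    have hw2 : ‖w‖ ≤ ‖y‖ + ‖k‖ := by
      have := norm_add_le y (w - y)
      rw [add_sub_cancel] at this
      linarith
    refine (h2 w y).trans ?_
    gcongr

theorem abs_potential_le : ∀ᵐ x ∂μ, ∀ y, |ψ x y| ≤ 2 * C * ((1 + ‖y‖) * (‖y‖ * ‖y‖)) := by
  filter_upwards [hψ.abs_potential_sub_le, hψ.potential_zero, hψ.field_zero] with x h1 h2 h3 y
  simpa [h2, h3] using h1 0 y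

theorem norm_deriv_apply_le : ∀ᵐ x ∂μ, ∀ y φ, ‖A x y φ‖ ≤ C * ((1 + ‖y‖) * ‖φ‖) := by
  filter_upwards [hψ.norm_le] with x h y φ
  refine ((A x y).le_opNorm φ).trans ?_
  rw [← mul_assoc]
  gcongr
  exact h y

theorem aesm_deriv {u φ : α → V} (hu : AEStronglyMeasurable u μ)
    (hφ : AEStronglyMeasurable φ μ) : AEStronglyMeasurable (fun x => A x (u x) (φ x)) μ := by
  -- the derivative is the limit of the difference quotients with steps `1 / (n + 1)`
  have hs : Tendsto (fun n : ℕ => 1 / ((n : ℝ) + 1)) atTop (𝓝[≠] 0) :=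
    tendsto_nhdsWithin_iff.mpr ⟨tendsto_one_div_add_atTop_nhds_zero_nat,
      Eventually.of_forall fun n => (Nat.one_div_pos_of_nat (α := ℝ)).ne'⟩
  refine aestronglyMeasurable_of_tendsto_ae atTop
    (f := fun (n : ℕ) x => (1 / ((n : ℝ) + 1))⁻¹ •
      (N x (u x + (1 / ((n : ℝ) + 1)) • φ x) - N x (u x)))
    (fun n => ((hψ.aesm_field _ (hu.add (hφ.const_smul _))).sub
      (hψ.aesm_field _ hu)).const_smul _) ?_
  filter_upwards [hψ.hasFDerivAt_field] with x hx
  exact ((hx (u x)).hasLineDerivAt (φ x)).tendsto_slope_zero.comp hs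

/-! #### The functional and its derivatives -/

variable {ι : X →ₗ[ℝ] Lp V 2 μ} {K : ℝ} (hι : IsCubicEmbedding ι K)
include hι

theorem integrable_potential (u : X) : Integrable (fun x => ψ x (ι u x)) μ := by
  refine ((hι.integrable_weight u 0 u u).const_mul (2 * C)).mono'
    (hψ.aesm_potential _ (IsCubicEmbedding.aesm u)) ?_
  filter_upwards [hψ.abs_potential_le] with x hx
  refine (hx _).trans ?_
  have hC := hψ.const_nonneg
  have : 1 + ‖ι u x‖ ≤ 1 + ‖ι u x‖ + ‖ι (0 : X) x‖ := le_add_of_nonneg_right (norm_nonneg _)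
  gcongr

omit hι in
theorem isControlled_field (u : X) : IsControlled ι (fun x => N x (ι u x)) C u 0 u where
  aesm := hψ.aesm_field _ (IsCubicEmbedding.aesm u)
  const_nonneg := hψ.const_nonneg
  norm_le := by
    filter_upwards [hψ.norm_field_le] with x hx
    refine (hx _).trans ?_
    have hC := hψ.const_nonneg
    have : 1 + ‖ι u x‖ ≤ 1 + ‖ι u x‖ + ‖ι (0 : X) x‖ := le_add_of_nonneg_right (norm_nonneg _)
    gcongr

omit hι in
theorem isControlled_deriv (u ξ : X) :
    IsControlled ι (fun x => A x (ι u x) (ι ξ x)) C u 0 ξ where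
  aesm := hψ.aesm_deriv (IsCubicEmbedding.aesm u) (IsCubicEmbedding.aesm ξ)
  const_nonneg := hψ.const_nonneg
  norm_le := by
    filter_upwards [hψ.norm_deriv_apply_le] with x hx
    refine (hx _ _).trans ?_
    have hC := hψ.const_nonneg
    have : 1 + ‖ι u x‖ ≤ 1 + ‖ι u x‖ + ‖ι (0 : X) x‖ := le_add_of_nonneg_right (norm_nonneg _)
    gcongr

/-- The derivative `φ ↦ ∫ ⟨N(x, u), φ⟩ dx` of `u ↦ ∫ ψ(x, u) dx`. -/
def gradient (u : X) : X →L[ℝ] ℝ := fieldPairing hι (hψ.isControlled_field u)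

theorem gradient_apply (u φ : X) :
    hψ.gradient hι u φ = ∫ x, inner ℝ (N x (ι u x)) (ι φ x) ∂μ := rfl

/-- The second derivative `(ξ, φ) ↦ ∫ ⟨A(x, u) ξ, φ⟩ dx` of `u ↦ ∫ ψ(x, u) dx`. It is a derivative
of `gradient` in the sense of Gateaux, and continuous in `u` at each fixed `ξ`. -/
def hessian (u : X) : X →L[ℝ] X →L[ℝ] ℝ :=
  LinearMap.mkContinuous
    { toFun := fun ξ => fieldPairing hι (hψ.isControlled_deriv (ι := ι) u ξ)
      map_add' := fun ξ ξ' => by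
        ext φ
        rw [add_apply, fieldPairing_apply, fieldPairing_apply, fieldPairing_apply,
          ← integral_add ((hψ.isControlled_deriv u ξ).integrable hι φ)
            ((hψ.isControlled_deriv u ξ').integrable hι φ)]
        refine integral_congr_ae ?_
        rw [map_add]
        filter_upwards [Lp.coeFn_add (ι ξ) (ι ξ')] with x hx
        rw [hx, Pi.add_apply, map_add, inner_add_left]
      map_smul' := fun s ξ => by
        ext φ
        rw [RingHom.id_apply, smul_apply, fieldPairing_apply, fieldPairing_apply, smul_eq_mul,
          ← integral_const_mul]
        refine integral_congr_ae ?_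
        rw [map_smul]
        filter_upwards [Lp.coeFn_smul s (ι ξ)] with x hx
        rw [hx, Pi.smul_apply, map_smul, real_inner_smul_left] }
    (C * K * (1 + ‖u‖ + ‖(0 : X)‖)) fun ξ => norm_fieldPairing_le hι (hψ.isControlled_deriv u ξ)

theorem hessian_apply_apply (u ξ φ : X) :
    hψ.hessian hι u ξ φ = ∫ x, inner ℝ (A x (ι u x) (ι ξ x)) (ι φ x) ∂μ := rfl

theorem norm_hessian_le (u : X) : ‖hψ.hessian hι u‖ ≤ C * K * (1 + ‖u‖) := by
  have := hψ.const_nonneg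
  have := hι.const_nonneg
  refine (LinearMap.mkContinuous_norm_le _ (by positivity) _).trans (le_of_eq ?_)
  rw [norm_zero, add_zero]

theorem norm_gradient_sub_le (u v : X) :
    ‖hψ.gradient hι u - hψ.gradient hι v‖ ≤ C * K * (1 + ‖u‖ + ‖v‖) * ‖u - v‖ := by
  have hc : IsControlled ι (fun x => N x (ι u x) - N x (ι v x)) C u v (u - v) :=
    { aesm := (hψ.aesm_field _ (IsCubicEmbedding.aesm u)).sub
        (hψ.aesm_field _ (IsCubicEmbedding.aesm v))
      const_nonneg := hψ.const_nonneg
      norm_le := by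
        rw [map_sub]
        filter_upwards [hψ.norm_field_sub_le, Lp.coeFn_sub (ι u) (ι v)] with x hx h2
        rw [h2, Pi.sub_apply]
        exact hx _ _ }
  have heq : hψ.gradient hι u - hψ.gradient hι v = fieldPairing hι hc := by
    ext φ
    rw [sub_apply, gradient_apply, gradient_apply, fieldPairing_apply,
      ← integral_sub ((hψ.isControlled_field u).integrable hι φ)
        ((hψ.isControlled_field v).integrable hι φ)]
    exact integral_congr_ae (Eventually.of_forall fun x => (inner_sub_left _ _ _).symm)
  rw [heq]
  exact norm_fieldPairing_le hι hc

theorem hasFDerivAt_integral (u : X) :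
    HasFDerivAt (fun u => ∫ x, ψ x (ι u x) ∂μ) (hψ.gradient hι u) u := by
  have hC := hψ.const_nonneg
  have hK := hι.const_nonneg
  rw [hasFDerivAt_iff_isLittleO_nhds_zero]
  have hO : (fun k => ∫ x, ψ x (ι (u + k) x) ∂μ - ∫ x, ψ x (ι u x) ∂μ - hψ.gradient hι u k)
      =O[𝓝 0] fun k : X => ‖k‖ ^ 2 := by
    refine Asymptotics.IsBigO.of_bound (2 * C * (K * (2 + ‖u‖))) ?_
    filter_upwards [Metric.ball_mem_nhds (0 : X) one_pos] with k hk
    have hk : ‖k‖ < 1 := by simpa using hk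
    have hd : Integrable (fun x => ψ x (ι (u + k) x) - ψ x (ι u x)) μ :=
      (hψ.integrable_potential hι _).sub (hψ.integrable_potential hι _)
    rw [gradient_apply, ← integral_sub (hψ.integrable_potential hι _)
      (hψ.integrable_potential hι _), ← integral_sub hd ((hψ.isControlled_field u).integrable hι k)]
    refine (norm_integral_le_of_norm_le ((hι.integrable_weight u k k k).const_mul (2 * C))
      ?_).trans ?_
    · rw [map_add]
      filter_upwards [hψ.abs_potential_sub_le, Lp.coeFn_add (ι u) (ι k)] with x hx h2
      rw [h2, Pi.add_apply]
      exact hx _ _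
    · rw [integral_const_mul, norm_pow, norm_norm]
      calc 2 * C * ∫ x, (1 + ‖ι u x‖ + ‖ι k x‖) * (‖ι k x‖ * ‖ι k x‖) ∂μ
          ≤ 2 * C * (K * (1 + ‖u‖ + ‖k‖) * (‖k‖ * ‖k‖)) := by
            gcongr
            exact hι.integral_weight_le u k k k
        _ ≤ 2 * C * (K * (2 + ‖u‖) * (‖k‖ * ‖k‖)) := by
            have : 1 + ‖u‖ + ‖k‖ ≤ 2 + ‖u‖ := by linarith
            gcongr
        _ = _ := by ring
  exact hO.trans_isLittleO (Asymptotics.isLittleO_norm_pow_id one_lt_two)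

/-- `hessian` is the Gateaux derivative of `gradient`, in the norm of the dual of `X`. -/
theorem tendsto_slope_gradient (u ξ : X) :
    Tendsto (fun s : ℝ => s⁻¹ • (hψ.gradient hι (u + s • ξ) - hψ.gradient hι u)) (𝓝[≠] 0)
      (𝓝 (hψ.hessian hι u ξ)) := by
  have hC := hψ.const_nonneg
  refine tendsto_of_seq_tendsto fun s hs => ?_
  have hs0 : Tendsto s atTop (𝓝 0) := hs.mono_right nhdsWithin_le_nhds
  have hsne : ∀ᶠ n in atTop, s n ≠ 0 := hs.eventually self_mem_nhdsWithin
  have hadd : ∀ n, ∀ᵐ x ∂μ, ι (u + s n • ξ) x = ι u x + s n • ι ξ x := fun n => by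
    rw [map_add, map_smul]
    filter_upwards [Lp.coeFn_add (ι u) (s n • ι ξ), Lp.coeFn_smul (s n) (ι ξ)] with x h1 h2
    rw [h1, Pi.add_apply, h2, Pi.smul_apply]
  have hc : ∀ n, IsControlled ι (fun x => (s n)⁻¹ • (N x (ι (u + s n • ξ) x) - N x (ι u x))
      - A x (ι u x) (ι ξ x)) (3 * C) u (s n • ξ) ξ := fun n =>
    { aesm := (((hψ.aesm_field _ (IsCubicEmbedding.aesm _)).sub
        (hψ.aesm_field _ (IsCubicEmbedding.aesm _))).const_smul _).sub
        (hψ.isControlled_deriv u ξ).aesm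
      const_nonneg := by positivity
      norm_le := by
        filter_upwards [hψ.norm_field_sub_le, hψ.norm_deriv_apply_le, hadd n,
          (map_smul ι (s n) ξ).symm ▸ Lp.coeFn_smul (s n) (ι ξ)] with x h1 h2 h3 h4
        have h5 := h1 (ι (u + s n • ξ) x) (ι u x)
        rw [h3, add_sub_cancel_left] at h5
        have h6 : ‖ι u x + s n • ι ξ x‖ ≤ ‖ι u x‖ + ‖s n • ι ξ x‖ := norm_add_le _ _
        have h7 : ‖(s n)⁻¹ • (N x (ι u x + s n • ι ξ x) - N x (ι u x))‖
            ≤ C * ((1 + (‖ι u x‖ + ‖s n • ι ξ x‖) + ‖ι u x‖) * ‖ι ξ x‖) := by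
          rcases eq_or_ne (s n) 0 with h0 | h0
          · simp only [h0, inv_zero, zero_smul, norm_zero]; positivity
          · rw [norm_smul, norm_inv, inv_mul_le_iff₀ (norm_pos_iff.mpr h0)]
            refine h5.trans ?_
            rw [norm_smul (s n) (ι ξ x)] at h6 ⊢
            calc C * ((1 + ‖ι u x + s n • ι ξ x‖ + ‖ι u x‖) * (‖s n‖ * ‖ι ξ x‖))
                ≤ C * ((1 + (‖ι u x‖ + ‖s n‖ * ‖ι ξ x‖) + ‖ι u x‖) * (‖s n‖ * ‖ι ξ x‖)) := by
                  gcongr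
              _ = _ := by ring
        rw [h3, h4, Pi.smul_apply]
        refine (norm_sub_le _ _).trans ((add_le_add h7 (h2 (ι u x) (ι ξ x))).trans ?_)
        have h8 : 0 ≤ C * ((1 + 2 * ‖s n • ι ξ x‖) * ‖ι ξ x‖) := by positivity
        linarith }
  have heq : ∀ n, fieldPairing hι (hc n) =
      (s n)⁻¹ • (hψ.gradient hι (u + s n • ξ) - hψ.gradient hι u) - hψ.hessian hι u ξ := fun n => by
    ext φ
    have hi1 := (hψ.isControlled_field (ι := ι) (u + s n • ξ)).integrable hι φ
    have hi2 := (hψ.isControlled_field (ι := ι) u).integrable hι φ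
    have hi3 := (hψ.isControlled_deriv (ι := ι) u ξ).integrable hι φ
    have hi12 : Integrable (fun x => (s n)⁻¹ * (inner ℝ (N x (ι (u + s n • ξ) x)) (ι φ x)
      - inner ℝ (N x (ι u x)) (ι φ x))) μ := (hi1.sub hi2).const_mul _
    rw [sub_apply, smul_apply, sub_apply, gradient_apply, gradient_apply, fieldPairing_apply,
      hessian_apply_apply, ← integral_sub hi1 hi2, smul_eq_mul, ← integral_const_mul,
      ← integral_sub hi12 hi3]
    refine integral_congr_ae (Eventually.of_forall fun x => ?_)
    simp only [inner_sub_left, real_inner_smul_left]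
  have hlim := tendsto_fieldPairing_zero hι hc (by simpa using hs0.smul_const ξ) (by
    filter_upwards [hψ.hasFDerivAt_field, ae_all_iff.mpr hadd] with x h1 h2
    simp_rw [h2]
    have h3 := ((h1 (ι u x)).hasLineDerivAt (ι ξ x)).tendsto_slope_zero
    have h4 := (h3.comp hs).sub_const (A x (ι u x) (ι ξ x))
    simpa using h4)
  simp_rw [heq] at hlim
  simpa [Function.comp_def] using hlim.add_const (hψ.hessian hι u ξ)

theorem continuous_hessian_apply (ξ : X) : Continuous fun u => hψ.hessian hι u ξ := by
  have hC := hψ.const_nonneg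
  rw [continuous_iff_seqContinuous]
  intro v u hv
  refine tendsto_of_subseq_tendsto fun ns hns => ?_
  -- convergence in `X` gives convergence almost everywhere along a subsequence
  have hL2 : Tendsto (fun n => ι (v (ns n))) atTop (𝓝 (ι u)) := by
    exact (hι.continuous.tendsto u).comp (hv.comp hns)
  obtain ⟨ms, hms, hae⟩ := (tendstoInMeasure_of_tendsto_Lp hL2).exists_seq_tendsto_ae
  refine ⟨ms, ?_⟩
  set w : ℕ → X := fun n => v (ns (ms n)) with hw
  have hwu : Tendsto w atTop (𝓝 u) := hv.comp (hns.comp hms.tendsto_atTop)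
  have hc : ∀ n, IsControlled ι (fun x => A x (ι (w n) x) (ι ξ x) - A x (ι u x) (ι ξ x)) (2 * C) u
      (w n - u) ξ := fun n =>
    { aesm := (hψ.isControlled_deriv (w n) ξ).aesm.sub (hψ.isControlled_deriv u ξ).aesm
      const_nonneg := by positivity
      norm_le := by
        rw [map_sub]
        filter_upwards [hψ.norm_deriv_apply_le, Lp.coeFn_sub (ι (w n)) (ι u)] with x h1 h2
        have h3 := norm_add_le (ι u x) (ι (w n) x - ι u x)
        rw [add_sub_cancel] at h3
        rw [h2, Pi.sub_apply]
        refine (norm_sub_le _ _).trans ((add_le_add (h1 _ _) (h1 _ _)).trans ?_)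
        calc C * ((1 + ‖ι (w n) x‖) * ‖ι ξ x‖) + C * ((1 + ‖ι u x‖) * ‖ι ξ x‖)
            ≤ C * ((1 + (‖ι u x‖ + ‖ι (w n) x - ι u x‖)) * ‖ι ξ x‖)
              + C * ((1 + ‖ι u x‖) * ‖ι ξ x‖) := by gcongr
          _ ≤ _ := by
              have : 0 ≤ C * (‖ι (w n) x - ι u x‖ * ‖ι ξ x‖) := by positivity
              linarith }
  have heq : ∀ n, fieldPairing hι (hc n) = hψ.hessian hι (w n) ξ - hψ.hessian hι u ξ := fun n => by
    ext φ
    rw [sub_apply, hessian_apply_apply, hessian_apply_apply, fieldPairing_apply,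
      ← integral_sub ((hψ.isControlled_deriv (w n) ξ).integrable hι φ)
        ((hψ.isControlled_deriv u ξ).integrable hι φ)]
    exact integral_congr_ae (Eventually.of_forall fun x => inner_sub_left _ _ _)
  have hlim := tendsto_fieldPairing_zero hι hc (by simpa using hwu.sub_const u) (by
    filter_upwards [hψ.continuous, hae] with x h1 h2
    have h3 : Tendsto (fun n => A x (ι (w n) x) (ι ξ x)) atTop (𝓝 (A x (ι u x) (ι ξ x))) :=
      ((ContinuousLinearMap.apply ℝ V (ι ξ x)).continuous.tendsto _).comp
        ((h1.tendsto (ι u x)).comp h2)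
    simpa using h3.sub_const (A x (ι u x) (ι ξ x)))
  simp_rw [heq] at hlim
  simpa using hlim.add_const (hψ.hessian hι u ξ)

end IsCubicPotential

end Nemytskii

/-! ### Measurability of the nonlinearity, and the potential of the problem -/

section Potential

open Filter Topology

/-- Off a null set, `(x, s) ↦ g(x, s) s` agrees with a jointly measurable function. -/
theorem IsAdmissible.exists_measurable {g : Space → ℝ → ℝ} (hg : IsAdmissible g) :
    ∃ f : Space → ℝ → ℝ, Measurable (Function.uncurry f) ∧
      ∀ᵐ x, ∀ s, 0 ≤ s → f x s = g x s * s := by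
  classical
  set F : Space → ℝ → ℝ := fun x s => g x (max s 0) * max s 0 with hF
  have hFc : ∀ x, Continuous (F x) := fun x =>
    ((hg.contDiffOn x).continuousOn).comp_continuous (f := fun s : ℝ => max s 0) (by fun_prop)
      fun s => mem_Ici.mpr (le_max_right _ _)
  have hFm : ∀ s, AEMeasurable (fun x => F x s) volume := fun s => by
    rcases le_or_gt s 0 with hs | hs
    · simp only [hF, max_eq_right hs, mul_zero]; exact aemeasurable_const
    · simp only [hF, max_eq_left hs.le]; exact (hg.measurable s hs).mul_const s
  have hae : ∀ᵐ x, ∀ q : ℚ, F x q = (hFm q).mk _ x := ae_all_iff.mpr fun q => (hFm q).ae_eq_mk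
  obtain ⟨S, hS, hSm, hS0⟩ := exists_measurable_superset_of_null (ae_iff.mp hae)
  have hmem : ∀ x, x ∉ S → ∀ q : ℚ, F x q = (hFm q).mk _ x := fun x hx => by
    by_contra h
    exact hx (hS h)
  set f : Space → ℝ → ℝ := fun x s => Sᶜ.indicator (fun x => F x s) x with hf
  have hfc : ∀ x, Continuous (f x) := fun x => by
    by_cases hx : x ∈ Sᶜ
    · simp only [hf, indicator_of_mem hx]; exact hFc x
    · simp only [hf, indicator_of_notMem hx]; exact continuous_const
  have hfq : ∀ q : ℚ, Measurable fun x => f x q := fun q => by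
    have : (fun x => f x q) = Sᶜ.indicator ((hFm q).mk _) := by
      funext x
      by_cases hx : x ∈ Sᶜ
      · simp only [hf, indicator_of_mem hx]; exact hmem x hx q
      · simp only [hf, indicator_of_notMem hx]
    rw [this]
    exact (hFm q).measurable_mk.indicator hSm.compl
  have hfm : ∀ s : ℝ, Measurable fun x => f x s := fun s => by
    obtain ⟨r, hr, hlim⟩ := mem_closure_iff_seq_limit.mp (Rat.denseRange_cast (𝕜 := ℝ) s)
    refine measurable_of_tendsto_metrizable (f := fun n x => f x (r n)) (fun n => ?_)
      (tendsto_pi_nhds.mpr fun x => ((hfc x).tendsto s).comp hlim)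
    obtain ⟨q, hq⟩ := hr n
    rw [← hq]
    exact hfq q
  refine ⟨f, (measurable_uncurry_of_continuous_of_measurable (u := fun s x => f x s) hfc
    hfm).comp measurable_swap, ?_⟩
  filter_upwards [measure_eq_zero_iff_ae_notMem.mp hS0] with x hx s hs
  simp only [hf, indicator_of_mem (mem_compl hx), hF, max_eq_left hs]

theorem IsAdmissible.aesm_radialField {g : Space → ℝ → ℝ} (hg : IsAdmissible g)
    {u : Space → Spinor} (hu : AEStronglyMeasurable u volume) :
    AEStronglyMeasurable (fun x => radialField (g x) (u x)) volume := by
  obtain ⟨f, hfm, hf⟩ := hg.exists_measurable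
  have hn : AEMeasurable (fun x => ‖u x‖) volume := hu.norm.aemeasurable
  have h1 : AEMeasurable (fun x => f x ‖u x‖) volume :=
    hfm.comp_aemeasurable (aemeasurable_id.prodMk hn)
  refine ((h1.div hn).aestronglyMeasurable.smul hu).congr ?_
  filter_upwards [hf] with x hx
  rcases eq_or_ne (u x) 0 with h0 | h0
  · simp [radialField, h0]
  · have : ‖u x‖ ≠ 0 := norm_ne_zero_iff.mpr h0
    simp only [Pi.smul_apply', Pi.div_apply, hx _ (norm_nonneg _), radialField]
    rw [mul_div_cancel_right₀ _ this]

theorem IsAdmissible.aesm_radialPotential {g : Space → ℝ → ℝ} (hg : IsAdmissible g)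
    {u : Space → Spinor} (hu : AEStronglyMeasurable u volume) :
    AEStronglyMeasurable (fun x => radialPotential (g x) (u x)) volume := by
  obtain ⟨f, hfm, hf⟩ := hg.exists_measurable
  have hn : AEMeasurable (fun x => ‖u x‖) volume := hu.norm.aemeasurable
  have hjoint : StronglyMeasurable (Function.uncurry fun (p : Space × ℝ) (t : ℝ) =>
      (Ioc 0 p.2).indicator (f p.1) t) := by
    have h1 : Measurable fun q : (Space × ℝ) × ℝ => f q.1.1 q.2 :=
      hfm.comp ((measurable_fst.comp measurable_fst).prodMk measurable_snd)
    have h2 : MeasurableSet {q : (Space × ℝ) × ℝ | 0 < q.2 ∧ q.2 ≤ q.1.2} :=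
      (measurableSet_lt measurable_const measurable_snd).inter
        (measurableSet_le measurable_snd (measurable_snd.comp measurable_fst))
    convert! (h1.indicator h2).stronglyMeasurable using 1
  have hΦ : Measurable fun p : Space × ℝ => ∫ t, (Ioc 0 p.2).indicator (f p.1) t :=
    hjoint.integral_prod_right.measurable
  refine (hΦ.comp_aemeasurable (aemeasurable_id.prodMk hn)).aestronglyMeasurable.congr ?_
  filter_upwards [hf] with x hx
  simp only [Function.comp_apply, id, radialPotential]
  rw [integral_indicator measurableSet_Ioc, intervalIntegral.integral_of_le (norm_nonneg _)]
  exact setIntegral_congr_fun measurableSet_Ioc fun t ht => hx t ht.1.le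

/-- The density `½ W(x) |y|² - G(x, |y|)` of the functional. -/
def diracPotential (W : Space → ℝ) (g : Space → ℝ → ℝ) (x : Space) (y : Spinor) : ℝ :=
  1 / 2 * (W x * ‖y‖ ^ 2) - radialPotential (g x) y

/-- The gradient `W(x) y - g(x, |y|) y` of the density of the functional. -/
def diracField (W : Space → ℝ) (g : Space → ℝ → ℝ) (x : Space) (y : Spinor) : Spinor :=
  W x • y - radialField (g x) y

/-- The Hessian of the density of the functional. -/
def diracHessian (W : Space → ℝ) (g : Space → ℝ → ℝ) (x : Space) (y : Spinor) :
    Spinor →L[ℝ] Spinor :=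
  W x • ContinuousLinearMap.id ℝ Spinor - radialDeriv (g x) y

theorem isCubicPotential_dirac {W : Space → ℝ} (hWm : AEMeasurable W volume) {κ : ℝ} (hκ : 0 ≤ κ)
    (hW : ∀ᵐ x, |W x| ≤ κ) {g : Space → ℝ → ℝ} (hg : IsAdmissible g) :
    ∃ C, IsCubicPotential (volume : Measure Space) (diracPotential W g) (diracField W g)
      (diracHessian W g) C := by
  obtain ⟨C, hC⟩ := hg.exists_profile
  have hC0 : 0 ≤ C := (hC 0).const_nonneg
  refine ⟨κ + 3 * C, by positivity, fun u hu => ?_, fun u hu => ?_, ?_, ?_, ?_, ?_, ?_, ?_⟩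
  · exact ((hWm.aestronglyMeasurable.mul (by exact hu.norm.pow 2)).const_mul _).sub
      (hg.aesm_radialPotential hu)
  · exact (hWm.aestronglyMeasurable.smul hu).sub (hg.aesm_radialField hu)
  · exact Eventually.of_forall fun x => by simp [diracPotential, radialPotential]
  · exact Eventually.of_forall fun x => by simp [diracField, radialField]
  · refine Eventually.of_forall fun x y => ?_
    convert! ((((hasStrictFDerivAt_norm_sq y).hasFDerivAt).const_mul (W x)).const_mul
      (1 / 2)).sub ((hC x).hasFDerivAt_radialPotential y) using 1
    rw [diracField, map_sub]
    ext φ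
    simp only [sub_apply, smul_apply, innerSL_apply_apply, inner_smul_left, smul_eq_mul,
      RCLike.conj_to_real, nsmul_eq_mul]
    push_cast
    ring
  · exact Eventually.of_forall fun x y =>
      ((hasFDerivAt_id y).const_smul (W x)).sub ((hC x).hasFDerivAt_radialField y)
  · filter_upwards [hW] with x hx y
    refine (norm_sub_le _ _).trans ?_
    have h1 : ‖W x • ContinuousLinearMap.id ℝ Spinor‖ ≤ κ := by
      rw [norm_smul]
      have := ContinuousLinearMap.norm_id_le (𝕜 := ℝ) (E := Spinor)
      calc |W x| * ‖ContinuousLinearMap.id ℝ Spinor‖ ≤ κ * 1 := by gcongr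
        _ = κ := mul_one κ
    have h2 := (hC x).norm_radialDeriv_le_const y
    have h3 : 0 ≤ κ * ‖y‖ := by positivity
    linarith
  · exact Eventually.of_forall fun x => continuous_const.sub (hC x).continuous_radialDeriv

theorem exists_isCubicEmbedding_toL2 {a : ℝ} (ha : 0 < a) :
    ∃ K, IsCubicEmbedding (toL2 a) K := by
  have hc := lowFreqConst_pos
  refine ⟨max a⁻¹ (24 * lowFreqConst), by positivity, memLp_three_toL2, fun u => ?_, fun u => ?_⟩
  · rw [← norm_sq_eq_integral]
    have h1 : ‖toL2 a u‖ ^ 2 ≤ a⁻¹ * ‖u‖ ^ 2 := by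
      rw [le_inv_mul_iff₀ ha]; exact mul_norm_toL2_sq_le u
    exact h1.trans (by gcongr; exact le_max_left _ _)
  · exact (integral_norm_cube_toL2_le u).trans (by gcongr; exact le_max_right _ _)

end Potential

/-! ### Reduction along a subspace on which the functional is strongly concave -/

section Reduction

open Filter Topology

variable {H : Type*} [NormedAddCommGroup H] [InnerProductSpace ℝ H]

/-- A differentiable functional `J` on `H` whose derivative `J'` is strongly monotone (with the
sign reversed) along the subspace `M`, is Lipschitz on bounded sets, and has a Gateaux derivative
`q` that is continuous only in the strong sense: `u ↦ q u ξ` is continuous for every `ξ`. -/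
structure IsReducible (M : Submodule ℝ H) (J : H → ℝ) (J' : H → H →L[ℝ] ℝ)
    (q : H → H →L[ℝ] H →L[ℝ] ℝ) (κ L : ℝ) : Prop where
  pos : 0 < κ
  const_nonneg : 0 ≤ L
  hasFDerivAt : ∀ u, HasFDerivAt J (J' u) u
  strong_mono : ∀ u, ∀ χ ∈ M, (J' (u + χ) - J' u) χ ≤ -(κ * ‖χ‖ ^ 2)
  norm_sub_le : ∀ u v, ‖J' u - J' v‖ ≤ L * (1 + ‖u‖ + ‖v‖) * ‖u - v‖
  norm_le : ∀ u, ‖q u‖ ≤ L * (1 + ‖u‖)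
  tendsto_slope : ∀ u ξ, Tendsto (fun s : ℝ => s⁻¹ • (J' (u + s • ξ) - J' u)) (𝓝[≠] 0)
    (𝓝 (q u ξ))
  continuous : ∀ ξ, Continuous fun u => q u ξ

namespace IsReducible

variable {M : Submodule ℝ H} {J : H → ℝ} {J' : H → H →L[ℝ] ℝ} {q : H → H →L[ℝ] H →L[ℝ] ℝ}
  {κ L : ℝ} (hJ : IsReducible M J J' q κ L)
include hJ

theorem hasDerivAt_line (u ξ : H) : HasDerivAt (fun s : ℝ => J' (u + s • ξ)) (q u ξ) 0 := by
  rw [hasDerivAt_iff_tendsto_slope_zero]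
  simpa using hJ.tendsto_slope u ξ

theorem second_le (u : H) {χ : H} (hχ : χ ∈ M) : q u χ χ ≤ -(κ * ‖χ‖ ^ 2) := by
  have h1 := ((ContinuousLinearMap.apply ℝ ℝ χ).continuous.tendsto _).comp (hJ.tendsto_slope u χ)
  refine le_of_tendsto h1 ?_
  filter_upwards [self_mem_nhdsWithin] with s hs
  have hs : s ≠ 0 := hs
  have h2 := hJ.strong_mono u (s • χ) (M.smul_mem s hχ)
  rw [map_smul, smul_eq_mul, norm_smul, mul_pow, Real.norm_eq_abs, sq_abs] at h2
  have hs2 : 0 < s ^ 2 := by positivity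
  simp only [Function.comp_apply, ContinuousLinearMap.apply_apply, smul_apply, smul_eq_mul]
  have h3 : s⁻¹ * (J' (u + s • χ) - J' u) χ = (s * (J' (u + s • χ) - J' u) χ) / s ^ 2 := by
    field_simp
  rw [h3, div_le_iff₀ hs2]
  linarith

/-- `J` is strongly concave along `M`. -/
theorem apply_add_le (u : H) {χ : H} (hχ : χ ∈ M) :
    J (u + χ) ≤ J u + J' u χ - κ / 2 * ‖χ‖ ^ 2 := by
  set f : ℝ → ℝ := fun s => J (u + s • χ) - s * J' u χ + κ / 2 * ‖χ‖ ^ 2 * s ^ 2 with hf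
  have hd : ∀ s, HasDerivAt f (J' (u + s • χ) χ - J' u χ + κ * ‖χ‖ ^ 2 * s) s := fun s => by
    have hline : HasDerivAt (fun s : ℝ => u + s • χ) χ s := by
      simpa using ((hasDerivAt_id s).smul_const χ).const_add u
    have h1 := (hJ.hasFDerivAt (u + s • χ)).comp_hasDerivAt s hline
    convert! (h1.sub ((hasDerivAt_id s).mul_const (J' u χ))).add
      (((hasDerivAt_id s).pow 2).const_mul (κ / 2 * ‖χ‖ ^ 2)) using 1
    simp
    ring
  have hanti : AntitoneOn f (Icc 0 1) := by
    refine antitoneOn_of_deriv_nonpos (convex_Icc 0 1)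
      (fun s _ => (hd s).continuousAt.continuousWithinAt)
      (fun s _ => (hd s).differentiableAt.differentiableWithinAt) fun s hs => ?_
    rw [interior_Icc] at hs
    rw [(hd s).deriv]
    have h2 := hJ.strong_mono u (s • χ) (M.smul_mem s hχ)
    rw [map_smul, smul_eq_mul, norm_smul, mul_pow, Real.norm_eq_abs, sq_abs, sub_apply] at h2
    have h3 : s * (J' (u + s • χ) χ - J' u χ + κ * ‖χ‖ ^ 2 * s) ≤ s * 0 := by
      rw [mul_zero]; linarith
    exact le_of_mul_le_mul_left h3 hs.1
  have h := hanti (left_mem_Icc.mpr zero_le_one) (right_mem_Icc.mpr zero_le_one) zero_le_one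
  simp only [hf, one_smul, zero_smul, add_zero] at h
  linarith

/-- Maximizing sequences along `M` are Cauchy, so the maximum is attained. -/
theorem exists_critical [CompleteSpace M] (u : H) : ∃ w : M, ∀ φ ∈ M, J' (u + w) φ = 0 := by
  have hκ := hJ.pos
  set F : M → ℝ := fun w => J (u + w) with hF
  have hFc : Continuous F := by
    have : Continuous J := continuous_iff_continuousAt.mpr fun u => (hJ.hasFDerivAt u).continuousAt
    fun_prop
  have hbdd : BddAbove (range F) := by
    refine ⟨J u + ‖J' u‖ ^ 2 / (2 * κ), ?_⟩
    rintro _ ⟨w, rfl⟩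
    have h1 := hJ.apply_add_le u w.2
    have h2 := (le_abs_self _).trans ((J' u).le_opNorm (w : H))
    have h3 : ‖J' u‖ ^ 2 / (2 * κ) - (‖J' u‖ * ‖(w : H)‖ - κ / 2 * ‖(w : H)‖ ^ 2)
        = (‖J' u‖ - κ * ‖(w : H)‖) ^ 2 / (2 * κ) := by field_simp; ring
    have h4 : 0 ≤ (‖J' u‖ - κ * ‖(w : H)‖) ^ 2 / (2 * κ) := by positivity
    simp only [hF]
    linarith
  set S := sSup (range F) with hS
  have hFS : ∀ w, F w ≤ S := fun w => le_csSup hbdd (mem_range_self w)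
  have hmid : ∀ w w' : M, F w + F w' ≤ 2 * S - κ / 4 * ‖w - w'‖ ^ 2 := fun w w' => by
    set m : M := (1 / 2 : ℝ) • (w + w') with hm
    set d : M := (1 / 2 : ℝ) • (w - w') with hd
    have h1 : u + (w : H) = (u + (m : H)) + (d : H) := by
      rw [add_assoc, ← Submodule.coe_add, hm, hd]; congr 2; module
    have h2 : u + (w' : H) = (u + (m : H)) + ((-d : M) : H) := by
      rw [add_assoc, ← Submodule.coe_add, hm, hd]; congr 2; module
    have h3 := hJ.apply_add_le (u + m) d.2
    have h4 := hJ.apply_add_le (u + m) (-d).2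
    rw [← h1] at h3
    rw [← h2, Submodule.coe_neg, map_neg, norm_neg] at h4
    have h5 : ‖(d : H)‖ = 1 / 2 * ‖w - w'‖ := by
      change ‖d‖ = _
      rw [hd, norm_smul]; norm_num
    rw [h5] at h3 h4
    have h6 := hFS m
    simp only [hF] at h6 ⊢
    linarith
  have hex : ∀ n : ℕ, ∃ w, S - 1 / ((n : ℝ) + 1) < F w := fun n => by
    obtain ⟨_, ⟨w, rfl⟩, hw⟩ := exists_lt_of_lt_csSup (range_nonempty F)
      (sub_lt_self S (Nat.one_div_pos_of_nat (α := ℝ) (n := n)))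
    exact ⟨w, hw⟩
  choose w hw using hex
  have hcauchy : CauchySeq w := by
    refine cauchySeq_of_le_tendsto_0 (fun N : ℕ => Real.sqrt (8 / κ * (1 / ((N : ℝ) + 1))))
      (fun n m N hn hm => ?_) ?_
    · rw [dist_eq_norm]
      refine Real.le_sqrt_of_sq_le ?_
      have h1 := hmid (w n) (w m)
      have h2 := hw n
      have h3 := hw m
      have h4 : 1 / ((n : ℝ) + 1) ≤ 1 / ((N : ℝ) + 1) := Nat.one_div_le_one_div hn
      have h5 : 1 / ((m : ℝ) + 1) ≤ 1 / ((N : ℝ) + 1) := Nat.one_div_le_one_div hm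
      have h6 : κ / 4 * ‖w n - w m‖ ^ 2 ≤ 2 * (1 / ((N : ℝ) + 1)) := by linarith
      calc ‖w n - w m‖ ^ 2 = 4 / κ * (κ / 4 * ‖w n - w m‖ ^ 2) := by field_simp
        _ ≤ 4 / κ * (2 * (1 / ((N : ℝ) + 1))) := by gcongr
        _ = _ := by ring
    · have := (tendsto_one_div_add_atTop_nhds_zero_nat (𝕜 := ℝ)).const_mul (8 / κ)
      rw [mul_zero] at this
      simpa [Function.comp_def] using (Real.continuous_sqrt.tendsto 0).comp this
  obtain ⟨w₀, hw₀⟩ := cauchySeq_tendsto_of_complete hcauchy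
  have hmax : S ≤ F w₀ := by
    refine le_of_tendsto_of_tendsto (f := fun n : ℕ => S - 1 / ((n : ℝ) + 1)) ?_
      ((hFc.tendsto w₀).comp hw₀) (Eventually.of_forall fun n => (hw n).le)
    simpa using (tendsto_one_div_add_atTop_nhds_zero_nat (𝕜 := ℝ)).const_sub S
  refine ⟨w₀, fun φ hφ => ?_⟩
  have hline : HasDerivAt (fun s : ℝ => u + (w₀ : H) + s • φ) φ 0 := by
    simpa using ((hasDerivAt_id (0 : ℝ)).smul_const φ).const_add (u + (w₀ : H))
  have hd : HasDerivAt (fun s : ℝ => J (u + (w₀ : H) + s • φ)) (J' (u + w₀) φ) 0 :=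
    HasFDerivAt.comp_hasDerivAt_of_eq 0 (hJ.hasFDerivAt (u + w₀)) hline (by simp)
  refine IsLocalMax.hasDerivAt_eq_zero (Eventually.of_forall fun s => ?_) hd
  have := (hFS (w₀ + s • ⟨φ, hφ⟩)).trans hmax
  simpa [hF, add_assoc] using this

theorem critical_unique {u : H} {w w' : M} (hw : ∀ φ ∈ M, J' (u + w) φ = 0)
    (hw' : ∀ φ ∈ M, J' (u + w') φ = 0) : w = w' := by
  have h1 := hJ.strong_mono (u + w) ((w' : H) - w) (M.sub_mem w'.2 w.2)
  have h2 : u + (w : H) + ((w' : H) - w) = u + w' := by abel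
  rw [h2, sub_apply, hw _ (M.sub_mem w'.2 w.2), hw' _ (M.sub_mem w'.2 w.2), sub_zero] at h1
  have h3 : ‖(w' : H) - w‖ ^ 2 ≤ 0 := by nlinarith [hJ.pos]
  have h4 : (w' : H) - w = 0 := by
    rw [← norm_eq_zero]; exact pow_eq_zero_iff (two_ne_zero) |>.mp (le_antisymm h3 (by positivity))
  exact (Subtype.ext (sub_eq_zero.mp h4)).symm

/-- The linearized equation `q(u)[v + p, φ] = 0`, `φ ∈ M`, is solvable, by Lax–Milgram. -/
theorem exists_linearized [CompleteSpace M] (u v : H) : ∃ p : M, ∀ φ ∈ M, q u (v + p) φ = 0 := by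
  set B : M →L[ℝ] M →L[ℝ] ℝ :=
    -(((q u).comp M.subtypeL).flip.comp M.subtypeL).flip with hB
  have hBapp : ∀ x y : M, B x y = -(q u x y) := fun x y => rfl
  have hco : IsCoercive B := ⟨κ, hJ.pos, fun x => by
    have := hJ.second_le u x.2
    rw [hBapp, Submodule.coe_norm]
    linarith [sq ‖(x : H)‖]⟩
  set ℓ : M →L[ℝ] ℝ := (q u v).comp M.subtypeL with hℓ
  obtain ⟨p, hp⟩ := hco.continuousLinearEquivOfBilin.surjective
    ((InnerProductSpace.toDual ℝ M).symm ℓ)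
  refine ⟨p, fun φ hφ => ?_⟩
  have h1 := hco.continuousLinearEquivOfBilin_apply p ⟨φ, hφ⟩
  rw [hp, InnerProductSpace.toDual_symm_apply, hBapp] at h1
  have h2 : q u v φ = -(q u p φ) := h1
  rw [map_add, add_apply, h2]
  ring

/-! #### The reduced functional -/

variable {P : Submodule ℝ H} {h : P → M} (hh : ∀ v : P, ∀ φ ∈ M, J' ((v : H) + h v) φ = 0)
include hh

/-- Strong monotonicity at `v + h(v₀)` in the direction `h(v) - h(v₀)`. -/
theorem norm_reduction_sub_le (v₀ v : P) : κ * ‖h v - h v₀‖ ≤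
    L * (1 + ‖(v : H) + h v₀‖ + ‖(v₀ : H) + h v₀‖) * ‖v - v₀‖ := by
  set d : M := h v - h v₀ with hd
  rcases eq_or_ne d 0 with h0 | h0
  · rw [h0, norm_zero, mul_zero]
    have := hJ.const_nonneg
    positivity
  have hd0 : 0 < ‖d‖ := norm_pos_iff.mpr h0
  have h1 := hJ.strong_mono ((v : H) + h v₀) d d.2
  have h2 : (v : H) + h v₀ + (d : H) = v + h v := by
    rw [hd, Submodule.coe_sub]; abel
  rw [h2, sub_apply, hh v d d.2] at h1
  have h3 : J' ((v : H) + h v₀) d = (J' ((v : H) + h v₀) - J' ((v₀ : H) + h v₀)) d := by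
    rw [sub_apply, hh v₀ d d.2, sub_zero]
  have h4 := (le_abs_self _).trans ((J' ((v : H) + h v₀) - J' ((v₀ : H) + h v₀)).le_opNorm (d : H))
  have h5 := hJ.norm_sub_le ((v : H) + h v₀) ((v₀ : H) + h v₀)
  have h6 : (v : H) + h v₀ - ((v₀ : H) + h v₀) = ((v - v₀ : P) : H) := by
    rw [Submodule.coe_sub]; abel
  rw [h6] at h5
  have h7 : κ * ‖(d : H)‖ * ‖(d : H)‖ ≤
      L * (1 + ‖(v : H) + h v₀‖ + ‖(v₀ : H) + h v₀‖) * ‖((v - v₀ : P) : H)‖ * ‖(d : H)‖ := by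
    have := mul_le_mul_of_nonneg_right h5 (norm_nonneg (d : H))
    linarith [sq ‖(d : H)‖]
  exact le_of_mul_le_mul_right h7 hd0

/-- The reduction map is Lipschitz at every point. -/
theorem isBigO_reduction_sub (v₀ : P) :
    (fun v : P => ((v : H) + h v) - ((v₀ : H) + h v₀)) =O[𝓝 v₀] fun v => v - v₀ := by
  have hκ := hJ.pos
  have hL := hJ.const_nonneg
  refine Asymptotics.IsBigO.of_bound (1 + L * (2 + 2 * ‖(v₀ : H) + h v₀‖) / κ) ?_
  filter_upwards [Metric.ball_mem_nhds v₀ one_pos] with v hv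
  have hv : ‖v - v₀‖ < 1 := by simpa [dist_eq_norm] using hv
  have h1 := hJ.norm_reduction_sub_le hh v₀ v
  have h2 : ((v : H) + h v) - ((v₀ : H) + h v₀) = ((v - v₀ : P) : H) + ((h v - h v₀ : M) : H) := by
    rw [Submodule.coe_sub, Submodule.coe_sub]; abel
  have h3 : ‖(v : H) + h v₀‖ ≤ 1 + ‖(v₀ : H) + h v₀‖ := by
    have : (v : H) + h v₀ = ((v - v₀ : P) : H) + ((v₀ : H) + h v₀) := by
      rw [Submodule.coe_sub]; abel
    rw [this]
    refine (norm_add_le _ _).trans ?_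
    gcongr
    exact hv.le
  have h4 : ‖h v - h v₀‖ ≤ L * (2 + 2 * ‖(v₀ : H) + h v₀‖) / κ * ‖v - v₀‖ := by
    rw [div_mul_eq_mul_div, le_div_iff₀ hκ, mul_comm]
    have h5 : 1 + ‖(v : H) + h v₀‖ + ‖(v₀ : H) + h v₀‖ ≤ 2 + 2 * ‖(v₀ : H) + h v₀‖ := by linarith
    refine h1.trans ?_
    gcongr
  rw [h2]
  refine (norm_add_le _ _).trans ?_
  rw [add_mul, one_mul]
  exact add_le_add le_rfl h4

theorem continuous_reduction : Continuous fun v : P => (v : H) + h v := by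
  rw [continuous_iff_continuousAt]
  intro v₀
  rw [ContinuousAt, tendsto_iff_norm_sub_tendsto_zero]
  have h1 : Tendsto (fun v : P => v - v₀) (𝓝 v₀) (𝓝 0) :=
    tendsto_sub_nhds_zero_iff.mpr tendsto_id
  simpa using ((hJ.isBigO_reduction_sub hh v₀).trans_tendsto h1).norm

/-- The derivative of the reduced functional: the contribution of `h` vanishes by the critical
point equation, and `h` need not be differentiable for this. -/
theorem hasFDerivAt_reduced (v₀ : P) : HasFDerivAt (fun v : P => J ((v : H) + h v))
    ((J' ((v₀ : H) + h v₀)).comp P.subtypeL) v₀ := by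
  rw [hasFDerivAt_iff_isLittleO]
  have h1 := (hasFDerivAt_iff_isLittleO.mp (hJ.hasFDerivAt ((v₀ : H) + h v₀))).comp_tendsto
    ((hJ.continuous_reduction hh).tendsto v₀)
  refine (h1.trans_isBigO (hJ.isBigO_reduction_sub hh v₀)).congr_left fun v => ?_
  have h2 : ((v : H) + h v) - ((v₀ : H) + h v₀) = ((v - v₀ : P) : H) + ((h v - h v₀ : M) : H) := by
    rw [Submodule.coe_sub, Submodule.coe_sub]; abel
  simp only [Function.comp_apply]
  rw [h2, map_add, hh v₀ _ (h v - h v₀).2, add_zero]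
  rfl

/-- The curve `t ↦ t v + h(t v)` has the velocity `v + p` given by the linearized equation. -/
theorem hasDerivAt_curve (v : P) (t : ℝ) {p : M}
    (hp : ∀ φ ∈ M, q (((t • v : P) : H) + h (t • v)) ((v : H) + p) φ = 0) :
    HasDerivAt (fun s : ℝ => ((s • v : P) : H) + h (s • v)) ((v : H) + p) t := by
  have hκ := hJ.pos
  set u : H := ((t • v : P) : H) + h (t • v) with hu
  set ξ : H := (v : H) + p with hξ
  have hline := hJ.hasDerivAt_line u ξ
  rw [hasDerivAt_iff_isLittleO_nhds_zero] at hline ⊢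
  refine Asymptotics.IsBigO.trans_isLittleO (Asymptotics.IsBigO.of_bound κ⁻¹ ?_) hline
  refine Eventually.of_forall fun r => ?_
  set d : M := h ((t + r) • v) - h (t • v) - r • p with hd
  have hdeq : ((((t + r) • v : P) : H) + h ((t + r) • v)) - u - r • ξ = (d : H) := by
    rw [hu, hξ, hd]
    simp only [Submodule.coe_sub, Submodule.coe_smul]
    module
  have hsum : u + r • ξ + (d : H) = (((t + r) • v : P) : H) + h ((t + r) • v) := by
    rw [← hdeq]; abel
  have h1 := hJ.strong_mono (u + r • ξ) d d.2
  rw [hsum, sub_apply, hh _ d d.2, zero_sub] at h1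
  rw [hdeq, le_inv_mul_iff₀ hκ]
  simp only [zero_add, zero_smul, add_zero]
  -- on `M`, `J' (u + r • ξ)` is the remainder `T` of the expansion of `J'` along the line
  set T : H →L[ℝ] ℝ := J' (u + r • ξ) - J' u - r • q u ξ with hT
  have h2 : J' (u + r • ξ) d = T d := by
    rw [hT, sub_apply, sub_apply, smul_apply, hp d d.2, hu, hh _ d d.2]; simp
  have h3 := (le_abs_self _).trans (T.le_opNorm (d : H))
  rcases eq_or_ne (d : H) 0 with h0 | h0
  · rw [h0, norm_zero, mul_zero]; positivity
  · have h4 : κ * ‖(d : H)‖ * ‖(d : H)‖ ≤ ‖T‖ * ‖(d : H)‖ := by linarith [sq ‖(d : H)‖]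
    exact le_of_mul_le_mul_right h4 (norm_pos_iff.mpr h0)

/-- The derivative of `J'` along the curve `t ↦ t v + h(t v)`. -/
theorem hasDerivAt_derivative_curve (v : P) (t : ℝ) {p : M}
    (hp : ∀ φ ∈ M, q (((t • v : P) : H) + h (t • v)) ((v : H) + p) φ = 0) :
    HasDerivAt (fun s : ℝ => J' (((s • v : P) : H) + h (s • v)))
      (q (((t • v : P) : H) + h (t • v)) ((v : H) + p)) t := by
  have hL := hJ.const_nonneg
  have hcurve := hJ.hasDerivAt_curve hh v t hp
  set u : H := ((t • v : P) : H) + h (t • v) with hu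
  set ξ : H := (v : H) + p with hξ
  have hcont : Tendsto (fun r : ℝ => (((t + r) • v : P) : H) + h ((t + r) • v)) (𝓝 0) (𝓝 u) := by
    have h1 : Continuous fun r : ℝ => (((t + r) • v : P) : H) + h ((t + r) • v) :=
      (hJ.continuous_reduction hh).comp (by fun_prop : Continuous fun r : ℝ => (t + r) • v)
    simpa [hu] using h1.tendsto 0
  have hline := hJ.hasDerivAt_line u ξ
  rw [hasDerivAt_iff_isLittleO_nhds_zero] at hcurve hline ⊢
  have hdiff : (fun r : ℝ => J' ((((t + r) • v : P) : H) + h ((t + r) • v)) - J' (u + r • ξ))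
      =o[𝓝 0] fun r : ℝ => r := by
    refine Asymptotics.IsBigO.trans_isLittleO
      (Asymptotics.IsBigO.of_bound (L * (1 + (‖u‖ + 1) + (‖u‖ + 1))) ?_) hcurve
    have hline' : Tendsto (fun r : ℝ => u + r • ξ) (𝓝 0) (𝓝 u) := by
      have : Continuous fun r : ℝ => u + r • ξ := by fun_prop
      simpa using this.tendsto 0
    filter_upwards [hcont.norm.eventually (ge_mem_nhds (lt_add_one ‖u‖)),
      hline'.norm.eventually (ge_mem_nhds (lt_add_one ‖u‖))] with r h1 h2
    refine (hJ.norm_sub_le _ _).trans ?_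
    rw [sub_sub _ u]
    gcongr
  refine (hdiff.add hline).congr_left fun r => ?_
  simp only [zero_add, zero_smul, add_zero]
  abel

/-- The velocities of the curve depend continuously on time. -/
theorem continuous_velocity (v : P) {p : ℝ → M}
    (hp : ∀ t, ∀ φ ∈ M, q (((t • v : P) : H) + h (t • v)) ((v : H) + p t) φ = 0) :
    Continuous fun t => (v : H) + p t := by
  have hκ := hJ.pos
  set u : ℝ → H := fun t => ((t • v : P) : H) + h (t • v) with hu
  have huc : Continuous u :=
    (hJ.continuous_reduction hh).comp (by fun_prop : Continuous fun r : ℝ => r • v)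
  rw [continuous_iff_continuousAt]
  intro t
  rw [ContinuousAt, tendsto_iff_norm_sub_tendsto_zero]
  have hlim : Tendsto (fun s => κ⁻¹ * ‖q (u t) ((v : H) + p t) - q (u s) ((v : H) + p t)‖)
      (𝓝 t) (𝓝 0) := by
    have h1 := (((hJ.continuous ((v : H) + p t)).comp huc).tendsto t).const_sub
      (q (u t) ((v : H) + p t))
    simpa using h1.norm.const_mul κ⁻¹
  refine squeeze_zero (fun s => norm_nonneg _) (fun s => ?_) hlim
  set d : M := p s - p t with hd
  have hdeq : (v : H) + p s - ((v : H) + p t) = (d : H) := by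
    rw [hd, Submodule.coe_sub]; abel
  rw [hdeq, le_inv_mul_iff₀ hκ]
  have h1 := hJ.second_le (u s) d.2
  have h2 : q (u s) d d = (q (u t) ((v : H) + p t) - q (u s) ((v : H) + p t)) d := by
    have h3 : q (u s) d = q (u s) ((v : H) + p s) - q (u s) ((v : H) + p t) := by
      rw [← hdeq, map_sub]
    rw [h3, sub_apply, sub_apply, hp t d d.2, hp s d d.2]
  have h3 := (neg_abs_le _).trans' (neg_le_neg
    ((q (u t) ((v : H) + p t) - q (u s) ((v : H) + p t)).le_opNorm (d : H)))
  rcases eq_or_ne (d : H) 0 with h0 | h0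
  · rw [h0, norm_zero, mul_zero]; positivity
  · have h4 : κ * ‖(d : H)‖ * ‖(d : H)‖ ≤
        ‖q (u t) ((v : H) + p t) - q (u s) ((v : H) + p t)‖ * ‖(d : H)‖ := by
      linarith [sq ‖(d : H)‖]
    exact le_of_mul_le_mul_right h4 (norm_pos_iff.mpr h0)

/-- The derivative of `H(t) = I(t v) - (t / 2) I'(t v)[v]`. -/
theorem hasDerivAt_reduced_sub (v : P) (t : ℝ) {p : M}
    (hp : ∀ φ ∈ M, q (((t • v : P) : H) + h (t • v)) ((v : H) + p) φ = 0) :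
    HasDerivAt (fun t : ℝ => J (((t • v : P) : H) + h (t • v))
        - t / 2 * J' (((t • v : P) : H) + h (t • v)) v)
      (1 / 2 * J' (((t • v : P) : H) + h (t • v)) v
        - t / 2 * q (((t • v : P) : H) + h (t • v)) ((v : H) + p) v) t := by
  have hsv : HasDerivAt (fun t : ℝ => t • v) v t := by
    simpa using (hasDerivAt_id t).smul_const v
  have h1 := (hJ.hasFDerivAt_reduced hh (t • v)).comp_hasDerivAt t hsv
  have h2 := (ContinuousLinearMap.apply ℝ ℝ (v : H)).hasFDerivAt.comp_hasDerivAt t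
    (hJ.hasDerivAt_derivative_curve hh v t hp)
  convert! h1.sub (((hasDerivAt_id t).div_const 2).mul h2) using 1
  simp
  ring

theorem contDiff_reduced_sub [CompleteSpace M] (v : P) :
    ContDiff ℝ 1 (fun t : ℝ => J (((t • v : P) : H) + h (t • v))
        - t / 2 * J' (((t • v : P) : H) + h (t • v)) v) := by
  choose p hp using fun t : ℝ => hJ.exists_linearized (((t • v : P) : H) + h (t • v)) (v : H)
  have hd := fun t => hJ.hasDerivAt_reduced_sub hh v t (hp t)
  rw [contDiff_one_iff_deriv]
  refine ⟨fun t => (hd t).differentiableAt, ?_⟩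
  rw [funext fun t => (hd t).deriv]
  set u : ℝ → H := fun t => ((t • v : P) : H) + h (t • v) with hu
  have huc : Continuous u :=
    (hJ.continuous_reduction hh).comp (by fun_prop : Continuous fun r : ℝ => r • v)
  have hJ'c : Continuous fun t => J' (u t) := continuous_iff_continuousAt.mpr fun t =>
    (hJ.hasDerivAt_derivative_curve hh v t (hp t)).continuousAt
  have hξc := hJ.continuous_velocity hh v hp
  have hqc : Continuous fun t => q (u t) ((v : H) + p t) := by
    rw [continuous_iff_continuousAt]
    intro t
    -- `q` is continuous only at fixed vectors, so the velocity is frozen at time `t`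
    have h1 : Tendsto (fun s => q (u s) ((v : H) + p t)) (𝓝 t) (𝓝 (q (u t) ((v : H) + p t))) :=
      ((hJ.continuous ((v : H) + p t)).comp huc).tendsto t
    have h2 : Tendsto (fun s => q (u s) (((v : H) + p s) - ((v : H) + p t))) (𝓝 t) (𝓝 0) := by
      have hb : Tendsto (fun s => L * (1 + ‖u s‖) * ‖((v : H) + p s) - ((v : H) + p t)‖) (𝓝 t)
          (𝓝 0) := by
        have : Continuous fun s => L * (1 + ‖u s‖) * ‖((v : H) + p s) - ((v : H) + p t)‖ := by
          fun_prop
        simpa using this.tendsto t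
      refine squeeze_zero_norm (fun s => ?_) hb
      exact ((q (u s)).le_opNorm _).trans (mul_le_mul_of_nonneg_right (hJ.norm_le _)
        (norm_nonneg _))
    have h3 := h1.add h2
    rw [add_zero] at h3
    refine h3.congr fun s => ?_
    rw [← map_add, add_sub_cancel]
  have h1 : Continuous fun t => J' (u t) (v : H) := hJ'c.clm_apply continuous_const
  have h2 : Continuous fun t => q (u t) ((v : H) + p t) (v : H) := hqc.clm_apply continuous_const
  exact (continuous_const.mul h1).sub ((continuous_id.div_const 2).mul h2)

/-- The sign of the derivative. Testing the critical point equation and the linearized equation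
with elements of `M`, `t H'(t)` is half of `J'(u)[u + 2χ] - q(u)[u + χ, u + χ]`, with
`u = t v + h(t v)` and `u + χ` the multiple `t u'(t)` of the velocity. -/
theorem deriv_reduced_sub_pos [CompleteSpace M] (hPM : Disjoint P M)
    (hpos : ∀ u, u ≠ 0 → ∀ χ ∈ M, q u (u + χ) (u + χ) < J' u (u + (2 : ℝ) • χ))
    {v : P} (hv : v ≠ 0) {t : ℝ} (ht : 0 < t) :
    0 < deriv (fun t : ℝ => J (((t • v : P) : H) + h (t • v))
        - t / 2 * J' (((t • v : P) : H) + h (t • v)) v) t := by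
  obtain ⟨p, hp⟩ := hJ.exists_linearized (((t • v : P) : H) + h (t • v)) (v : H)
  rw [(hJ.hasDerivAt_reduced_sub hh v t hp).deriv]
  have hcrit := hh (t • v)
  set w : M := h (t • v) with hw
  set u : H := ((t • v : P) : H) + w with hu
  have hu0 : u ≠ 0 := fun h0 => by
    have h1 : ((t • v : P) : H) = -w := eq_neg_of_add_eq_zero_left h0
    have h2 : ((t • v : P) : H) ∈ M := h1 ▸ M.neg_mem w.2
    have h3 := Submodule.disjoint_def.mp hPM _ (t • v).2 h2
    have h4 : t • v = 0 := Subtype.ext h3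
    exact hv ((smul_eq_zero.mp h4).resolve_left ht.ne')
  set χ : M := t • p - w with hχ
  have huχ : u + (χ : H) = t • ((v : H) + p) := by
    rw [hu, hχ]; simp only [Submodule.coe_sub, Submodule.coe_smul]; module
  have h1 := hpos u hu0 χ χ.2
  have h2 : q u (u + χ) (u + χ) = t ^ 2 * q u ((v : H) + p) v := by
    rw [huχ, map_smul (q u), smul_apply, map_smul, map_add (q u ((v : H) + p)), hp p p.2]
    simp only [smul_eq_mul]; ring
  have h3 : J' u (u + (2 : ℝ) • (χ : H)) = t * J' u v := by
    have : u + (2 : ℝ) • (χ : H) = t • (v : H) + ((w + (2 : ℝ) • χ : M) : H) := by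
      rw [hu]; simp only [Submodule.coe_add, Submodule.coe_smul]; abel
    rw [this, map_add, hcrit _ (w + (2 : ℝ) • χ).2, map_smul, smul_eq_mul, add_zero]
  rw [h2, h3] at h1
  have h4 : 0 < t * (1 / 2 * J' u v - t / 2 * q u ((v : H) + p) v) := by linarith
  exact (mul_pos_iff_of_pos_left ht).mp h4

end IsReducible

end Reduction

/-! ### The functional of the nonlinear Dirac equation -/

section IsometryForm

variable {F : Type*} [NormedAddCommGroup F] [InnerProductSpace ℝ F]

/-- The bounded bilinear form `(ξ, φ) ↦ ⟨S ξ, φ⟩` of a linear isometry `S`. -/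
def isometryForm (S : F →ₗᵢ[ℝ] F) : F →L[ℝ] F →L[ℝ] ℝ where
  toFun ξ := innerSL ℝ (S ξ)
  map_add' ξ η := by rw [map_add, map_add]
  map_smul' c ξ := by ext φ; simp
  cont := (innerSL ℝ).continuous.comp S.continuous

theorem isometryForm_apply (S : F →ₗᵢ[ℝ] F) (ξ : F) : isometryForm S ξ = innerSL ℝ (S ξ) := rfl

theorem norm_isometryForm_le (S : F →ₗᵢ[ℝ] F) : ‖isometryForm S‖ ≤ 1 := by
  refine ContinuousLinearMap.opNorm_le_bound _ zero_le_one fun ξ => ?_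
  rw [isometryForm_apply, innerSL_apply_norm, one_mul]
  exact (S.norm_map ξ).le

end IsometryForm

section Functional

open Filter Topology

variable {a : ℝ} {W : Space → ℝ} {g : Space → ℝ → ℝ} {C K κ : ℝ}

/-- `J(u) = ½ ⟨S u, u⟩ + ∫ ψ(x, u) dx`, where `S` is the sign of `D_a`. -/
theorem functional_eq (ha : 0 < a) (hWm : AEMeasurable W volume)
    (hW : ∀ᵐ x, |W x| ≤ κ) (hι : IsCubicEmbedding (toL2 a) K)
    (hψ : IsCubicPotential (volume : Measure Space) (diracPotential W g) (diracField W g)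
      (diracHessian W g) C) (u : E a) :
    functional a W g u = 1 / 2 * inner ℝ (signIsometry ha u) u
      + ∫ x, diracPotential W g x (toL2 a u x) := by
  have hi1 : Integrable (fun x => W x * ‖toL2 a u x‖ ^ 2) := by
    refine ((Lp.memLp (toL2 a u)).norm.integrable_sq.const_mul κ).mono'
      (hWm.aestronglyMeasurable.mul (by exact (Lp.aestronglyMeasurable (toL2 a u)).norm.pow 2)) ?_
    filter_upwards [hW] with x hx
    rw [norm_mul, norm_pow, norm_norm]
    exact mul_le_mul_of_nonneg_right hx (by positivity)
  have hi2 : Integrable (fun x => radialPotential (g x) (toL2 a u x)) := by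
    refine ((hi1.const_mul (1 / 2)).sub (hψ.integrable_potential hι u)).congr
      (Eventually.of_forall fun x => ?_)
    simp [diracPotential]
  rw [functional, norm_projPlus_sq_sub_norm_projMinus_sq ha]
  simp only [diracPotential]
  rw [integral_sub (hi1.const_mul _) hi2, integral_const_mul]
  simp only [radialPotential]
  ring

/-- The derivative of the functional. -/
def functionalDeriv (ha : 0 < a) (hι : IsCubicEmbedding (toL2 a) K)
    (hψ : IsCubicPotential (volume : Measure Space) (diracPotential W g) (diracField W g)
      (diracHessian W g) C) (u : E a) : E a →L[ℝ] ℝ :=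
  innerSL ℝ (signIsometry ha u) + hψ.gradient hι u

/-- The second derivative of the functional, in the sense of Gateaux. -/
def functionalHessian (ha : 0 < a) (hι : IsCubicEmbedding (toL2 a) K)
    (hψ : IsCubicPotential (volume : Measure Space) (diracPotential W g) (diracField W g)
      (diracHessian W g) C) (u : E a) : E a →L[ℝ] E a →L[ℝ] ℝ :=
  isometryForm (signIsometry ha) + hψ.hessian hι u

theorem hasFDerivAt_functional (ha : 0 < a) (hWm : AEMeasurable W volume)
    (hW : ∀ᵐ x, |W x| ≤ κ) (hι : IsCubicEmbedding (toL2 a) K)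
    (hψ : IsCubicPotential (volume : Measure Space) (diracPotential W g) (diracField W g)
      (diracHessian W g) C) (u : E a) :
    HasFDerivAt (functional a W g) (functionalDeriv ha hι hψ u) u := by
  rw [funext (functional_eq ha hWm hW hι hψ)]
  refine HasFDerivAt.add ?_ (hψ.hasFDerivAt_integral hι u)
  convert! (((signIsometry ha).toContinuousLinearMap.hasFDerivAt (x := u)).inner ℝ
    (hasFDerivAt_id u)).const_mul (1 / 2) using 1
  ext φ
  have h : inner ℝ (signIsometry ha φ) u = inner ℝ (signIsometry ha u) φ := by
    rw [real_inner_comm, ← inner_signIsometry_left]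
  simp [h]
  ring

theorem integral_sq_toL2_le (ha : 0 < a) (χ : E a) :
    ∫ x, ‖toL2 a χ x‖ ^ 2 ≤ ‖χ‖ ^ 2 / a := by
  rw [← norm_sq_eq_integral, le_div_iff₀ ha, mul_comm]
  exact mul_norm_toL2_sq_le χ

/-- `J` is strongly concave along `E⁻`: there `S = -1`, the nonlinearity is monotone, and the
quadratic term is at most `κ |χ|₂² ≤ (κ / a) ‖χ‖²`. -/
theorem isReducible_functional (ha : 0 < a) (hWm : AEMeasurable W volume) (hκ : 0 ≤ κ)
    (hκa : κ < a) (hW : ∀ᵐ x, |W x| ≤ κ) (hg : IsAdmissible g)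
    (hι : IsCubicEmbedding (toL2 a) K)
    (hψ : IsCubicPotential (volume : Measure Space) (diracPotential W g) (diracField W g)
      (diracHessian W g) C) :
    IsReducible (EMinus a) (functional a W g) (functionalDeriv ha hι hψ)
      (functionalHessian ha hι hψ) (1 - κ / a) (1 + C * K) where
  pos := by rw [sub_pos, div_lt_one ha]; exact hκa
  const_nonneg := by
    have := hψ.const_nonneg
    have := hι.const_nonneg
    positivity
  hasFDerivAt := hasFDerivAt_functional ha hWm hW hι hψ
  strong_mono := fun u χ hχ => by
    obtain ⟨Cg, hCg⟩ := hg.exists_profile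
    have hS : signIsometry ha χ = -χ := (mem_EMinus_iff ha).mp hχ
    have h1 : (functionalDeriv ha hι hψ (u + χ) - functionalDeriv ha hι hψ u) χ
        = -‖χ‖ ^ 2 + (hψ.gradient hι (u + χ) χ - hψ.gradient hι u χ) := by
      simp only [functionalDeriv, sub_apply, add_apply, innerSL_apply_apply, map_add,
        hS, inner_neg_left, real_inner_self_eq_norm_sq]
      ring
    have hi1 := (hψ.isControlled_field (ι := toL2 a) (u + χ)).integrable hι χ
    have hi2 := (hψ.isControlled_field (ι := toL2 a) u).integrable hι χ
    have h2 : hψ.gradient hι (u + χ) χ - hψ.gradient hι u χ ≤ ∫ x, κ * ‖toL2 a χ x‖ ^ 2 := by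
      rw [hψ.gradient_apply, hψ.gradient_apply, ← integral_sub hi1 hi2]
      refine integral_mono_ae (hi1.sub hi2)
        ((Lp.memLp (toL2 a χ)).norm.integrable_sq.const_mul κ) ?_
      rw [map_add]
      filter_upwards [hW, Lp.coeFn_add (toL2 a u) (toL2 a χ)] with x hx hadd
      have h3 := (hCg x).inner_radialField_sub_nonneg (toL2 a u x + toL2 a χ x) (toL2 a u x)
      have h4 : W x * ‖toL2 a χ x‖ ^ 2 ≤ κ * ‖toL2 a χ x‖ ^ 2 :=
        mul_le_mul_of_nonneg_right ((le_abs_self _).trans hx) (by positivity)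
      rw [add_sub_cancel_left, inner_sub_left] at h3
      rw [hadd, Pi.add_apply]
      simp only [diracField, inner_sub_left, smul_add, inner_add_left, real_inner_smul_left,
        real_inner_self_eq_norm_sq]
      linarith
    rw [integral_const_mul] at h2
    have h5 := mul_le_mul_of_nonneg_left (integral_sq_toL2_le ha χ) hκ
    have h6 : κ * (‖χ‖ ^ 2 / a) = κ / a * ‖χ‖ ^ 2 := by ring
    rw [h1]
    linarith
  norm_sub_le := fun u v => by
    have h1 := hψ.norm_gradient_sub_le hι u v
    have h2 : functionalDeriv ha hι hψ u - functionalDeriv ha hι hψ v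
        = innerSL ℝ (signIsometry ha (u - v)) + (hψ.gradient hι u - hψ.gradient hι v) := by
      simp only [functionalDeriv, map_sub]; abel
    have h3 : 0 ≤ (‖u‖ + ‖v‖) * ‖u - v‖ := by positivity
    rw [h2]
    refine (norm_add_le _ _).trans ?_
    rw [innerSL_apply_norm, (signIsometry ha).norm_map]
    linarith
  norm_le := fun u => by
    have h1 := hψ.norm_hessian_le hι u
    have h2 := norm_isometryForm_le (signIsometry ha)
    refine (norm_add_le (isometryForm (signIsometry ha)) (hψ.hessian hι u)).trans ?_
    linarith [norm_nonneg u]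
  tendsto_slope := fun u ξ => by
    have h1 := (hψ.tendsto_slope_gradient hι u ξ).const_add (innerSL ℝ (signIsometry ha ξ))
    refine h1.congr' ?_
    filter_upwards [self_mem_nhdsWithin] with s hs
    have hs : s ≠ 0 := hs
    have h2 : functionalDeriv ha hι hψ (u + s • ξ) - functionalDeriv ha hι hψ u
        = s • innerSL ℝ (signIsometry ha ξ)
          + (hψ.gradient hι (u + s • ξ) - hψ.gradient hι u) := by
      simp only [functionalDeriv, map_add, map_smul]; abel
    rw [h2, smul_add, smul_smul, inv_mul_cancel₀ hs, one_smul]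
  continuous := fun ξ => continuous_const.add (hψ.continuous_hessian_apply hι ξ)

/-- `J'(u)[u + 2χ] - J''(u)[u + χ, u + χ]` is bounded from below by `(1 - κ/a) ‖χ‖²`, and is not
zero when `χ = 0`, because of the strict monotonicity of `g`. -/
theorem functionalHessian_lt (ha : 0 < a) (hκ : 0 ≤ κ) (hκa : κ < a) (hW : ∀ᵐ x, |W x| ≤ κ)
    (hg : IsAdmissible g) (hι : IsCubicEmbedding (toL2 a) K)
    (hψ : IsCubicPotential (volume : Measure Space) (diracPotential W g) (diracField W g)
      (diracHessian W g) C) {u : E a} (hu : u ≠ 0) {χ : E a} (hχ : χ ∈ EMinus a) :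
    functionalHessian ha hι hψ u (u + χ) (u + χ)
      < functionalDeriv ha hι hψ u (u + (2 : ℝ) • χ) := by
  obtain ⟨Cg, hCg⟩ := hg.exists_profile
  have hS : signIsometry ha χ = -χ := (mem_EMinus_iff ha).mp hχ
  set k : Space → ℝ := fun x => inner ℝ (diracField W g x (toL2 a u x)) (toL2 a (u + (2 : ℝ) • χ) x)
    - inner ℝ (diracHessian W g x (toL2 a u x) (toL2 a (u + χ) x)) (toL2 a (u + χ) x) with hk
  have hi1 := (hψ.isControlled_field (ι := toL2 a) u).integrable hι (u + (2 : ℝ) • χ)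
  have hi2 := (hψ.isControlled_deriv (ι := toL2 a) u (u + χ)).integrable hι (u + χ)
  have hki : Integrable k := hi1.sub hi2
  have h1 : functionalDeriv ha hι hψ u (u + (2 : ℝ) • χ)
      - functionalHessian ha hι hψ u (u + χ) (u + χ) = ‖χ‖ ^ 2 + ∫ x, k x := by
    have h2 : inner ℝ (signIsometry ha χ) u = inner ℝ (signIsometry ha u) χ := by
      rw [inner_signIsometry_left, real_inner_comm]
    simp only [functionalDeriv, functionalHessian, add_apply, isometryForm_apply,
      innerSL_apply_apply, hk]
    rw [integral_sub hi1 hi2, hψ.gradient_apply, hψ.hessian_apply_apply]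
    simp only [map_add, inner_add_left, inner_add_right, real_inner_smul_right, h2]
    rw [hS, inner_neg_left, real_inner_self_eq_norm_sq]
    ring
  have hkx : ∀ᵐ x, k x = -(W x * ‖toL2 a χ x‖ ^ 2)
      + (inner ℝ (radialDeriv (g x) (toL2 a u x) (toL2 a u x + toL2 a χ x))
          (toL2 a u x + toL2 a χ x)
        - inner ℝ (radialField (g x) (toL2 a u x)) (toL2 a u x + (2 : ℝ) • toL2 a χ x)) := by
    have h3 : toL2 a (u + (2 : ℝ) • χ) =ᵐ[volume] fun x => toL2 a u x + (2 : ℝ) • toL2 a χ x := by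
      rw [map_add, map_smul]
      filter_upwards [Lp.coeFn_add (toL2 a u) ((2 : ℝ) • toL2 a χ),
        Lp.coeFn_smul (2 : ℝ) (toL2 a χ)] with x h4 h5
      rw [h4, Pi.add_apply, h5, Pi.smul_apply]
    have h4 : toL2 a (u + χ) =ᵐ[volume] fun x => toL2 a u x + toL2 a χ x := by
      rw [map_add]; exact Lp.coeFn_add _ _
    filter_upwards [h3, h4] with x h5 h6
    simp only [hk, h5, h6, diracField, diracHessian, sub_apply, smul_apply,
      ContinuousLinearMap.id_apply]
    simp only [inner_sub_left, inner_add_left, inner_add_right, smul_add, real_inner_smul_left,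
      real_inner_smul_right, real_inner_self_eq_norm_sq, real_inner_comm (toL2 a u x) (toL2 a χ x)]
    ring
  rcases eq_or_ne χ 0 with h0 | h0
  · have hz : ∀ᵐ x, toL2 a χ x = 0 := by
      rw [h0, map_zero]; exact Lp.coeFn_zero _ _ _
    have hk' : ∀ᵐ x, k x = inner ℝ (radialDeriv (g x) (toL2 a u x) (toL2 a u x)) (toL2 a u x)
        - inner ℝ (radialField (g x) (toL2 a u x)) (toL2 a u x) := by
      filter_upwards [hkx, hz] with x h2 h3
      rw [h2, h3]; simp
    have hk0 : 0 ≤ᵐ[volume] k := by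
      filter_upwards [hk'] with x h2
      rw [h2]
      rcases eq_or_ne (toL2 a u x) 0 with h3 | h3
      · simp [h3]
      · exact (sub_pos.mpr ((hCg x).inner_radialField_lt h3)).le
    have hpos : 0 < ∫ x, k x := by
      refine lt_of_le_of_ne (integral_nonneg_of_ae hk0) fun h2 => hu ?_
      apply toL2_injective a
      rw [map_zero, Lp.eq_zero_iff_ae_eq_zero]
      filter_upwards [hk', (integral_eq_zero_iff_of_nonneg_ae hk0 hki).mp h2.symm] with x h3 h4
      by_contra h5
      have h6 := sub_pos.mpr ((hCg x).inner_radialField_lt h5)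
      rw [← h3, h4] at h6
      exact lt_irrefl _ h6
    have h2 : 0 ≤ ‖χ‖ ^ 2 := by positivity
    linarith
  · have hk1 : ∫ x, -(κ * ‖toL2 a χ x‖ ^ 2) ≤ ∫ x, k x := by
      refine integral_mono_ae ((Lp.memLp (toL2 a χ)).norm.integrable_sq.const_mul κ).neg hki ?_
      filter_upwards [hkx, hW] with x h2 h3
      have h4 := (hCg x).inner_radialField_le (toL2 a u x) (toL2 a χ x)
      have h5 : W x * ‖toL2 a χ x‖ ^ 2 ≤ κ * ‖toL2 a χ x‖ ^ 2 :=
        mul_le_mul_of_nonneg_right ((le_abs_self _).trans h3) (by positivity)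
      rw [h2]
      linarith
    rw [integral_neg, integral_const_mul] at hk1
    have h5 := mul_le_mul_of_nonneg_left (integral_sq_toL2_le ha χ) hκ
    have h6 : κ * (‖χ‖ ^ 2 / a) = κ / a * ‖χ‖ ^ 2 := by ring
    have h7 : 0 < (1 - κ / a) * ‖χ‖ ^ 2 := by
      have : 0 < 1 - κ / a := by rw [sub_pos, div_lt_one ha]; exact hκa
      have := norm_pos_iff.mpr h0
      positivity
    linarith

theorem disjoint_EPlus_EMinus (ha : 0 < a) : Disjoint (EPlus a) (EMinus a) := by
  rw [Submodule.disjoint_def]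
  intro u hP hM
  have h1 := (mem_EPlus_iff ha).mp hP
  rw [(mem_EMinus_iff ha).mp hM] at h1
  rw [neg_eq_iff_add_eq_zero, ← two_smul ℝ u] at h1
  exact (smul_eq_zero.mp h1).resolve_left two_ne_zero

theorem exists_bound_of_eLpNorm_lt {W : Space → ℝ}
    (hW : eLpNorm W ∞ volume < ENNReal.ofReal a) : ∃ κ, 0 ≤ κ ∧ κ < a ∧ ∀ᵐ x, |W x| ≤ κ := by
  refine ⟨(eLpNorm W ∞ volume).toReal, ENNReal.toReal_nonneg, ?_, ?_⟩
  · rwa [← ENNReal.lt_ofReal_iff_toReal_lt hW.ne_top]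
  · filter_upwards [ae_le_eLpNormEssSup (f := W) (μ := volume)] with x hx
    rw [eLpNorm_exponent_top] at hW ⊢
    rw [← Real.norm_eq_abs, ← toReal_enorm]
    exact ENNReal.toReal_mono hW.ne_top hx

end Functional

end NonlinearDirac

end

theorem lemma3p6 (a : ℝ) (ha : 0 < a) (W : NonlinearDirac.Space → ℝ)
    (hWm : AEMeasurable W volume) (hW : eLpNorm W ∞ volume < ENNReal.ofReal a)
    (g : NonlinearDirac.Space → ℝ → ℝ) (hg : NonlinearDirac.IsAdmissible g)
    (J : NonlinearDirac.E a → ℝ) (hJ : J = NonlinearDirac.functional a W g)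
    (I : NonlinearDirac.EPlus a → ℝ) (hI : I = NonlinearDirac.reducedFunctional J) :
    -- the reduced functional is well defined, and the derivatives exist
    Differentiable ℝ J ∧
    (∀ (v : NonlinearDirac.EPlus a) (w : NonlinearDirac.EMinus a),
      NonlinearDirac.IsCriticalAlongMinus J v w ↔ w = NonlinearDirac.reductionMap J v) ∧
    Differentiable ℝ I ∧
    -- the claim
    ∀ v : NonlinearDirac.EPlus a, v ≠ 0 →
      ContDiff ℝ 1 (fun t : ℝ => I (t • v) - t / 2 * fderiv ℝ I (t • v) v) ∧
      ∀ t : ℝ, 0 < t →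
        0 < deriv (fun s : ℝ => I (s • v) - s / 2 * fderiv ℝ I (s • v) v) t := by
  open NonlinearDirac in
  obtain ⟨κ, hκ, hκa, hWκ⟩ := exists_bound_of_eLpNorm_lt hW
  obtain ⟨K, hι⟩ := exists_isCubicEmbedding_toL2 ha
  obtain ⟨C, hψ⟩ := isCubicPotential_dirac hWm hκ hWκ hg
  have hR := isReducible_functional ha hWm hκ hκa hWκ hg hι hψ
  rw [← hJ] at hR
  have := completeSpace_E ha
  have : CompleteSpace (EMinus a) := (isClosed_EMinus ha).completeSpace_coe
  have hcrit : ∀ (v : EPlus a) (w : EMinus a), IsCriticalAlongMinus J v w ↔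
      ∀ φ ∈ EMinus a, functionalDeriv ha hι hψ ((v : E a) + w) φ = 0 := fun v w => by
    rw [IsCriticalAlongMinus, (hR.hasFDerivAt _).fderiv]
    exact Subtype.forall
  have hred : ∀ v : EPlus a, IsCriticalAlongMinus J v (reductionMap J v) := fun v => by
    obtain ⟨w, hw⟩ := hR.exists_critical (v : E a)
    exact Classical.epsilon_spec (p := fun w => IsCriticalAlongMinus J v w)
      ⟨w, (hcrit v w).mpr hw⟩
  have hh := fun v : EPlus a => (hcrit v _).mp (hred v)
  have hIder : ∀ v : EPlus a, HasFDerivAt I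
      ((functionalDeriv ha hι hψ ((v : E a) + reductionMap J v)).comp (EPlus a).subtypeL) v := by
    rw [hI]; exact hR.hasFDerivAt_reduced hh
  have hH : ∀ v : EPlus a, (fun t : ℝ => I (t • v) - t / 2 * fderiv ℝ I (t • v) v) =
      fun t : ℝ => J (((t • v : EPlus a) : E a) + reductionMap J (t • v)) - t / 2 *
        functionalDeriv ha hι hψ (((t • v : EPlus a) : E a) + reductionMap J (t • v)) v := by
    intro v
    funext t
    rw [(hIder (t • v)).fderiv, hI]
    rfl
  refine ⟨fun u => (hR.hasFDerivAt u).differentiableAt, fun v w => ⟨fun hw => ?_, ?_⟩,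
    fun v => (hIder v).differentiableAt, fun v hv => ⟨?_, fun t ht => ?_⟩⟩
  · exact hR.critical_unique ((hcrit v w).mp hw) (hh v)
  · rintro rfl
    exact hred v
  · rw [hH v]
    exact hR.contDiff_reduced_sub hh v
  · rw [hH v]
    exact hR.deriv_reduced_sub_pos hh (disjoint_EPlus_EMinus ha)
      (fun u hu χ hχ => functionalHessian_lt ha hκ hκa hWκ hg hι hψ hu hχ) hv ht
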